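/- Let $k$ be a commutative ring, let $\mathbf A$ be a dg-category over $k$ (cohomological grading), and let $\kappa$ be an (infinite) regular cardinal. Assume that $\mathbf A$ is cohomologically concentrated in nonpositive degrees, i.e. $H^n(\mathbf A(X,Y))=0$ for all objects $X,Y$ and all $n>0$, and that the homotopy category $H^0(\mathbf A)$ is additive. Let $\mathrm{Tw}(\mathbf A)$ be the dg-category of one-sided unbounded twisted complexes on $\mathbf A$. It is defined as follows. If $\mathbf B$ is a dg-category strictly concentrated in nonpositive degrees and with a strict zero object, then an object of $\mathrm{Tw}(\mathbf B)$ is a family $(X^i)_{i\in\mathbb Z}$ of objects of $\mathbf B$ with morphisms $x_i^j\colon X^i\to X^j$ of degree $i-j+1$ such that $(-1)^j dx_i^j+\sum_l x_l^jx_i^l=0$; a morphism of degree $p$ is a family $f_i^j\colon X^i\to Y^j$ of morphisms of degree $i-j+p$, with differential $(df)_i^j=(-1)^jdf_i^j+\sum_l\bigl(y_l^jf_i^l-(-1)^pf_l^jx_i^l\bigr)$, and composition is $(gf)_i^j=\sum_l g_l^jf_i^l$. For an arbitrary dg-category $\mathbf A$ one sets $\mathrm{Tw}(\mathbf A)=\mathrm{Tw}(\tau_{\le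 0}\mathbf A_{\{0\}})$, where $\mathbf A_{\{0\}}$ is $\mathbf A$ with a strict zero object formally added and $\tau_{\le0}$ is the left truncation of all complexes of morphisms. Then: 1. $\mathrm{Tw}(\mathbf A)$ is pretriangulated, i.e. the Yoneda embedding of $\mathrm{Tw}(\mathbf A)$ into its pretriangulated hull (the closure of the representable right dg-modules under shifts and mapping cones, a full dg-subcategory of the dg-category of right dg-modules) is a quasi-equivalence. 2. If the graded cohomology category $H^*(\mathbf A)$ has direct sums indexed by sets of cardinality $\le\kappa$, then so does $H^*(\mathrm{Tw}(\mathbf A))$; if $H^*(\mathbf A)$ has direct products indexed by sets of cardinality $\le\kappa$, then so does $H^*(\mathrm{Tw}(\mathbf A))$. (Direct sums and products in a graded category are meant in the graded sense: for instance $P$ with degree $0$ projections $P\to X_s$ is a product of the $X_s$ if $\mathrm{Hom}^n(Y,P)\to\prod_s\mathrm{Hom}^n(Y,X_s)$ is bijective for all objects $Y$ and all $n\in\mathbb Z$.) -/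

import Mathlib

universe w u v u' v' t

/-! ### Graded categories and dg-categories over a commutative ring -/

/-- The sign `(-1) ^ n`, as an element of the base ring. -/
def dgSign (k : Type w) [CommRing k] (n : ℤ) : k := ((n.negOnePow : ℤ) : k)

section Sign
variable (k : Type w) [CommRing k]

theorem dgSign_zero : dgSign k 0 = 1 := by simp [dgSign]

theorem dgSign_one : dgSign k 1 = -1 := by simp [dgSign]

theorem dgSign_add (m n : ℤ) : dgSign k (m + n) = dgSign k m * dgSign k n := by
  simp [dgSign, Int.negOnePow_add]

theorem dgSign_mul_self (n : ℤ) : dgSign k n * dgSign k n = 1 := by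
  rw [← dgSign_add, dgSign, Int.negOnePow_even _ ⟨n, rfl⟩]; simp

theorem dgSign_succ (n : ℤ) : dgSign k (n + 1) = -dgSign k n := by
  rw [dgSign_add, dgSign_one]; ring

end Sign

/-- A graded category over `k`: a category enriched in `ℤ`-graded `k`-modules.
`Hom X Y n` is the module of morphisms `X ⟶ Y` of degree `n`, and `comp g f h` is `g ∘ f`;
the proof `h` says that the degrees add up. -/
structure GradedCat (k : Type w) [CommRing k] where
  Obj : Type u
  Hom : Obj → Obj → ℤ → Type v
  [homAddCommGroup : ∀ X Y n, AddCommGroup (Hom X Y n)]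
  [homModule : ∀ X Y n, Module k (Hom X Y n)]
  id : ∀ X, Hom X X 0
  comp : ∀ {X Y Z : Obj} {p q n : ℤ}, Hom Y Z p → Hom X Y q → p + q = n → Hom X Z n
  add_comp : ∀ {X Y Z : Obj} {p q n : ℤ} (g g' : Hom Y Z p) (f : Hom X Y q) (h : p + q = n),
    comp (g + g') f h = comp g f h + comp g' f h
  smul_comp : ∀ {X Y Z : Obj} {p q n : ℤ} (a : k) (g : Hom Y Z p) (f : Hom X Y q)
    (h : p + q = n), comp (a • g) f h = a • comp g f h
  comp_add : ∀ {X Y Z : Obj} {p q n : ℤ} (g : Hom Y Z p) (f f' : Hom X Y q) (h : p + q = n),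
    comp g (f + f') h = comp g f h + comp g f' h
  comp_smul : ∀ {X Y Z : Obj} {p q n : ℤ} (a : k) (g : Hom Y Z p) (f : Hom X Y q)
    (h : p + q = n), comp g (a • f) h = a • comp g f h
  id_comp : ∀ {X Y : Obj} {n : ℤ} (f : Hom X Y n), comp (id Y) f (zero_add n) = f
  comp_id : ∀ {X Y : Obj} {n : ℤ} (f : Hom X Y n), comp f (id X) (add_zero n) = f
  assoc : ∀ {W X Y Z : Obj} {a b c ab bc n : ℤ} (h : Hom Y Z a) (g : Hom X Y b) (f : Hom W X c)
    (hab : a + b = ab) (hbc : b + c = bc) (h₁ : ab + c = n) (h₂ : a + bc = n),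
    comp (comp h g hab) f h₁ = comp h (comp g f hbc) h₂

attribute [instance] GradedCat.homAddCommGroup GradedCat.homModule

namespace GradedCat

variable {k : Type w} [CommRing k] (G : GradedCat.{w, u, v} k)

/-- Composition as a bilinear map. -/
def compL {X Y Z : G.Obj} {p q n : ℤ} (h : p + q = n) :
    G.Hom Y Z p →ₗ[k] G.Hom X Y q →ₗ[k] G.Hom X Z n :=
  LinearMap.mk₂ k (fun g f => G.comp g f h) (fun g g' f => G.add_comp g g' f h)
    (fun a g f => G.smul_comp a g f h) (fun g f f' => G.comp_add g f f' h)
    (fun a g f => G.comp_smul a g f h)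

variable {G}

theorem zero_comp {X Y Z : G.Obj} {p q n : ℤ} (f : G.Hom X Y q) (h : p + q = n) :
    G.comp (0 : G.Hom Y Z p) f h = 0 := (G.compL h).map_zero₂ f

theorem comp_zero {X Y Z : G.Obj} {p q n : ℤ} (g : G.Hom Y Z p) (h : p + q = n) :
    G.comp g (0 : G.Hom X Y q) h = 0 := (G.compL h g).map_zero

theorem neg_comp {X Y Z : G.Obj} {p q n : ℤ} (g : G.Hom Y Z p) (f : G.Hom X Y q)
    (h : p + q = n) : G.comp (-g) f h = -G.comp g f h := (G.compL h).map_neg₂ g f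

theorem comp_neg {X Y Z : G.Obj} {p q n : ℤ} (g : G.Hom Y Z p) (f : G.Hom X Y q)
    (h : p + q = n) : G.comp g (-f) h = -G.comp g f h := (G.compL h g).map_neg f

theorem sub_comp {X Y Z : G.Obj} {p q n : ℤ} (g g' : G.Hom Y Z p) (f : G.Hom X Y q)
    (h : p + q = n) : G.comp (g - g') f h = G.comp g f h - G.comp g' f h :=
  (G.compL h).map_sub₂ g g' f

theorem comp_sub {X Y Z : G.Obj} {p q n : ℤ} (g : G.Hom Y Z p) (f f' : G.Hom X Y q)
    (h : p + q = n) : G.comp g (f - f') h = G.comp g f h - G.comp g f' h :=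
  (G.compL h g).map_sub f f'

theorem sum_comp {ι : Type*} {X Y Z : G.Obj} {p q n : ℤ} (s : Finset ι) (g : ι → G.Hom Y Z p)
    (f : G.Hom X Y q) (h : p + q = n) :
    G.comp (∑ i ∈ s, g i) f h = ∑ i ∈ s, G.comp (g i) f h :=
  (G.compL h).map_sum₂ s g f

theorem comp_sum {ι : Type*} {X Y Z : G.Obj} {p q n : ℤ} (s : Finset ι) (g : G.Hom Y Z p)
    (f : ι → G.Hom X Y q) (h : p + q = n) :
    G.comp g (∑ i ∈ s, f i) h = ∑ i ∈ s, G.comp g (f i) h :=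
  map_sum (G.compL h g) f s

variable (G)

/-- The ordinary category of degree `0` morphisms of a graded category: its objects. -/
def DegZero : Type u := G.Obj

instance : CategoryTheory.Category.{v} G.DegZero where
  Hom X Y := G.Hom X Y 0
  id X := G.id X
  comp f g := G.comp g f (add_zero 0)
  id_comp f := G.comp_id f
  comp_id f := G.id_comp f
  assoc f g h := (G.assoc h g f _ _ _ _).symm

instance : CategoryTheory.Preadditive G.DegZero where
  homGroup X Y := G.homAddCommGroup X Y 0
  add_comp _ _ _ f f' g := G.comp_add g f f' _
  comp_add _ _ _ f g g' := G.add_comp g g' f _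

/-- `G` has direct products indexed by sets of cardinality `≤ κ`: every such family `X` has a
product `P`, with degree `0` projections `π s`, in the sense of graded categories, i.e.
`Hom(Y, P) → ∏ s, Hom(Y, X s)` is an isomorphism of graded modules for every `Y`. -/
def HasProductsLE (κ : Cardinal.{t}) : Prop :=
  ∀ (I : Type t), Cardinal.mk I ≤ κ → ∀ X : I → G.Obj,
    ∃ (P : G.Obj) (π : ∀ s, G.Hom P (X s) 0), ∀ (Y : G.Obj) (n : ℤ),
      Function.Bijective fun (f : G.Hom Y P n) (s : I) => G.comp (π s) f (zero_add n)

/-- `G` has direct sums (coproducts) indexed by sets of cardinality `≤ κ`, in the sense of graded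
categories: `Hom(C, Y) → ∏ s, Hom(X s, Y)` is an isomorphism of graded modules for every `Y`. -/
def HasCoproductsLE (κ : Cardinal.{t}) : Prop :=
  ∀ (I : Type t), Cardinal.mk I ≤ κ → ∀ X : I → G.Obj,
    ∃ (C : G.Obj) (ι : ∀ s, G.Hom (X s) C 0), ∀ (Y : G.Obj) (n : ℤ),
      Function.Bijective fun (f : G.Hom C Y n) (s : I) => G.comp f (ι s) (add_zero n)

end GradedCat

/-- A dg-category over `k`: a graded category with differentials `d : Hom X Y n → Hom X Y (n + 1)`,
`d ∘ d = 0`, satisfying the Leibniz rule `d (g ∘ f) = dg ∘ f + (-1) ^ |g| g ∘ df`.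
(The equality `d (id X) = 0` follows, see `DGCat.d_id`.) -/
structure DGCat (k : Type w) [CommRing k] extends GradedCat.{w, u, v} k where
  d : ∀ {X Y : Obj} (n m : ℤ), n + 1 = m → Hom X Y n →ₗ[k] Hom X Y m
  d_d : ∀ {X Y : Obj} {n m l : ℤ} (h : n + 1 = m) (h' : m + 1 = l) (f : Hom X Y n),
    d m l h' (d n m h f) = 0
  d_comp : ∀ {X Y Z : Obj} {p q n p' q' n' : ℤ} (g : Hom Y Z p) (f : Hom X Y q)
    (h : p + q = n) (hn : n + 1 = n') (hp : p + 1 = p') (hq : q + 1 = q')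
    (h₁ : p' + q = n') (h₂ : p + q' = n'),
    d n n' hn (comp g f h) = comp (d p p' hp g) f h₁ + dgSign k p • comp g (d q q' hq f) h₂

namespace DGCat

section Cohomology

variable {k : Type w} [CommRing k] (A : DGCat.{w, u, v} k)

theorem d_id (X : A.Obj) : A.d 0 1 (zero_add 1) (A.id X) = 0 := by
  have h := A.d_comp (A.id X) (A.id X) (add_zero 0) (zero_add 1) (zero_add 1) (zero_add 1)
    (add_zero 1) (zero_add 1)
  rw [A.id_comp, A.comp_id, dgSign_zero, one_smul, A.id_comp] at h
  simpa using h

/-- Closed morphisms of degree `n`. -/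
def cocycles (X Y : A.Obj) (n : ℤ) : Submodule k (A.Hom X Y n) :=
  LinearMap.ker (A.d n (n + 1) rfl)

/-- Exact morphisms of degree `n`. -/
def coboundaries (X Y : A.Obj) (n : ℤ) : Submodule k (A.Hom X Y n) :=
  LinearMap.range (A.d (X := X) (Y := Y) (n - 1) n (sub_add_cancel n 1))

/-- The cohomology `H^n` of the complex of morphisms. -/
abbrev HomH (X Y : A.Obj) (n : ℤ) : Type v :=
  A.cocycles X Y n ⧸ (A.coboundaries X Y n).submoduleOf (A.cocycles X Y n)

/-- The cohomology class of a closed morphism. -/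
def mkH {X Y : A.Obj} {n : ℤ} (f : A.cocycles X Y n) : A.HomH X Y n :=
  Submodule.Quotient.mk f

variable {A}

theorem d_of_mem {X Y : A.Obj} {n m : ℤ} (h : n + 1 = m) {f : A.Hom X Y n}
    (hf : f ∈ A.cocycles X Y n) : A.d n m h f = 0 := by
  subst h; exact hf

theorem mem_coboundaries {X Y : A.Obj} {m n : ℤ} (h : m + 1 = n) (e : A.Hom X Y m) :
    A.d m n h e ∈ A.coboundaries X Y n := by
  obtain rfl : m = n - 1 := by omega
  exact ⟨e, rfl⟩

theorem mkH_surjective {X Y : A.Obj} {n : ℤ} : Function.Surjective (A.mkH (X := X) (Y := Y) (n := n)) :=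
  Submodule.Quotient.mk_surjective _

theorem comp_mem {X Y Z : A.Obj} {p q n : ℤ} (g : A.cocycles Y Z p) (f : A.cocycles X Y q)
    (h : p + q = n) : A.comp g.1 f.1 h ∈ A.cocycles X Z n := by
  change A.d _ _ _ _ = 0
  rw [A.d_comp g.1 f.1 h rfl rfl rfl (by omega) (by omega), d_of_mem _ g.2, d_of_mem _ f.2,
    GradedCat.zero_comp, GradedCat.comp_zero, smul_zero, add_zero]

theorem comp_mem_coboundaries_left {X Y Z : A.Obj} {p q n : ℤ} {g : A.Hom Y Z p}
    {f : A.Hom X Y q} (hg : g ∈ A.coboundaries Y Z p) (hf : f ∈ A.cocycles X Y q)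
    (h : p + q = n) : A.comp g f h ∈ A.coboundaries X Z n := by
  obtain ⟨e, rfl⟩ := hg
  have := A.d_comp e f (n := n - 1) (n' := n) (by omega) (by omega) (sub_add_cancel p 1) rfl h
    (by omega)
  rw [d_of_mem _ hf, GradedCat.comp_zero, smul_zero, add_zero] at this
  rw [← this]
  exact mem_coboundaries _ _

theorem comp_mem_coboundaries_right {X Y Z : A.Obj} {p q n : ℤ} {g : A.Hom Y Z p}
    {f : A.Hom X Y q} (hg : g ∈ A.cocycles Y Z p) (hf : f ∈ A.coboundaries X Y q)
    (h : p + q = n) : A.comp g f h ∈ A.coboundaries X Z n := by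
  obtain ⟨e, rfl⟩ := hf
  have := A.d_comp g e (n := n - 1) (n' := n) (by omega) (by omega) rfl (sub_add_cancel q 1)
    (by omega) h
  rw [d_of_mem _ hg, GradedCat.zero_comp, zero_add] at this
  have h2 : A.comp g (A.d (q - 1) q (sub_add_cancel q 1) e) h
      = dgSign k p • A.d (n - 1) n (by omega) (A.comp g e (by omega)) := by
    rw [this, smul_smul, dgSign_mul_self, one_smul]
  rw [h2]
  exact Submodule.smul_mem _ _ (mem_coboundaries _ _)

variable (A)

/-- Composition of cohomology classes. -/
def compH {X Y Z : A.Obj} {p q n : ℤ} (g : A.HomH Y Z p) (f : A.HomH X Y q) (h : p + q = n) :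
    A.HomH X Z n :=
  Quotient.map₂ (fun g f => ⟨A.comp g.1 f.1 h, comp_mem g f h⟩) (by
    intro g g' hg f f' hf
    replace hg := (Submodule.quotientRel_def _).1 hg
    replace hf := (Submodule.quotientRel_def _).1 hf
    refine (Submodule.quotientRel_def _).2 ?_
    have h1 := comp_mem_coboundaries_left (f := f.1) hg f.2 h
    have h2 := comp_mem_coboundaries_right (g := g'.1) g'.2 hf h
    have h3 := Submodule.add_mem _ h1 h2
    change A.comp g.1 f.1 h - A.comp g'.1 f'.1 h ∈ A.coboundaries X Z n
    convert h3 using 1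
    change _ = A.comp (g.1 - g'.1) f.1 h + A.comp g'.1 (f.1 - f'.1) h
    rw [GradedCat.sub_comp, GradedCat.comp_sub]
    abel) g f

/-- The graded cohomology category `H^*(A)`. -/
def cohomology : GradedCat.{w, u, v} k where
  Obj := A.Obj
  Hom := A.HomH
  id X := A.mkH ⟨A.id X, A.d_id X⟩
  comp := A.compH
  add_comp g g' f h := by
    obtain ⟨g, rfl⟩ := mkH_surjective g
    obtain ⟨g', rfl⟩ := mkH_surjective g'
    obtain ⟨f, rfl⟩ := mkH_surjective f
    exact congrArg A.mkH (Subtype.ext (A.add_comp g.1 g'.1 f.1 h))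
  smul_comp a g f h := by
    obtain ⟨g, rfl⟩ := mkH_surjective g
    obtain ⟨f, rfl⟩ := mkH_surjective f
    exact congrArg A.mkH (Subtype.ext (A.smul_comp a g.1 f.1 h))
  comp_add g f f' h := by
    obtain ⟨g, rfl⟩ := mkH_surjective g
    obtain ⟨f, rfl⟩ := mkH_surjective f
    obtain ⟨f', rfl⟩ := mkH_surjective f'
    exact congrArg A.mkH (Subtype.ext (A.comp_add g.1 f.1 f'.1 h))
  comp_smul a g f h := by
    obtain ⟨g, rfl⟩ := mkH_surjective g
    obtain ⟨f, rfl⟩ := mkH_surjective f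
    exact congrArg A.mkH (Subtype.ext (A.comp_smul a g.1 f.1 h))
  id_comp f := by
    obtain ⟨f, rfl⟩ := mkH_surjective f
    exact congrArg A.mkH (Subtype.ext (A.id_comp f.1))
  comp_id f := by
    obtain ⟨f, rfl⟩ := mkH_surjective f
    exact congrArg A.mkH (Subtype.ext (A.comp_id f.1))
  assoc h g f h₁ h₂ h₃ h₄ := by
    obtain ⟨h, rfl⟩ := mkH_surjective h
    obtain ⟨g, rfl⟩ := mkH_surjective g
    obtain ⟨f, rfl⟩ := mkH_surjective f
    exact congrArg A.mkH (Subtype.ext (A.assoc h.1 g.1 f.1 h₁ h₂ h₃ h₄))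

/-- The homotopy category `H^0(A)`, an ordinary preadditive category. -/
abbrev H0 : Type u := A.cohomology.DegZero

/-- `A` is strictly concentrated in nonpositive degrees. -/
def IsNonpositive : Prop := ∀ (X Y : A.Obj) (n : ℤ), 0 < n → ∀ f : A.Hom X Y n, f = 0

/-- `A` is cohomologically concentrated in nonpositive degrees. -/
def IsCohNonpositive : Prop := ∀ (X Y : A.Obj) (n : ℤ), 0 < n → ∀ f : A.HomH X Y n, f = 0

/-- The full dg-subcategory of `A` on the objects satisfying `P`. -/
def full (P : A.Obj → Prop) : DGCat.{w, u, v} k where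
  Obj := {X : A.Obj // P X}
  Hom X Y n := A.Hom X.1 Y.1 n
  id X := A.id X.1
  comp := A.comp
  add_comp := A.add_comp
  smul_comp := A.smul_comp
  comp_add := A.comp_add
  comp_smul := A.comp_smul
  id_comp := A.id_comp
  comp_id := A.comp_id
  assoc := A.assoc
  d := A.d
  d_d := A.d_d
  d_comp := A.d_comp

end Cohomology

end DGCat

/-! ### Dg-functors and quasi-equivalences -/

/-- Dg-functors. -/
structure DGFunctor {k : Type w} [CommRing k] (A : DGCat.{w, u, v} k) (B : DGCat.{w, u', v'} k)
    where
  obj : A.Obj → B.Obj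
  map : ∀ {X Y : A.Obj} {n : ℤ}, A.Hom X Y n →ₗ[k] B.Hom (obj X) (obj Y) n
  map_id : ∀ X, map (A.id X) = B.id (obj X)
  map_comp : ∀ {X Y Z : A.Obj} {p q n : ℤ} (g : A.Hom Y Z p) (f : A.Hom X Y q) (h : p + q = n),
    map (A.comp g f h) = B.comp (map g) (map f) h
  map_d : ∀ {X Y : A.Obj} {n m : ℤ} (h : n + 1 = m) (f : A.Hom X Y n),
    map (A.d n m h f) = B.d n m h (map f)

namespace DGFunctor

variable {k : Type w} [CommRing k] {A : DGCat.{w, u, v} k} {B : DGCat.{w, u', v'} k}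
  (F : DGFunctor A B)

/-- The map induced on closed morphisms. -/
def mapZ (X Y : A.Obj) (n : ℤ) : A.cocycles X Y n →ₗ[k] B.cocycles (F.obj X) (F.obj Y) n :=
  F.map.restrict (fun f hf => by
    change B.d _ _ _ _ = 0
    rw [← F.map_d, DGCat.d_of_mem _ hf, map_zero])

/-- The map induced on the cohomology of the complexes of morphisms. -/
def mapH (X Y : A.Obj) (n : ℤ) : A.HomH X Y n →ₗ[k] B.HomH (F.obj X) (F.obj Y) n :=
  Submodule.mapQ _ _ (F.mapZ X Y n) (by
    rintro ⟨f, hf⟩ ⟨e, he⟩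
    exact ⟨F.map e, by rw [← F.map_d, he]; rfl⟩)

/-- The functor induced on homotopy categories. -/
def mapH0 : CategoryTheory.Functor A.H0 B.H0 where
  obj X := F.obj X
  map {X Y} f := F.mapH X Y 0 f
  map_id X := congrArg B.mkH (Subtype.ext (F.map_id X))
  map_comp f g := by
    obtain ⟨f, rfl⟩ := DGCat.mkH_surjective f
    obtain ⟨g, rfl⟩ := DGCat.mkH_surjective g
    exact congrArg B.mkH (Subtype.ext (F.map_comp g.1 f.1 _))

/-- `F` is a quasi-equivalence: it induces isomorphisms on the cohomology of the complexes of
morphisms, and an essentially surjective functor on homotopy categories. -/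
def IsQuasiEquivalence : Prop :=
  (∀ X Y n, Function.Bijective (F.mapH X Y n)) ∧ F.mapH0.EssSurj

end DGFunctor

/-! ### Dg-modules, the Yoneda embedding and the pretriangulated hull -/

/-- Right dg-modules over `A`. -/
structure DGModule {k : Type w} [CommRing k] (A : DGCat.{w, u, v} k) where
  carrier : A.Obj → ℤ → Type v
  [addCommGroup : ∀ X n, AddCommGroup (carrier X n)]
  [module : ∀ X n, Module k (carrier X n)]
  d : ∀ {X : A.Obj} (n m : ℤ), n + 1 = m → carrier X n →ₗ[k] carrier X m
  d_d : ∀ {X : A.Obj} {n m l : ℤ} (h : n + 1 = m) (h' : m + 1 = l) (x : carrier X n),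
    d m l h' (d n m h x) = 0
  act : ∀ {X Y : A.Obj} {p q n : ℤ}, carrier Y p → A.Hom X Y q → p + q = n → carrier X n
  add_act : ∀ {X Y : A.Obj} {p q n : ℤ} (x x' : carrier Y p) (f : A.Hom X Y q) (h : p + q = n),
    act (x + x') f h = act x f h + act x' f h
  smul_act : ∀ {X Y : A.Obj} {p q n : ℤ} (a : k) (x : carrier Y p) (f : A.Hom X Y q)
    (h : p + q = n), act (a • x) f h = a • act x f h
  act_add : ∀ {X Y : A.Obj} {p q n : ℤ} (x : carrier Y p) (f f' : A.Hom X Y q) (h : p + q = n),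
    act x (f + f') h = act x f h + act x f' h
  act_smul : ∀ {X Y : A.Obj} {p q n : ℤ} (a : k) (x : carrier Y p) (f : A.Hom X Y q)
    (h : p + q = n), act x (a • f) h = a • act x f h
  act_id : ∀ {X : A.Obj} {n : ℤ} (x : carrier X n), act x (A.id X) (add_zero n) = x
  act_act : ∀ {X Y Z : A.Obj} {a b c ab bc n : ℤ} (x : carrier Z a) (g : A.Hom Y Z b)
    (f : A.Hom X Y c) (hab : a + b = ab) (hbc : b + c = bc) (h₁ : ab + c = n) (h₂ : a + bc = n),
    act (act x g hab) f h₁ = act x (A.comp g f hbc) h₂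
  d_act : ∀ {X Y : A.Obj} {p q n p' q' n' : ℤ} (x : carrier Y p) (f : A.Hom X Y q)
    (h : p + q = n) (hn : n + 1 = n') (hp : p + 1 = p') (hq : q + 1 = q')
    (h₁ : p' + q = n') (h₂ : p + q' = n'),
    d n n' hn (act x f h) = act (d p p' hp x) f h₁ + dgSign k p • act x (A.d q q' hq f) h₂

attribute [instance] DGModule.addCommGroup DGModule.module

namespace DGModule

variable {k : Type w} [CommRing k] {A : DGCat.{w, u, v} k}

theorem zero_act (M : DGModule A) {X Y : A.Obj} {p q n : ℤ} (f : A.Hom X Y q) (h : p + q = n) :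
    M.act (0 : M.carrier Y p) f h = 0 := by
  have := M.smul_act 0 (0 : M.carrier Y p) f h
  rwa [zero_smul, zero_smul] at this

/-- Degree `n` morphisms of right dg-modules: families of maps `M(X)^i → N(X)^(i + n)` commuting
with the right action of `A` (and not necessarily with the differentials). -/
def homSubmodule (M N : DGModule A) (n : ℤ) :
    Submodule k (∀ (X : A.Obj) (i : ℤ), M.carrier X i →ₗ[k] N.carrier X (i + n)) where
  carrier := {φ | ∀ (X Y : A.Obj) (p q r : ℤ) (x : M.carrier Y p) (f : A.Hom X Y q)
    (h : p + q = r), φ X r (M.act x f h) = N.act (φ Y p x) f (by omega)}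
  add_mem' {φ ψ} hφ hψ X Y p q r x f h := by
    simp only [Pi.add_apply, LinearMap.add_apply]
    rw [hφ X Y p q r x f h, hψ X Y p q r x f h, N.add_act]
  zero_mem' X Y p q r x f h := (N.zero_act f _).symm
  smul_mem' a φ hφ X Y p q r x f h := by
    simp only [Pi.smul_apply, LinearMap.smul_apply]
    rw [hφ X Y p q r x f h, N.smul_act]

/-- `HomDG M N n` is the module of degree `n` morphisms of right dg-modules `M ⟶ N`. -/
abbrev HomDG (M N : DGModule A) (n : ℤ) : Type (max u v) := M.homSubmodule N n

/-- The component `M(X)^i → N(X)^j` of a morphism of degree `n`, where `i + n = j`. -/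
def HomDG.app {M N : DGModule A} {n : ℤ} (φ : HomDG M N n) {X : A.Obj} (i j : ℤ) (h : i + n = j) :
    M.carrier X i →ₗ[k] N.carrier X j := h ▸ φ.1 X i

/-- Constructor for morphisms of dg-modules. -/
def HomDG.mk {M N : DGModule A} {n : ℤ}
    (φ : ∀ (X : A.Obj) (i j : ℤ), i + n = j → M.carrier X i →ₗ[k] N.carrier X j)
    (hφ : ∀ (X Y : A.Obj) (p q r p' r' : ℤ) (x : M.carrier Y p) (f : A.Hom X Y q)
      (h : p + q = r) (hp : p + n = p') (hr : r + n = r') (h' : p' + q = r'),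
      φ X r r' hr (M.act x f h) = N.act (φ Y p p' hp x) f h') : HomDG M N n :=
  ⟨fun X i => φ X i (i + n) rfl, fun X Y p q r x f h =>
    hφ X Y p q r (p + n) (r + n) x f h rfl rfl (by omega)⟩

theorem HomDG.mk_app {M N : DGModule A} {n : ℤ}
    (φ : ∀ (X : A.Obj) (i j : ℤ), i + n = j → M.carrier X i →ₗ[k] N.carrier X j) (hφ)
    {X : A.Obj} (i j : ℤ) (h : i + n = j) (x : M.carrier X i) :
    (HomDG.mk φ hφ).app i j h x = φ X i j h x := by
  subst h; rfl

theorem HomDG.ext {M N : DGModule A} {n : ℤ} {φ ψ : HomDG M N n}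
    (H : ∀ (X : A.Obj) (i j : ℤ) (h : i + n = j) (x : M.carrier X i),
      φ.app i j h x = ψ.app i j h x) : φ = ψ :=
  Subtype.ext (by funext X i; exact LinearMap.ext (H X i (i + n) rfl))

theorem HomDG.add_app {M N : DGModule A} {n : ℤ} (φ ψ : HomDG M N n) {X : A.Obj} (i j : ℤ)
    (h : i + n = j) (x : M.carrier X i) : (φ + ψ).app i j h x = φ.app i j h x + ψ.app i j h x := by
  subst h; rfl

theorem HomDG.smul_app {M N : DGModule A} {n : ℤ} (a : k) (φ : HomDG M N n) {X : A.Obj} (i j : ℤ)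
    (h : i + n = j) (x : M.carrier X i) : (a • φ).app i j h x = a • φ.app i j h x := by
  subst h; rfl

theorem HomDG.zero_app {M N : DGModule A} {n : ℤ} {X : A.Obj} (i j : ℤ)
    (h : i + n = j) (x : M.carrier X i) : (0 : HomDG M N n).app i j h x = 0 := by
  subst h; rfl

theorem HomDG.app_act {M N : DGModule A} {n : ℤ} (φ : HomDG M N n) {X Y : A.Obj}
    {p q r p' r' : ℤ} (x : M.carrier Y p) (f : A.Hom X Y q)
    (h : p + q = r) (hp : p + n = p') (hr : r + n = r') (h' : p' + q = r') :
    φ.app r r' hr (M.act x f h) = N.act (φ.app p p' hp x) f h' := by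
  subst hp hr
  exact φ.2 X Y p q r x f h

/-- Composition of morphisms of dg-modules. -/
def HomDG.comp {L M N : DGModule A} {p q n : ℤ} (ψ : HomDG M N p) (φ : HomDG L M q)
    (h : p + q = n) : HomDG L N n :=
  HomDG.mk (fun X i j hij => (ψ.app (i + q) j (by omega)).comp (φ.app i (i + q) rfl)) (by
    intro X Y a b c a' c' x f h1 h2 h3 h4
    simp only [LinearMap.comp_apply]
    rw [φ.app_act x f h1 rfl rfl (by omega), ψ.app_act _ f _ (by omega) _ h4])

theorem HomDG.comp_app {L M N : DGModule A} {p q n : ℤ} (ψ : HomDG M N p) (φ : HomDG L M q)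
    (h : p + q = n) {X : A.Obj} (i l j : ℤ) (hij : i + n = j) (hil : i + q = l) (hlj : l + p = j)
    (x : L.carrier X i) :
    (ψ.comp φ h).app i j hij x = ψ.app l j hlj (φ.app i l hil x) := by
  subst hil
  exact HomDG.mk_app _ _ i j hij x

/-- The identity morphism of a dg-module. -/
def HomDG.idHom (M : DGModule A) : HomDG M M 0 :=
  HomDG.mk (fun X i j h => (show i = j by omega) ▸ LinearMap.id) (by
    intro X Y p q r p' r' x f h hp hr h'
    obtain rfl : p = p' := by omega
    obtain rfl : r = r' := by omega
    rfl)

theorem HomDG.idHom_app (M : DGModule A) {X : A.Obj} (i : ℤ) (h : i + 0 = i)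
    (x : M.carrier X i) : (HomDG.idHom M).app i i h x = x :=
  HomDG.mk_app _ _ i i h x

/-- The differential of a degree `n` morphism of dg-modules: `d ∘ φ - (-1) ^ n φ ∘ d`. -/
def HomDG.diffFun {M N : DGModule A} (n m : ℤ) (h : n + 1 = m) (φ : HomDG M N n) : HomDG M N m :=
  HomDG.mk (fun X i j hij => (N.d (i + n) j (by omega)).comp (φ.app i (i + n) rfl)
      - dgSign k n • (φ.app (i + 1) j (by omega)).comp (M.d i (i + 1) rfl)) (by
    intro X Y a b c a' c' x f h1 h2 h3 h4
    simp only [LinearMap.comp_apply, LinearMap.sub_apply, LinearMap.smul_apply]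
    rw [φ.app_act x f h1 rfl rfl (by omega),
      N.d_act _ f _ _ (by omega) rfl h4 (by omega),
      M.d_act x f h1 rfl rfl rfl (by omega) (by omega), map_add, map_smul,
      φ.app_act _ f _ (by omega) (by omega) h4, φ.app_act _ _ _ rfl (by omega) (by omega)]
    have e1 : ∀ y y' : N.carrier Y a', N.act (y - y') f h4 = N.act y f h4 - N.act y' f h4 := by
      intro y y'
      rw [sub_eq_add_neg, ← neg_one_smul k y', N.add_act, N.smul_act]; module
    rw [e1, N.smul_act, dgSign_add]
    module)

theorem HomDG.diffFun_app {M N : DGModule A} {n m : ℤ} (h : n + 1 = m) (φ : HomDG M N n)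
    {X : A.Obj} (i j i' j' : ℤ) (hi : i + 1 = i') (hj : i + n = j') (hij : i + m = j)
    (h₁ : j' + 1 = j) (h₂ : i' + n = j) (x : M.carrier X i) :
    (HomDG.diffFun n m h φ).app i j hij x
      = N.d j' j h₁ (φ.app i j' hj x) - dgSign k n • φ.app i' j h₂ (M.d i i' hi x) := by
  subst hi hj
  unfold HomDG.diffFun
  rw [HomDG.mk_app]
  rfl

/-- The differential of morphisms of dg-modules, as a linear map. -/
def HomDG.diff {M N : DGModule A} (n m : ℤ) (h : n + 1 = m) : HomDG M N n →ₗ[k] HomDG M N m where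
  toFun := HomDG.diffFun n m h
  map_add' φ ψ := by
    apply HomDG.ext
    intro X i j hij x
    simp only [HomDG.add_app, HomDG.diffFun_app h _ i j (i + 1) (i + n) rfl rfl hij (by omega)
      (by omega), map_add]
    module
  map_smul' a φ := by
    apply HomDG.ext
    intro X i j hij x
    simp only [HomDG.smul_app, HomDG.diffFun_app h _ i j (i + 1) (i + n) rfl rfl hij (by omega)
      (by omega), map_smul, RingHom.id_apply]
    module

theorem HomDG.diff_app {M N : DGModule A} {n m : ℤ} (h : n + 1 = m) (φ : HomDG M N n)
    {X : A.Obj} (i j i' j' : ℤ) (hi : i + 1 = i') (hj : i + n = j') (hij : i + m = j)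
    (h₁ : j' + 1 = j) (h₂ : i' + n = j) (x : M.carrier X i) :
    (HomDG.diff n m h φ).app i j hij x
      = N.d j' j h₁ (φ.app i j' hj x) - dgSign k n • φ.app i' j h₂ (M.d i i' hi x) :=
  HomDG.diffFun_app h φ i j i' j' hi hj hij h₁ h₂ x

end DGModule

/-- The dg-category `C_dg(A)` of right dg-modules over `A`. -/
def DGCat.modules {k : Type w} [CommRing k] (A : DGCat.{w, u, v} k) :
    DGCat.{w, max w u (v + 1), max u v} k where
  Obj := DGModule A
  Hom := DGModule.HomDG
  id := DGModule.HomDG.idHom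
  comp := DGModule.HomDG.comp
  add_comp {L M N p q n} g g' f h := DGModule.HomDG.ext fun X i j hij x => by
    simp only [DGModule.HomDG.add_app,
      DGModule.HomDG.comp_app _ _ h i (i + q) j hij rfl (by omega)]
  smul_comp {L M N p q n} a g f h := DGModule.HomDG.ext fun X i j hij x => by
    simp only [DGModule.HomDG.smul_app,
      DGModule.HomDG.comp_app _ _ h i (i + q) j hij rfl (by omega)]
  comp_add {L M N p q n} g f f' h := DGModule.HomDG.ext fun X i j hij x => by
    simp only [DGModule.HomDG.add_app,
      DGModule.HomDG.comp_app _ _ h i (i + q) j hij rfl (by omega), map_add]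
  comp_smul {L M N p q n} a g f h := DGModule.HomDG.ext fun X i j hij x => by
    simp only [DGModule.HomDG.smul_app,
      DGModule.HomDG.comp_app _ _ h i (i + q) j hij rfl (by omega), map_smul]
  id_comp {M N n} f := DGModule.HomDG.ext fun X i j hij x => by
    rw [DGModule.HomDG.comp_app _ _ _ i j j hij hij (add_zero j),
      DGModule.HomDG.idHom_app]
  comp_id {M N n} f := DGModule.HomDG.ext fun X i j hij x => by
    rw [DGModule.HomDG.comp_app _ _ _ i i j hij (add_zero i) hij,
      DGModule.HomDG.idHom_app]
  assoc {K L M N a b c ab bc n} h g f hab hbc h₁ h₂ := DGModule.HomDG.ext fun X i j hij x => by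
    rw [DGModule.HomDG.comp_app _ _ _ i (i + c) j hij rfl (by omega),
      DGModule.HomDG.comp_app _ _ _ (i + c) (i + bc) j (by omega) (by omega) (by omega),
      DGModule.HomDG.comp_app _ _ _ i (i + bc) j hij rfl (by omega),
      DGModule.HomDG.comp_app _ _ _ i (i + c) (i + bc) rfl rfl (by omega)]
  d := DGModule.HomDG.diff
  d_d {M N n m l} h h' φ := DGModule.HomDG.ext fun X i j hij x => by
    have hs : dgSign k m = -dgSign k n := by rw [← h, dgSign_succ]
    rw [DGModule.HomDG.diff_app h' _ i j (i + 1) (i + m) rfl rfl hij (by omega) (by omega),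
      DGModule.HomDG.diff_app h φ i (i + m) (i + 1) (i + n) rfl rfl rfl (by omega) (by omega),
      DGModule.HomDG.diff_app h φ (i + 1) j (i + 1 + 1) (i + m) rfl (by omega) (by omega)
        (by omega) (by omega), M.d_d, map_sub, N.d_d, map_zero, map_smul, hs, DGModule.HomDG.zero_app]
    module
  d_comp {L M N p q n p' q' n'} g f h hn hp hq h₁ h₂ := DGModule.HomDG.ext fun X i j hij x => by
    have hs : dgSign k n = dgSign k p * dgSign k q := by rw [← h, dgSign_add]
    rw [DGModule.HomDG.add_app, DGModule.HomDG.smul_app,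
      DGModule.HomDG.diff_app hn _ i j (i + 1) (i + n) rfl rfl hij (by omega) (by omega),
      DGModule.HomDG.comp_app _ _ _ i (i + q) j hij rfl (by omega),
      DGModule.HomDG.comp_app _ _ _ i (i + q) (i + n) rfl rfl (by omega),
      DGModule.HomDG.comp_app _ _ _ i (i + q') j hij rfl (by omega),
      DGModule.HomDG.comp_app _ _ _ (i + 1) (i + q') j (by omega) (by omega) (by omega),
      DGModule.HomDG.diff_app hp _ (i + q) j (i + q') (i + n) (by omega) (by omega) (by omega)
        (by omega) (by omega),
      DGModule.HomDG.diff_app hq _ i (i + q') (i + 1) (i + q) rfl rfl rfl (by omega) (by omega),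
      map_sub, map_smul, hs]
    module

namespace DGModule

variable {k : Type w} [CommRing k] {A : DGCat.{w, u, v} k}

/-- The representable dg-module `A(-, B)`. -/
def yoneda (B : A.Obj) : DGModule A where
  carrier X n := A.Hom X B n
  d := A.d
  d_d := A.d_d
  act := A.comp
  add_act := A.add_comp
  smul_act := A.smul_comp
  act_add := A.comp_add
  act_smul := A.comp_smul
  act_id := A.comp_id
  act_act := A.assoc
  d_act := A.d_comp

/-- The morphism `g ∘ - : A(-, B) ⟶ A(-, C)` induced by `g : B ⟶ C`. -/
def yonedaHom {B C : A.Obj} {n : ℤ} (g : A.Hom B C n) : HomDG (yoneda B) (yoneda C) n :=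
  HomDG.mk (M := yoneda B) (N := yoneda C) (fun X i j h => A.compL (by omega) g) (by
    intro X Y p q r p' r' x f h hp hr h'
    exact (A.assoc g x f _ _ _ _).symm)

theorem yonedaHom_app {B C : A.Obj} {n : ℤ} (g : A.Hom B C n) {X : A.Obj} (i j : ℤ)
    (h : i + n = j) (h' : n + i = j) (x : (yoneda B).carrier X i) :
    (yonedaHom g).app i j h x = A.comp (X := X) (Y := B) (Z := C) g x h' :=
  HomDG.mk_app (M := yoneda B) (N := yoneda C) _ _ i j h x

theorem yonedaHom_id (B : A.Obj) : yonedaHom (A.id B) = HomDG.idHom (yoneda B) :=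
  HomDG.ext fun X i j h x => by
    obtain rfl : i = j := by omega
    rw [yonedaHom_app _ _ _ _ (zero_add i), HomDG.idHom_app]
    exact A.id_comp x

theorem yonedaHom_comp {B C D : A.Obj} {p q n : ℤ} (g : A.Hom C D p) (f : A.Hom B C q)
    (h : p + q = n) : yonedaHom (A.comp g f h) = (yonedaHom g).comp (yonedaHom f) h :=
  HomDG.ext fun X i j hij x => by
    rw [HomDG.comp_app _ _ h i (i + q) j hij rfl (by omega),
      yonedaHom_app _ _ _ _ (show n + i = j by omega),
      yonedaHom_app _ _ _ _ (show q + i = i + q by omega)]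
    refine Eq.trans ?_ (yonedaHom_app g (i + q) j _ (show p + (i + q) = j by omega) _).symm
    exact A.assoc _ _ _ _ _ _ _

theorem yonedaHom_d {B C : A.Obj} {n m : ℤ} (h : n + 1 = m) (g : A.Hom B C n) :
    yonedaHom (A.d n m h g) = HomDG.diff n m h (yonedaHom g) :=
  HomDG.ext fun X i j hij x => by
    rw [HomDG.diff_app h _ i j (i + 1) (i + n) rfl rfl hij (by omega) (by omega),
      yonedaHom_app _ _ _ _ (show m + i = j by omega),
      yonedaHom_app _ _ _ _ (show n + i = i + n by omega),
      yonedaHom_app _ _ _ _ (show n + (i + 1) = j by omega)]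
    have := A.d_comp (X := X) g x (show n + i = i + n by omega) (show i + n + 1 = j by omega) h rfl
      (show m + i = j by omega) (by omega)
    exact eq_sub_of_add_eq this.symm

/-- The map `A(B, C) ⟶ Hom(A(-, B), A(-, C))`, `g ↦ g ∘ -`. -/
def yonedaMap (B C : A.Obj) (n : ℤ) : A.Hom B C n →ₗ[k] HomDG (yoneda B) (yoneda C) n where
  toFun := yonedaHom
  map_add' g g' := HomDG.ext fun X i j h x => by
    rw [HomDG.add_app]
    simp only [yonedaHom_app _ i j h (show n + i = j by omega)]
    exact A.add_comp _ _ _ _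
  map_smul' a g := HomDG.ext fun X i j h x => by
    rw [RingHom.id_apply, HomDG.smul_app]
    simp only [yonedaHom_app _ i j h (show n + i = j by omega)]
    exact A.smul_comp _ _ _ _

/-- The shift `M[s]`, with `M[s]^n = M^(n + s)` and differential multiplied by `(-1) ^ s`. -/
def shift (M : DGModule A) (s : ℤ) : DGModule A where
  carrier X n := M.carrier X (n + s)
  d n m h := dgSign k s • M.d (n + s) (m + s) (by omega)
  d_d h h' x := by simp [M.d_d]
  act x f h := M.act x f (by omega)
  add_act x x' f h := M.add_act _ _ _ _
  smul_act a x f h := M.smul_act _ _ _ _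
  act_add x f f' h := M.act_add _ _ _ _
  act_smul a x f h := M.act_smul _ _ _ _
  act_id {X n} x := by
    exact M.act_id x
  act_act x g f hab hbc h₁ h₂ := M.act_act _ _ _ _ _ _ _
  d_act {X Y p q n p' q' n'} x f h hn hp hq h₁ h₂ := by
    simp only [LinearMap.smul_apply]
    rw [M.d_act x f (by omega) (by omega) (show p + s + 1 = p' + s by omega) hq (by omega)
      (by omega), M.smul_act, dgSign_add, smul_add, smul_smul, mul_comm (dgSign k p),
      ← mul_assoc, dgSign_mul_self, one_mul]

/-- The mapping cone of a closed degree `0` morphism `φ : M ⟶ N`: the graded module `M[1] ⊕ N`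
with differential `(x, y) ↦ (-dx, φ x + dy)`. -/
def cone {M N : DGModule A} (φ : HomDG M N 0) (hφ : HomDG.diff 0 1 (zero_add 1) φ = 0) :
    DGModule A where
  carrier X n := M.carrier X (n + 1) × N.carrier X n
  d n m h := LinearMap.prod (-(M.d (n + 1) (m + 1) (by omega)) ∘ₗ LinearMap.fst k _ _)
    (φ.app (n + 1) m (by omega) ∘ₗ LinearMap.fst k _ _ + N.d n m h ∘ₗ LinearMap.snd k _ _)
  d_d {X n m l} h h' x := by
    have e := HomDG.diff_app (zero_add 1) φ (n + 1) (l) (m + 1) m (by omega) (by omega)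
      (by omega) h' (by omega) x.1
    rw [hφ, dgSign_zero, one_smul, HomDG.zero_app] at e
    have e0 : N.d m l h' (φ.app (n + 1) m (by omega) x.1)
        = φ.app (m + 1) l (by omega) (M.d (n + 1) (m + 1) (by omega) x.1) :=
      (sub_eq_zero.mp e.symm)
    ext
    · simp [M.d_d]
    · simp [N.d_d, e0]
  act x f h := (M.act x.1 f (by omega), N.act x.2 f h)
  add_act x x' f h := Prod.ext (M.add_act _ _ _ _) (N.add_act _ _ _ _)
  smul_act a x f h := Prod.ext (M.smul_act _ _ _ _) (N.smul_act _ _ _ _)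
  act_add x f f' h := Prod.ext (M.act_add _ _ _ _) (N.act_add _ _ _ _)
  act_smul a x f h := Prod.ext (M.act_smul _ _ _ _) (N.act_smul _ _ _ _)
  act_id x := Prod.ext (M.act_id _) (N.act_id _)
  act_act x g f hab hbc h₁ h₂ :=
    Prod.ext (M.act_act _ _ _ _ _ _ _) (N.act_act _ _ _ _ _ _ _)
  d_act {X Y p q n p' q' n'} x f h hn hp hq h₁ h₂ := by
    have e1 := M.d_act x.1 f (show p + 1 + q = n + 1 by omega) (show n + 1 + 1 = n' + 1 by omega)
      (show p + 1 + 1 = p' + 1 by omega) hq (by omega) (by omega)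
    have e2 := N.d_act x.2 f h hn hp hq h₁ h₂
    have e3 := φ.app_act x.1 f (show p + 1 + q = n + 1 by omega) (show p + 1 + 0 = p' by omega)
      (show n + 1 + 0 = n' by omega) h₁
    have e4 : ∀ y : M.carrier Y (p' + 1), M.act (-y) f (show p' + 1 + q = n' + 1 by omega)
        = -M.act y f (by omega) := by
      intro y
      rw [← neg_one_smul k y, M.smul_act]; module
    rw [dgSign_succ] at e1
    refine Prod.ext ?_ ?_
    · simp only [LinearMap.prod_apply, Function.prod, LinearMap.comp_apply, LinearMap.fst_apply,
        LinearMap.neg_apply, e1, e4, Prod.fst_add, Prod.smul_fst]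
      module
    · simp only [LinearMap.prod_apply, Function.prod, LinearMap.comp_apply, LinearMap.fst_apply,
        LinearMap.snd_apply, LinearMap.add_apply, e2, e3, N.add_act, Prod.snd_add, Prod.smul_snd]
      module

/-- The closure of the representable dg-modules under shifts and mapping cones. -/
inductive IsPretr : DGModule A → Prop
  | yoneda (B : A.Obj) : IsPretr (yoneda B)
  | shift (M : DGModule A) (s : ℤ) : IsPretr M → IsPretr (M.shift s)
  | cone {M N : DGModule A} (φ : HomDG M N 0) (hφ : HomDG.diff 0 1 (zero_add 1) φ = 0) :
      IsPretr M → IsPretr N → IsPretr (cone φ hφ)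

end DGModule

namespace DGCat

variable {k : Type w} [CommRing k] (A : DGCat.{w, u, v} k)

/-- The pretriangulated hull `pretr(A)`, a full dg-subcategory of `C_dg(A)`. -/
def pretr : DGCat.{w, max w u (v + 1), max u v} k :=
  A.modules.full fun M : DGModule A => M.IsPretr

/-- The Yoneda embedding `A ⟶ pretr(A)`, `B ↦ A(-, B)`, `g ↦ g ∘ -`. -/
def yonedaPretr : DGFunctor A A.pretr where
  obj B := ⟨DGModule.yoneda B, DGModule.IsPretr.yoneda B⟩
  map {B C n} := DGModule.yonedaMap B C n
  map_id B := DGModule.yonedaHom_id B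
  map_comp g f h := DGModule.yonedaHom_comp g f h
  map_d h g := DGModule.yonedaHom_d h g

/-- `A` is pretriangulated if `A ⟶ pretr(A)` is a quasi-equivalence. -/
def IsPretriangulated : Prop := A.yonedaPretr.IsQuasiEquivalence

/-! ### Truncations, formal zero objects and twisted complexes -/

/-- The left truncation of the complex of morphisms: everything in negative degrees, closed
morphisms in degree `0`, and zero in positive degrees. -/
def truncHom (X Y : A.Obj) (n : ℤ) : Submodule k (A.Hom X Y n) where
  carrier := {f | (n = 0 → f ∈ A.cocycles X Y n) ∧ (0 < n → f = 0)}
  add_mem' {f g} hf hg := ⟨fun h => add_mem (hf.1 h) (hg.1 h),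
    fun h => by rw [hf.2 h, hg.2 h, add_zero]⟩
  zero_mem' := ⟨fun _ => zero_mem _, fun _ => rfl⟩
  smul_mem' a f hf := ⟨fun h => Submodule.smul_mem _ a (hf.1 h),
    fun h => by rw [hf.2 h, smul_zero]⟩

/-- The truncation `τ_{≤ 0} A`. -/
def trunc : DGCat.{w, u, v} k where
  Obj := A.Obj
  Hom X Y n := A.truncHom X Y n
  id X := ⟨A.id X, fun _ => A.d_id X, fun h => absurd h (lt_irrefl _)⟩
  comp {X Y Z p q n} g f h := ⟨A.comp g.1 f.1 h, by
    by_cases hp : 0 < p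
    · rw [g.2.2 hp, GradedCat.zero_comp]; exact zero_mem _
    by_cases hq : 0 < q
    · rw [f.2.2 hq, GradedCat.comp_zero]; exact zero_mem _
    refine ⟨fun hn => ?_, fun hn => by omega⟩
    exact comp_mem ⟨g.1, g.2.1 (by omega)⟩ ⟨f.1, f.2.1 (by omega)⟩ h⟩
  add_comp g g' f h := Subtype.ext (A.add_comp _ _ _ _)
  smul_comp a g f h := Subtype.ext (A.smul_comp _ _ _ _)
  comp_add g f f' h := Subtype.ext (A.comp_add _ _ _ _)
  comp_smul a g f h := Subtype.ext (A.comp_smul _ _ _ _)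
  id_comp f := Subtype.ext (A.id_comp _)
  comp_id f := Subtype.ext (A.comp_id _)
  assoc h g f _ _ _ _ := Subtype.ext (A.assoc _ _ _ _ _ _ _)
  d {X Y} n m h := (A.d n m h).restrict (fun f hf => by
    refine ⟨fun _ => A.d_d h rfl f, fun hm => ?_⟩
    by_cases hn : n = 0
    · exact d_of_mem h (hf.1 hn)
    · rw [hf.2 (by omega), map_zero])
  d_d h h' f := Subtype.ext (A.d_d h h' f.1)
  d_comp g f h hn hp hq h₁ h₂ := Subtype.ext (A.d_comp g.1 f.1 h hn hp hq h₁ h₂)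

theorem trunc_isNonpositive : A.trunc.IsNonpositive :=
  fun _ _ _ hn f => Subtype.ext (f.2.2 hn)

/-- Morphisms of `A` with a zero object `none` formally added. -/
def addZeroHom : Option A.Obj → Option A.Obj → ℤ → Type v
  | some X, some Y, n => A.Hom X Y n
  | none, _, _ => PUnit
  | some _, none, _ => PUnit

instance : ∀ (X Y : Option A.Obj) (n : ℤ), AddCommGroup (A.addZeroHom X Y n)
  | some X, some Y, n => (inferInstance : AddCommGroup (A.Hom X Y n))
  | none, _, _ => (inferInstance : AddCommGroup PUnit.{v + 1})
  | some _, none, _ => (inferInstance : AddCommGroup PUnit.{v + 1})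

instance : ∀ (X Y : Option A.Obj) (n : ℤ), Module k (A.addZeroHom X Y n)
  | some X, some Y, n => (inferInstance : Module k (A.Hom X Y n))
  | none, _, _ => (inferInstance : Module k PUnit.{v + 1})
  | some _, none, _ => (inferInstance : Module k PUnit.{v + 1})

theorem addZeroHom_none_left {Y : Option A.Obj} {n : ℤ} (f g : A.addZeroHom none Y n) : f = g :=
  match Y, f, g with
  | none, _, _ => rfl
  | some _, _, _ => rfl

theorem addZeroHom_none_right {X : Option A.Obj} {n : ℤ} (f g : A.addZeroHom X none n) : f = g :=
  match X, f, g with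
  | none, _, _ => rfl
  | some _, _, _ => rfl

/-- Composition in `A` with a zero object added. -/
def addZeroComp : ∀ {X Y Z : Option A.Obj} {p q n : ℤ}, A.addZeroHom Y Z p → A.addZeroHom X Y q →
    p + q = n → A.addZeroHom X Z n
  | some _, some _, some _, _, _, _ => fun g f h => A.comp g f h
  | none, _, _, _, _, _ => fun _ _ _ => 0
  | some _, none, _, _, _, _ => fun _ _ _ => 0
  | some _, some _, none, _, _, _ => fun _ _ _ => 0

/-- Differentials in `A` with a zero object added. -/
def addZeroD : ∀ {X Y : Option A.Obj} (n m : ℤ), n + 1 = m →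
    A.addZeroHom X Y n →ₗ[k] A.addZeroHom X Y m
  | some _, some _, n, m, h => A.d n m h
  | none, _, _, _, _ => 0
  | some _, none, _, _, _ => 0

/-- The dg-category `A_{0}`: `A` with a strict zero object formally added. -/
def addZero : DGCat.{w, u, v} k where
  Obj := Option A.Obj
  Hom := A.addZeroHom
  id
    | some X => A.id X
    | none => 0
  comp := A.addZeroComp
  add_comp {X Y Z p q n} g g' f h := by
    cases X
    · exact A.addZeroHom_none_left _ _
    cases Z
    · exact A.addZeroHom_none_right _ _
    cases Y
    · exact (add_zero _).symm
    exact A.add_comp g g' f h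
  smul_comp {X Y Z p q n} a g f h := by
    cases X
    · exact A.addZeroHom_none_left _ _
    cases Z
    · exact A.addZeroHom_none_right _ _
    cases Y
    · exact (smul_zero _).symm
    exact A.smul_comp a g f h
  comp_add {X Y Z p q n} g f f' h := by
    cases X
    · exact A.addZeroHom_none_left _ _
    cases Z
    · exact A.addZeroHom_none_right _ _
    cases Y
    · exact (add_zero _).symm
    exact A.comp_add g f f' h
  comp_smul {X Y Z p q n} a g f h := by
    cases X
    · exact A.addZeroHom_none_left _ _
    cases Z
    · exact A.addZeroHom_none_right _ _
    cases Y
    · exact (smul_zero _).symm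
    exact A.comp_smul a g f h
  id_comp {X Y n} f := by
    cases X
    · exact A.addZeroHom_none_left _ _
    cases Y
    · exact A.addZeroHom_none_right _ _
    exact A.id_comp f
  comp_id {X Y n} f := by
    cases X
    · exact A.addZeroHom_none_left _ _
    cases Y
    · exact A.addZeroHom_none_right _ _
    exact A.comp_id f
  assoc {W X Y Z a b c ab bc n} h g f hab hbc h₁ h₂ := by
    cases W
    · exact A.addZeroHom_none_left _ _
    cases Z
    · exact A.addZeroHom_none_right _ _
    cases X
    · cases Y
      · rfl
      · exact (GradedCat.comp_zero (G := A.toGradedCat) _ _).symm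
    cases Y
    · exact GradedCat.zero_comp (G := A.toGradedCat) _ _
    exact A.assoc h g f hab hbc h₁ h₂
  d := A.addZeroD
  d_d {X Y n m l} h h' f := by
    cases X
    · exact A.addZeroHom_none_left _ _
    cases Y
    · exact A.addZeroHom_none_right _ _
    exact A.d_d h h' f
  d_comp {X Y Z p q n p' q' n'} g f h hn hp hq h₁ h₂ := by
    cases X
    · exact A.addZeroHom_none_left _ _
    cases Z
    · exact A.addZeroHom_none_right _ _
    cases Y
    · refine (map_zero (A.d n n' hn)).trans ?_
      exact ((zero_add _).trans (smul_zero _)).symm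
    exact A.d_comp g f h hn hp hq h₁ h₂

/-- The identity of `X`, seen as a degree `n` morphism `X ⟶ Y` when `X = Y` and `n = 0`. -/
def eqId {X : A.Obj} : ∀ {Y : A.Obj} {n : ℤ}, X = Y → 0 = n → A.Hom X Y n
  | _, _, rfl, rfl => A.id X

theorem eqId_comp {X Y : A.Obj} {m n : ℤ} (h : 0 = m) (f : A.Hom X Y n) (e : m + n = n) :
    A.comp (A.eqId rfl h) f e = f := by
  subst h; exact A.id_comp f

theorem comp_eqId {X Y : A.Obj} {m n : ℤ} (h : 0 = m) (f : A.Hom X Y n) (e : n + m = n) :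
    A.comp f (A.eqId rfl h) e = f := by
  subst h; exact A.comp_id f

theorem d_eqId {X Y : A.Obj} {n m : ℤ} (h : X = Y) (h' : 0 = n) (e : n + 1 = m) :
    A.d n m e (A.eqId h h') = 0 := by
  subst h h' e; exact A.d_id X

section Twisted

variable {A} (hA : A.IsNonpositive)

/-- The graded category of sequences `(X^i)` of objects of `A`. A degree `p` morphism `X ⟶ Y` is a
family `f i j : X^i ⟶ Y^j` of morphisms of degree `i - j + p`, and
`(g ∘ f) i j = ∑ l, g l j ∘ f i l`. As `A` is concentrated in nonpositive degrees, the terms of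
the sum outside the finite range which is written here are zero. -/
noncomputable def seqGraded : GradedCat.{w, u, v} k where
  Obj := ℤ → A.Obj
  Hom X Y p := ∀ i j : ℤ, A.Hom (X i) (Y j) (i - j + p)
  id X i j := if h : i = j then A.eqId (congrArg X h) (by omega) else 0
  comp {X Y Z p q n} g f h i j :=
    ∑ l ∈ Finset.Icc (i + q) (j - p), A.comp (g l j) (f i l) (by omega)
  add_comp g g' f h := by
    funext i j
    exact (Finset.sum_congr rfl fun l _ => A.add_comp _ _ _ _).trans Finset.sum_add_distrib
  smul_comp a g f h := by
    funext i j
    exact (Finset.sum_congr rfl fun l _ => A.smul_comp _ _ _ _).trans Finset.smul_sum.symm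
  comp_add g f f' h := by
    funext i j
    exact (Finset.sum_congr rfl fun l _ => A.comp_add _ _ _ _).trans Finset.sum_add_distrib
  comp_smul a g f h := by
    funext i j
    exact (Finset.sum_congr rfl fun l _ => A.comp_smul _ _ _ _).trans Finset.smul_sum.symm
  id_comp {X Y n} f := by
    funext i j
    by_cases hij : i + n ≤ j
    · rw [Finset.sum_eq_single j]
      · beta_reduce; rw [dif_pos rfl]; exact A.eqId_comp _ _ _
      · intro l _ hl
        beta_reduce; rw [dif_neg hl, GradedCat.zero_comp]
      · intro hj
        exact absurd (Finset.mem_Icc.2 ⟨hij, by omega⟩) hj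
    · rw [Finset.Icc_eq_empty (by omega), Finset.sum_empty]
      exact (hA _ _ _ (by omega) _).symm
  comp_id {X Y n} f := by
    funext i j
    by_cases hij : i + n ≤ j
    · rw [Finset.sum_eq_single i]
      · beta_reduce; rw [dif_pos rfl]; exact A.comp_eqId _ _ _
      · intro l _ hl
        beta_reduce; rw [dif_neg (Ne.symm hl), GradedCat.comp_zero]
      · intro hj
        exact absurd (Finset.mem_Icc.2 ⟨by omega, by omega⟩) hj
    · rw [Finset.Icc_eq_empty (by omega), Finset.sum_empty]
      exact (hA _ _ _ (by omega) _).symm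
  assoc {W X Y Z a b c ab bc n} h g f hab hbc h₁ h₂ := by
    funext i j
    simp only [GradedCat.sum_comp, GradedCat.comp_sum]
    rw [Finset.sum_comm' (t' := Finset.Icc (i + bc) (j - a))
      (s' := fun l => Finset.Icc (i + c) (l - b))]
    · exact Finset.sum_congr rfl fun l _ => Finset.sum_congr rfl fun m _ => A.assoc _ _ _ _ _ _ _
    · intro x y
      simp only [Finset.mem_Icc]
      omega

/-- The dg-category of sequences of objects of `A`, with the entrywise differential
`(d f) i j = (-1) ^ j d (f i j)`. -/
noncomputable def seqDG : DGCat.{w, u, v} k where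
  toGradedCat := seqGraded hA
  d {X Y} n m h :=
    { toFun := fun f i j => dgSign k j • A.d (i - j + n) (i - j + m) (by omega) (f i j)
      map_add' := fun f g => by
        funext i j
        exact (congrArg _ (map_add (A.d _ _ _) (f i j) (g i j))).trans (smul_add _ _ _)
      map_smul' := fun a f => by
        funext i j
        exact (congrArg _ (map_smul (A.d _ _ _) a (f i j))).trans (smul_comm _ _ _) }
  d_d h h' f := by
    funext i j
    change dgSign k j • A.d _ _ _ (dgSign k j • A.d _ _ _ (f i j)) = 0
    rw [map_smul, A.d_d, smul_zero, smul_zero]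
  d_comp {X Y Z p q n p' q' n'} g f h hn hp hq h₁ h₂ := by
    funext i j
    change dgSign k j • A.d (i - j + n) (i - j + n') (by omega)
        (∑ l ∈ Finset.Icc (i + q) (j - p), A.comp (g l j) (f i l) (by omega)) =
      ∑ l ∈ Finset.Icc (i + q) (j - p'),
        A.comp (dgSign k j • A.d (l - j + p) (l - j + p') (by omega) (g l j)) (f i l)
          (show _ = i - j + n' by omega)
      + dgSign k p • ∑ l ∈ Finset.Icc (i + q') (j - p),
        A.comp (g l j) (dgSign k l • A.d (i - l + q) (i - l + q') (by omega) (f i l))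
          (show _ = i - j + n' by omega)
    have e1 : ∑ l ∈ Finset.Icc (i + q) (j - p'),
        A.comp (dgSign k j • A.d (l - j + p) (l - j + p') (by omega) (g l j)) (f i l)
          (show _ = i - j + n' by omega)
        = ∑ l ∈ Finset.Icc (i + q) (j - p),
        A.comp (dgSign k j • A.d (l - j + p) (l - j + p') (by omega) (g l j)) (f i l)
          (show _ = i - j + n' by omega) := by
      refine Finset.sum_subset (Finset.Icc_subset_Icc le_rfl (by omega)) fun l h1 h2 => ?_
      rw [Finset.mem_Icc] at h1 h2
      rw [hA _ _ _ (by omega) (A.d _ _ _ (g l j)), smul_zero, GradedCat.zero_comp]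
    have e2 : ∑ l ∈ Finset.Icc (i + q') (j - p),
        A.comp (g l j) (dgSign k l • A.d (i - l + q) (i - l + q') (by omega) (f i l))
          (show _ = i - j + n' by omega)
        = ∑ l ∈ Finset.Icc (i + q) (j - p),
        A.comp (g l j) (dgSign k l • A.d (i - l + q) (i - l + q') (by omega) (f i l))
          (show _ = i - j + n' by omega) := by
      refine Finset.sum_subset (Finset.Icc_subset_Icc (by omega) le_rfl) fun l h1 h2 => ?_
      rw [Finset.mem_Icc] at h1 h2
      rw [hA _ _ _ (by omega) (A.d _ _ _ (f i l)), smul_zero, GradedCat.comp_zero]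
    rw [e1, e2, map_sum, Finset.smul_sum, Finset.smul_sum, ← Finset.sum_add_distrib]
    refine Finset.sum_congr rfl fun l _ => ?_
    have hs : dgSign k j * dgSign k (l - j + p) = dgSign k p * dgSign k l := by
      rw [← dgSign_add, ← dgSign_add]; congr 1; omega
    rw [A.d_comp (g l j) (f i l) _ (show i - j + n + 1 = i - j + n' by omega)
      (show l - j + p + 1 = l - j + p' by omega) (show i - l + q + 1 = i - l + q' by omega)
      (by omega) (by omega), A.smul_comp, A.comp_smul, smul_add, smul_smul, smul_smul, hs]

end Twisted

/-- A Maurer-Cartan object of a dg-category: an object `X` with an endomorphism `x` of degree `1`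
such that `dx + x ∘ x = 0`. -/
structure MCObj where
  X : A.Obj
  x : A.Hom X X 1
  mc : A.d 1 2 one_add_one_eq_two x + A.comp x x one_add_one_eq_two = 0

/-- The twisted differential `f ↦ df + y ∘ f - (-1) ^ p f ∘ x` on morphisms `(X, x) ⟶ (Y, y)` of
degree `p`. -/
def mcD (X Y : A.MCObj) (p m : ℤ) (h : p + 1 = m) : A.Hom X.X Y.X p →ₗ[k] A.Hom X.X Y.X m :=
  A.d p m h + A.compL (by omega) Y.x - dgSign k p • (A.compL h).flip X.x

theorem mcD_apply (X Y : A.MCObj) (p m : ℤ) (h : p + 1 = m) (f : A.Hom X.X Y.X p) :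
    A.mcD X Y p m h f = A.d p m h f + A.comp Y.x f (by omega) - dgSign k p • A.comp f X.x h := rfl

/-- The dg-category of Maurer-Cartan objects, with twisted differentials. -/
def mcDG : DGCat.{w, max u v, v} k where
  Obj := A.MCObj
  Hom X Y n := A.Hom X.X Y.X n
  id X := A.id X.X
  comp := A.comp
  add_comp := A.add_comp
  smul_comp := A.smul_comp
  comp_add := A.comp_add
  comp_smul := A.comp_smul
  id_comp := A.id_comp
  comp_id := A.comp_id
  assoc := A.assoc
  d {X Y} n m h := A.mcD X Y n m h
  d_d {X Y n m l} h h' f := by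
    have hs : dgSign k m = -dgSign k n := by rw [← h, dgSign_succ]
    have eY : A.comp (A.d 1 2 one_add_one_eq_two Y.x) f (show 2 + n = l by omega)
        = -A.comp Y.x (A.comp Y.x f (show 1 + n = m by omega)) (show 1 + m = l by omega) := by
      rw [eq_neg_of_add_eq_zero_left Y.mc, GradedCat.neg_comp,
        A.assoc _ _ _ _ (show 1 + n = m by omega) _ (by omega)]
    have eX : A.comp f (A.d 1 2 one_add_one_eq_two X.x) (show n + 2 = l by omega)
        = -A.comp (A.comp f X.x h) X.x h' := by
      rw [eq_neg_of_add_eq_zero_left X.mc, GradedCat.comp_neg,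
        A.assoc _ _ _ h one_add_one_eq_two h' (by omega)]
    have e1 := A.d_comp Y.x f (show 1 + n = m by omega) h' one_add_one_eq_two h (by omega)
      (by omega)
    have e2 := A.d_comp f X.x h h' h one_add_one_eq_two h' (by omega)
    have e3 : A.comp (A.comp Y.x f (show 1 + n = m by omega)) X.x h'
        = A.comp Y.x (A.comp f X.x h) (show 1 + m = l by omega) := A.assoc _ _ _ _ _ _ _
    rw [eY, dgSign_one] at e1
    rw [eX] at e2
    simp only [mcD_apply, map_add, map_sub, map_smul, A.d_d, e1, e2, hs, e3, smul_add, smul_sub,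
      smul_neg, neg_smul, one_smul, smul_smul, dgSign_mul_self]
    abel
  d_comp {X Y Z p q n p' q' n'} g f h hn hp hq h₁ h₂ := by
    have hs : dgSign k n = dgSign k p * dgSign k q := by rw [← h, dgSign_add]
    have e1 : A.comp Z.x (A.comp g f h) (show 1 + n = n' by omega)
        = A.comp (A.comp Z.x g (show 1 + p = p' by omega)) f h₁ := (A.assoc _ _ _ _ _ _ _).symm
    have e2 : A.comp (A.comp g f h) X.x hn = A.comp g (A.comp f X.x hq) h₂ := A.assoc _ _ _ _ _ _ _
    have e3 : A.comp (A.comp g Y.x hp) f h₁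
        = A.comp g (A.comp Y.x f (show 1 + q = q' by omega)) h₂ := A.assoc _ _ _ _ _ _ _
    rw [mcD_apply, mcD_apply, mcD_apply, A.d_comp g f h hn hp hq h₁ h₂, e1, e2, hs,
      GradedCat.sub_comp, A.add_comp, A.smul_comp, e3, GradedCat.comp_sub, A.comp_add, A.comp_smul]
    module

/-- The dg-category of (one-sided, unbounded) twisted complexes on a dg-category `A` strictly
concentrated in nonpositive degrees. Unfolding the definitions:
* an object is a sequence `X^i` with morphisms `x i j : X^i ⟶ X^j` of degree `i - j + 1` such that
  `(-1) ^ j d (x i j) + ∑ l, x l j ∘ x i l = 0`;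
* a morphism `X ⟶ Y` of degree `p` is a family `f i j : X^i ⟶ Y^j` of morphisms of degree
  `i - j + p`, with
  `(d f) i j = (-1) ^ j d (f i j) + ∑ l, (y l j ∘ f i l - (-1) ^ p f l j ∘ x i l)`;
* `(g ∘ f) i j = ∑ l, g l j ∘ f i l`. -/
noncomputable def twNonpositive {A : DGCat.{w, u, v} k} (hA : A.IsNonpositive) : DGCat.{w, max u v, v} k :=
  (seqDG hA).mcDG

theorem twNonpositive_comp {A : DGCat.{w, u, v} k} (hA : A.IsNonpositive)
    {X Y Z : (twNonpositive hA).Obj} {p q n : ℤ} (g : (twNonpositive hA).Hom Y Z p)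
    (f : (twNonpositive hA).Hom X Y q) (h : p + q = n) (i j : ℤ) :
    (twNonpositive hA).comp g f h i j =
      ∑ l ∈ Finset.Icc (i + q) (j - p), A.comp (g l j) (f i l) (by omega) := rfl

theorem twNonpositive_d {A : DGCat.{w, u, v} k} (hA : A.IsNonpositive)
    {X Y : (twNonpositive hA).Obj} {p m : ℤ} (h : p + 1 = m) (f : (twNonpositive hA).Hom X Y p)
    (i j : ℤ) :
    (twNonpositive hA).d p m h f i j =
      dgSign k j • A.d (i - j + p) (i - j + m) (by omega) (f i j)
        + ∑ l ∈ Finset.Icc (i + p) (j - 1), A.comp (Y.x l j) (f i l) (by omega)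
        - dgSign k p • ∑ l ∈ Finset.Icc (i + 1) (j - p), A.comp (f l j) (X.x i l) (by omega) := rfl

theorem twNonpositive_mc {A : DGCat.{w, u, v} k} (hA : A.IsNonpositive)
    (X : (twNonpositive hA).Obj) (i j : ℤ) :
    dgSign k j • A.d (i - j + 1) (i - j + 2) (by omega) (X.x i j)
      + ∑ l ∈ Finset.Icc (i + 1) (j - 1), A.comp (X.x l j) (X.x i l) (by omega) = 0 :=
  congrFun (congrFun X.mc i) j

/-- The dg-category `Tw(A) = Tw(τ_{≤ 0} A_{0})` of twisted complexes on a dg-category `A`. -/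
noncomputable def Tw : DGCat.{w, max u v, v} k :=
  twNonpositive (A := A.addZero.trunc) A.addZero.trunc_isNonpositive

end DGCat

/-! A coproduct in `H^*(A)` is the same thing as a homotopy coproduct (`IsHoCoprod`): closed maps `X
s ⟶ C` for which the cone of `A(C, Y) ⟶ ∏ s, A(X s, Y)` is acyclic for every `Y`. In this form the
notion can be lifted from `A` to twisted complexes by a filtration argument. Products are treated as
coproducts in the opposite dg-category.

Twisted complexes are the Maurer-Cartan objects of the dg-category of sequences, whose complexes of
morphisms carry the complete filtration by `j - i`. Since entries of positive degree vanish, every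
morphism of degree `n` lies in step `n`. A Maurer-Cartan element has degree `1`, so it raises the
filtration and is invisible on the associated graded, where only the entrywise differential remains.
Hence the termwise homotopy coproduct `C` of the underlying sequences is a coproduct on graded
pieces (`isGrCoprod_seqDiag`). It remains to equip `C` with a Maurer-Cartan element and to correct
the inclusions so that they become closed. `exists_curv_eq_zero` does this step by step: the
obstruction, a pair (curvature, defect of closedness), is by Bianchi identities a cocycle in the
cone of the current graded piece, which is acyclic. `exists_lift` then passes acyclicity from the
graded pieces to the complete twisted complexes. Adding a zero object and truncating preserve
homotopy coproducts (`exists_isHoCoprod_addZero`, `IsHoCoprod.trunc`).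

The same machine produces cones. A closed degree `1` morphism between two Maurer-Cartan objects
gives another perturbation (`coneTwist`), and a binary homotopy coproduct of the terms, available
because `H^0(A)` is additive, becomes a homotopy cone (`IsHoCone`). Shifts exist strictly, by
reindexing. This suffices for pretriangulatedness (`isPretriangulated_of_shifts_of_cones`): the
Yoneda embedding is bijective on complexes of morphisms, and by induction every module in the hull
is homotopy equivalent to a representable one. In the cone step, a map `e` from the strict cone of
modules to the representable homotopy cone is an equivalence because mapping out along `e` has
acyclic cone when tested on its own source and target (`isoDeg_zero_of_liftsAt`). -/

namespace DGCat

variable {k : Type w} [CommRing k] (A : DGCat.{w, u, v} k)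

/-! ### Homotopy coproducts and coproducts in graded cohomology -/

section Classes

variable {A}

theorem mkH_eq_zero_iff {X Y : A.Obj} {e n : ℤ} (he : e + 1 = n) (f : A.cocycles X Y n) :
    A.mkH f = 0 ↔ ∃ x : A.Hom X Y e, A.d e n he x = f.1 := by
  obtain rfl : e = n - 1 := by omega
  exact (Submodule.Quotient.mk_eq_zero _).trans Iff.rfl

theorem mkH_sub {X Y : A.Obj} {n : ℤ} (f g : A.cocycles X Y n) :
    A.mkH f - A.mkH g = A.mkH (f - g) := rfl

theorem mkH_eq_iff {X Y : A.Obj} {e n : ℤ} (he : e + 1 = n) (f g : A.cocycles X Y n) :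
    A.mkH f = A.mkH g ↔ ∃ x : A.Hom X Y e, A.d e n he x = f.1 - g.1 := by
  rw [← sub_eq_zero, mkH_sub, mkH_eq_zero_iff he]
  rfl

theorem mem_cocycles {X Y : A.Obj} {n m : ℤ} (h : n + 1 = m) {f : A.Hom X Y n}
    (hf : A.d n m h f = 0) : f ∈ A.cocycles X Y n := by
  subst h; exact hf

/-- `C`, with the closed morphisms `ι s : X s ⟶ C`, is a homotopy coproduct of the `X s`: for every
`Y`, the cone of `A(C, Y) ⟶ ∏ s, A(X s, Y)` is acyclic. -/
structure IsHoCoprod (A : DGCat.{w, u, v} k) {I : Type t} (X : I → A.Obj) (C : A.Obj)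
    (ι : ∀ s, A.Hom (X s) C 0) : Prop where
  closed : ∀ s, A.d 0 1 (zero_add 1) (ι s) = 0
  lift : ∀ {Y : A.Obj} {e n m l : ℤ} (he : e + 1 = n) (hn : n + 1 = m) (hm : m + 1 = l)
    (r : A.Hom C Y m) (σ : ∀ s, A.Hom (X s) Y n), A.d m l hm r = 0 →
    (∀ s, A.d n m hn (σ s) = A.comp r (ι s) (add_zero m)) →
    ∃ (g : A.Hom C Y n) (h : ∀ s, A.Hom (X s) Y e), A.d n m hn g = r ∧
      ∀ s, A.comp g (ι s) (add_zero n) - σ s = A.d e n he (h s)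

/-- A bijection on cohomology is a quasi-isomorphism, so its cone is acyclic. Concretely,
injectivity in degree `m` makes `r` exact, and surjectivity in degree `n` corrects the primitive. -/
theorem isHoCoprod_of_bijective {I : Type t} (X : I → A.Obj) (C : A.Obj)
    (ι : ∀ s, A.cocycles (X s) C 0)
    (H : ∀ (Y : A.Obj) (n : ℤ), Function.Bijective fun (f : A.HomH C Y n) (s : I) =>
      A.cohomology.comp (X := X s) (Y := C) (Z := Y) f (A.mkH (ι s)) (add_zero n)) :
    IsHoCoprod A X C fun s => (ι s).1 where
  closed s := d_of_mem _ (ι s).2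
  lift {Y e n m l} he hn hm r σ hr hσ := by
    obtain ⟨g', hg'⟩ : ∃ g' : A.Hom C Y n, A.d n m hn g' = r := by
      have hr' := mem_cocycles hm hr
      refine (mkH_eq_zero_iff hn (⟨r, hr'⟩ : A.cocycles C Y m)).1 ((H Y m).1 ?_)
      funext s
      refine ((mkH_eq_zero_iff hn ⟨_, comp_mem ⟨r, hr'⟩ (ι s) (add_zero m)⟩).2 ⟨σ s, hσ s⟩).trans ?_
      exact (GradedCat.zero_comp (G := A.cohomology) _ _).symm
    -- The primitive `g'` and the given `σ s` have the same differential along `ι s`, so their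
    -- difference is a family of classes, which surjectivity realises by a cocycle on `C`.
    have hc : ∀ s, A.comp g' (ι s).1 (add_zero n) - σ s ∈ A.cocycles (X s) Y n := fun s => by
      refine mem_cocycles hn ?_
      rw [map_sub, hσ, A.d_comp g' (ι s).1 (add_zero n) hn hn (zero_add 1) (add_zero m) hn, hg',
        d_of_mem _ (ι s).2, GradedCat.comp_zero, smul_zero, add_zero, sub_self]
    obtain ⟨g₀, hg₀⟩ := (H Y n).2 fun s => A.mkH ⟨_, hc s⟩
    obtain ⟨g'', rfl⟩ := mkH_surjective g₀
    have hx : ∀ s, ∃ x : A.Hom (X s) Y e, A.d e n he x =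
        A.comp g''.1 (ι s).1 (add_zero n) - (A.comp g' (ι s).1 (add_zero n) - σ s) := fun s =>
      (mkH_eq_iff he ⟨_, comp_mem g'' (ι s) (add_zero n)⟩ ⟨_, hc s⟩).1 (congrFun hg₀ s)
    choose x hx using hx
    refine ⟨g' - g''.1, fun s => - x s, ?_, fun s => ?_⟩
    · rw [map_sub, d_of_mem _ g''.2, sub_zero, hg']
    · rw [map_neg, hx, GradedCat.sub_comp]
      abel

/-- Injectivity is `lift` with `r` the difference of two representatives and `σ` the chosen
primitives; surjectivity is `lift` with `r = 0`. -/
theorem IsHoCoprod.bijective {I : Type t} {X : I → A.Obj} {C : A.Obj}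
    {ι : ∀ s, A.Hom (X s) C 0} (H : IsHoCoprod A X C ι) (Y : A.Obj) (n : ℤ) :
    Function.Bijective fun (f : A.HomH C Y n) (s : I) =>
      A.cohomology.comp (X := X s) (Y := C) (Z := Y) f
        (A.mkH ⟨ι s, mem_cocycles _ (H.closed s)⟩) (add_zero n) := by
  constructor
  · intro f₁ f₂ hf
    obtain ⟨f₁, rfl⟩ := mkH_surjective f₁
    obtain ⟨f₂, rfl⟩ := mkH_surjective f₂
    have hx : ∀ s, ∃ x : A.Hom (X s) Y (n - 1), A.d _ n (sub_add_cancel n 1) x =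
        A.comp f₁.1 (ι s) (add_zero n) - A.comp f₂.1 (ι s) (add_zero n) := fun s =>
      (mkH_eq_iff (sub_add_cancel n 1)
        ⟨_, comp_mem f₁ ⟨ι s, mem_cocycles _ (H.closed s)⟩ (add_zero n)⟩
        ⟨_, comp_mem f₂ ⟨ι s, mem_cocycles _ (H.closed s)⟩ (add_zero n)⟩).1 (congrFun hf s)
    choose x hx using hx
    obtain ⟨g, -, hg, -⟩ := H.lift (sub_add_cancel (n - 1) 1) (sub_add_cancel n 1) rfl
      (f₁.1 - f₂.1) x (d_of_mem rfl (f₁ - f₂).2)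
      (fun s => by rw [hx, GradedCat.sub_comp])
    exact (mkH_eq_iff (sub_add_cancel n 1) _ _).2 ⟨g, hg⟩
  · intro σ
    choose σ' hσ' using fun s => mkH_surjective (σ s)
    obtain ⟨g, h, hg, hh⟩ := H.lift (sub_add_cancel n 1) rfl rfl (0 : A.Hom C Y (n + 1))
      (fun s => (σ' s).1) (map_zero _)
      (fun s => by rw [GradedCat.zero_comp]; exact (σ' s).2)
    refine ⟨A.mkH ⟨g, hg⟩, funext fun s => ?_⟩
    rw [← hσ' s]
    refine (mkH_eq_iff (sub_add_cancel n 1)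
        ⟨_, comp_mem ⟨g, hg⟩ ⟨ι s, mem_cocycles _ (H.closed s)⟩ (add_zero n)⟩ (σ' s)).2 ⟨h s, ?_⟩
    exact (hh s).symm

theorem exists_isHoCoprod {κ : Cardinal.{t}} (H : A.cohomology.HasCoproductsLE κ) {I : Type t}
    (hI : Cardinal.mk I ≤ κ) (X : I → A.Obj) : ∃ C ι, IsHoCoprod A X C ι := by
  obtain ⟨C, ι, h⟩ := H I hI X
  choose ι' hι' using fun s => mkH_surjective (A := A) (X := X s) (Y := C) (ι s)
  obtain rfl : (fun s => A.mkH (ι' s)) = ι := funext hι'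
  exact ⟨C, _, isHoCoprod_of_bijective X C ι' h⟩

theorem hasCoproductsLE_of_isHoCoprod {κ : Cardinal.{t}}
    (H : ∀ (I : Type t), Cardinal.mk I ≤ κ → ∀ X : I → A.Obj, ∃ C ι, IsHoCoprod A X C ι) :
    A.cohomology.HasCoproductsLE κ := by
  intro I hI X
  obtain ⟨C, ι, h⟩ := H I hI X
  exact ⟨C, _, h.bijective⟩

end Classes

/-! ### The opposite dg-category: products as coproducts -/

/-- The opposite dg-category, with composition `g ∘ f` in `A.op` equal to `(-1) ^ (|g| |f|)` times
the composition `f ∘ g` in `A`. -/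
def op : DGCat.{w, u, v} k where
  Obj := A.Obj
  Hom X Y n := A.Hom Y X n
  id := A.id
  comp {X Y Z p q n} g f h := dgSign k (p * q) • A.comp f g (by omega)
  add_comp g g' f h := by rw [A.comp_add, smul_add]
  smul_comp a g f h := by rw [A.comp_smul, smul_comm]
  comp_add g f f' h := by rw [A.add_comp, smul_add]
  comp_smul a g f h := by rw [A.smul_comp, smul_comm]
  id_comp f := by rw [A.comp_id, zero_mul, dgSign_zero, one_smul]
  comp_id f := by rw [A.id_comp, mul_zero, dgSign_zero, one_smul]
  assoc {W X Y Z a b c ab bc n} h g f hab hbc h₁ h₂ := by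
    subst hab hbc
    rw [A.comp_smul, A.smul_comp, smul_smul, smul_smul, ← dgSign_add, ← dgSign_add,
      A.assoc f g h (show c + b = b + c by omega) (show b + a = a + b by omega) (by omega)
        (by omega)]
    congr 2
    ring
  d := A.d
  d_d := A.d_d
  d_comp {X Y Z p q n p' q' n'} g f h hn hp hq h₁ h₂ := by
    subst hp hq
    have e1 : dgSign k ((p + 1) * q) = dgSign k (p * q) * dgSign k q := by
      rw [← dgSign_add]; congr 1; ring
    have e2 : dgSign k (p * (q + 1)) = dgSign k p * dgSign k (p * q) := by
      rw [← dgSign_add]; congr 1; ring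
    rw [map_smul, A.d_comp f g (by omega) hn rfl rfl (by omega) (by omega), e1, e2, smul_smul,
      ← mul_assoc, dgSign_mul_self, one_mul, smul_add, smul_smul, add_comm]

theorem op_comp {X Y Z : A.Obj} {p q n : ℤ} (g : A.Hom Z Y p) (f : A.Hom Y X q) (h : p + q = n) :
    A.op.comp (X := X) (Y := Y) (Z := Z) g f h = dgSign k (p * q) • A.comp f g (by omega) := rfl

variable {A}

theorem op_mkH_comp {X Y Z : A.Obj} {n : ℤ} (f : A.HomH Y X 0) (g : A.HomH Z Y n) :
    A.cohomology.comp f g (zero_add n) = A.op.cohomology.comp (X := X) (Y := Y) (Z := Z) g f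
      (add_zero n) := by
  obtain ⟨g, rfl⟩ := mkH_surjective g
  obtain ⟨f, rfl⟩ := mkH_surjective f
  refine congrArg A.mkH (Subtype.ext ?_)
  change A.comp f.1 g.1 _ = dgSign k (n * 0) • A.comp f.1 g.1 _
  rw [mul_zero, dgSign_zero, one_smul]

/-- Projections have degree `0`, so no Koszul sign appears when composition is reversed, and the two
universal properties coincide literally. -/
theorem hasProductsLE_iff_op (A : DGCat.{w, u, v} k) (κ : Cardinal.{t}) :
    A.cohomology.HasProductsLE κ ↔ A.op.cohomology.HasCoproductsLE κ := by
  refine forall_congr' fun I => forall_congr' fun hI => forall_congr' fun X =>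
    exists_congr fun C => exists_congr fun π => forall_congr' fun Y => forall_congr' fun n => ?_
  refine iff_of_eq (congrArg Function.Bijective ?_)
  funext f s
  exact op_mkH_comp _ _

end DGCat

/-! ### Complete filtrations and successive approximation -/

theorem exists_approx_seq {α : Type*} (P : ℕ → α → Prop) (Q : ℕ → α → α → Prop)
    (h₀ : ∃ x, P 0 x) (hs : ∀ i x, P i x → ∃ y, P (i + 1) y ∧ Q i x y) :
    ∃ a : ℕ → α, (∀ i, P i (a i)) ∧ ∀ i, Q i (a i) (a (i + 1)) := by
  choose! f hf using hs
  obtain ⟨x, hx⟩ := h₀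
  have hP : ∀ i : ℕ, P i (Nat.rec x (fun i y => f i y) i) := fun i => by
    induction i with
    | zero => exact hx
    | succ i ih => exact (hf i _ ih).1
  exact ⟨fun i => Nat.rec x (fun i y => f i y) i, hP, fun i => (hf i _ (hP i)).2⟩

namespace DGCat

variable {k : Type w} [CommRing k]

/-- A complete decreasing multiplicative filtration on the complexes of morphisms of a dg-category,
such that every degree `n` morphism lies in the `n`-th step. -/
structure Filtration (D : DGCat.{w, u, v} k) where
  F : ∀ (X Y : D.Obj) (n : ℤ), ℤ → Submodule k (D.Hom X Y n)
  anti : ∀ {X Y : D.Obj} {n a b : ℤ}, a ≤ b → F X Y n b ≤ F X Y n a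
  mem_self : ∀ {X Y : D.Obj} {n : ℤ} (f : D.Hom X Y n), f ∈ F X Y n n
  comp_mem : ∀ {X Y Z : D.Obj} {p q n a b c : ℤ} {g : D.Hom Y Z p} {f : D.Hom X Y q}
    (h : p + q = n), c ≤ a + b → g ∈ F Y Z p a → f ∈ F X Y q b → D.comp g f h ∈ F X Z n c
  d_mem : ∀ {X Y : D.Obj} {n m a : ℤ} {f : D.Hom X Y n} (h : n + 1 = m), f ∈ F X Y n a →
    D.d n m h f ∈ F X Y m a
  complete : ∀ {X Y : D.Obj} {n a : ℤ} (f : ℕ → D.Hom X Y n),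
    (∀ i : ℕ, f (i + 1) - f i ∈ F X Y n (a + i)) → ∃ f' : D.Hom X Y n, ∀ i : ℕ,
      f' - f i ∈ F X Y n (a + i)
  separated : ∀ {X Y : D.Obj} {n a : ℤ} {f : D.Hom X Y n}, (∀ i : ℕ, f ∈ F X Y n (a + i)) → f = 0

namespace Filtration

variable {D : DGCat.{w, u, v} k} (F : D.Filtration)

theorem mem_of_le {X Y : D.Obj} {n a : ℤ} (h : a ≤ n) (f : D.Hom X Y n) : f ∈ F.F X Y n a :=
  F.anti h (F.mem_self f)

/-- The opposite filtration. -/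
def op : D.op.Filtration where
  F X Y := F.F Y X
  anti h := F.anti h
  mem_self f := F.mem_self f
  comp_mem h hc hg hf := Submodule.smul_mem _ _ (F.comp_mem _ (by omega) hf hg)
  d_mem h hf := F.d_mem h hf
  complete f hf := F.complete f hf
  separated hf := F.separated hf

/-- The morphisms `ι s : X s ⟶ C` induce a homotopy coproduct on associated graded pieces. -/
def IsGrCoprod {I : Type t} (X : I → D.Obj) (C : D.Obj) (ι : ∀ s, D.Hom (X s) C 0) : Prop :=
  ∀ {Y : D.Obj} {e n m l : ℤ} (a : ℤ) (he : e + 1 = n) (hn : n + 1 = m) (hm : m + 1 = l)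
    (r : D.Hom C Y m) (σ : ∀ s, D.Hom (X s) Y n), r ∈ F.F C Y m a → (∀ s, σ s ∈ F.F (X s) Y n a) →
    D.d m l hm r ∈ F.F C Y l (a + 1) →
    (∀ s, D.d n m hn (σ s) - D.comp r (ι s) (add_zero m) ∈ F.F (X s) Y m (a + 1)) →
    ∃ (g : D.Hom C Y n) (h : ∀ s, D.Hom (X s) Y e), g ∈ F.F C Y n a ∧
      (∀ s, h s ∈ F.F (X s) Y e a) ∧ D.d n m hn g - r ∈ F.F C Y m (a + 1) ∧
      ∀ s, D.comp g (ι s) (add_zero n) - σ s - D.d e n he (h s) ∈ F.F (X s) Y n (a + 1)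

/-- A perturbation of the differential of the complexes `∏ s, D(X s, Z)`, compatible with
composition on the left and raising the filtration. -/
structure Twist {I : Type t} (X : I → D.Obj) where
  T : ∀ {Z : D.Obj} (n m : ℤ), n + 1 = m → (∀ s, D.Hom (X s) Z n) →+ (∀ s, D.Hom (X s) Z m)
  T_comp : ∀ {Y Z : D.Obj} {p q q' n n' : ℤ} (g : D.Hom Y Z p) (σ : ∀ s, D.Hom (X s) Y q)
    (h : p + q = n) (hq : q + 1 = q') (hn : n + 1 = n') (h' : p + q' = n') (s : I),
    T n n' hn (fun s => D.comp g (σ s) h) s = dgSign k p • D.comp g (T q q' hq σ s) h'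
  T_T : ∀ {Z : D.Obj} {n m l : ℤ} (hn : n + 1 = m) (hm : m + 1 = l) (σ : ∀ s, D.Hom (X s) Z n)
    (s : I), D.d m l hm (T n m hn σ s) + T m l hm (fun s => D.d n m hn (σ s)) s
      + T m l hm (T n m hn σ) s = 0
  T_mem : ∀ {Z : D.Obj} {n m a : ℤ} (hn : n + 1 = m) (σ : ∀ s, D.Hom (X s) Z n),
    (∀ s, σ s ∈ F.F (X s) Z n a) → ∀ s, T n m hn σ s ∈ F.F (X s) Z m (a + 1)

namespace Twist

variable {F} {I : Type t} {X : I → D.Obj} (T : F.Twist X)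

/-- The perturbed differential. -/
def δ {Z : D.Obj} (n m : ℤ) (h : n + 1 = m) (σ : ∀ s, D.Hom (X s) Z n) (s : I) :
    D.Hom (X s) Z m := D.d n m h (σ s) + T.T n m h σ s

theorem δ_add {Z : D.Obj} {n m : ℤ} (h : n + 1 = m) (σ τ : ∀ s, D.Hom (X s) Z n) (s : I) :
    T.δ n m h (fun s => σ s + τ s) s = T.δ n m h σ s + T.δ n m h τ s := by
  have : T.T n m h (fun s => σ s + τ s) = T.T n m h σ + T.T n m h τ := map_add _ _ _
  rw [δ, δ, δ, this, map_add, Pi.add_apply]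
  abel

theorem δ_sub {Z : D.Obj} {n m : ℤ} (h : n + 1 = m) (σ τ : ∀ s, D.Hom (X s) Z n) (s : I) :
    T.δ n m h (fun s => σ s - τ s) s = T.δ n m h σ s - T.δ n m h τ s := by
  have : T.T n m h (fun s => σ s - τ s) = T.T n m h σ - T.T n m h τ := map_sub _ _ _
  rw [δ, δ, δ, this, map_sub, Pi.sub_apply]
  abel

theorem δ_mem {Z : D.Obj} {n m a : ℤ} (h : n + 1 = m) {σ : ∀ s, D.Hom (X s) Z n}
    (hσ : ∀ s, σ s ∈ F.F (X s) Z n a) (s : I) : T.δ n m h σ s ∈ F.F (X s) Z m a :=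
  add_mem (F.d_mem h (hσ s)) (F.anti (by omega) (T.T_mem h σ hσ s))

theorem δ_δ {Z : D.Obj} {n m l : ℤ} (hn : n + 1 = m) (hm : m + 1 = l)
    (σ : ∀ s, D.Hom (X s) Z n) (s : I) : T.δ m l hm (T.δ n m hn σ) s = 0 := by
  have : T.T m l hm (T.δ n m hn σ) = T.T m l hm (fun s => D.d n m hn (σ s))
      + T.T m l hm (T.T n m hn σ) := map_add _ _ _
  rw [δ, this, δ, map_add, D.d_d, zero_add, Pi.add_apply, ← add_assoc]
  exact T.T_T hn hm σ s

theorem δ_comp {Y Z : D.Obj} {p q p' q' n n' : ℤ} (g : D.Hom Y Z p) (σ : ∀ s, D.Hom (X s) Y q)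
    (h : p + q = n) (hn : n + 1 = n') (hp : p + 1 = p') (hq : q + 1 = q') (h₁ : p' + q = n')
    (h₂ : p + q' = n') (s : I) : T.δ n n' hn (fun s => D.comp g (σ s) h) s =
      D.comp (D.d p p' hp g) (σ s) h₁ + dgSign k p • D.comp g (T.δ q q' hq σ s) h₂ := by
  rw [δ, δ, D.d_comp g (σ s) h hn hp hq h₁ h₂, T.T_comp g σ h hq hn h₂, D.comp_add, smul_add,
    add_assoc]

variable {C : D.Obj}

/-- The curvature of an endomorphism of degree `1`. -/
def curv (c : D.Hom C C 1) : D.Hom C C 2 :=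
  D.d 1 2 one_add_one_eq_two c + D.comp c c one_add_one_eq_two

/-- The Bianchi identity. Both terms on the right lie one filtration step above `curv c`, so the
curvature is closed on the associated graded. -/
theorem d_curv (c : D.Hom C C 1) (h : (2 : ℤ) + 1 = 3) : D.d 2 3 h (curv c) =
    D.comp (curv c) c h - D.comp c (curv c) (by omega) := by
  rw [curv, map_add, D.d_d, D.d_comp c c one_add_one_eq_two h one_add_one_eq_two
    one_add_one_eq_two h (by omega), D.add_comp, D.comp_add, dgSign_one,
    D.assoc c c c one_add_one_eq_two one_add_one_eq_two h (by omega)]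
  module

/-- The defect of closedness of `ι` for the differential twisted by `c`. -/
def defect (c : D.Hom C C 1) (ι : ∀ s, D.Hom (X s) C 0) (s : I) : D.Hom (X s) C 1 :=
  T.δ 0 1 (zero_add 1) ι s + D.comp c (ι s) (add_zero 1)

/-- The companion Bianchi identity. With `d_curv` it says that (curvature, defect) is a cocycle, up
to higher filtration, in the cone of precomposition with `ι`. -/
theorem δ_defect (c : D.Hom C C 1) (ι : ∀ s, D.Hom (X s) C 0) (s : I) :
    T.δ 1 2 one_add_one_eq_two (T.defect c ι) s = D.comp (curv c) (ι s) (add_zero 2)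
      - D.comp c (T.defect c ι s) one_add_one_eq_two := by
  have h := T.δ_add one_add_one_eq_two (T.δ 0 1 (zero_add 1) ι)
    (fun s => D.comp c (ι s) (add_zero 1)) s
  refine h.trans ?_
  rw [T.δ_δ, T.δ_comp c ι (add_zero 1) one_add_one_eq_two one_add_one_eq_two (zero_add 1)
    (add_zero 2) one_add_one_eq_two, defect, curv, D.add_comp, D.comp_add, dgSign_one,
    D.assoc c c (ι s) one_add_one_eq_two (add_zero 1) (add_zero 2) one_add_one_eq_two]
  module

theorem curv_add (c u : D.Hom C C 1) : curv (c + u) = curv c +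
    D.d 1 2 one_add_one_eq_two u + (D.comp c u one_add_one_eq_two +
      D.comp u c one_add_one_eq_two + D.comp u u one_add_one_eq_two) := by
  simp only [curv, map_add, D.add_comp, D.comp_add]
  abel

theorem defect_add (c u : D.Hom C C 1) (ι j : ∀ s, D.Hom (X s) C 0) (s : I) :
    T.defect (c + u) (fun s => ι s + j s) s = T.defect c ι s + T.δ 0 1 (zero_add 1) j s +
      D.comp u (ι s) (add_zero 1) + D.comp c (j s) (add_zero 1) +
      D.comp u (j s) (add_zero 1) := by
  simp only [defect, δ_add, D.add_comp, D.comp_add]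
  abel

/-- The cross terms and the quadratic term contain a factor of degree `1`, which lies in step `1`;
only `d u` survives on the graded piece. -/
theorem curv_add_sub_mem {c u : D.Hom C C 1} {a : ℤ} (hu : u ∈ F.F C C 1 a) :
    curv (c + u) - curv c - D.d 1 2 one_add_one_eq_two u ∈ F.F C C 2 (a + 1) := by
  rw [curv_add]
  have h1 : D.comp c u one_add_one_eq_two ∈ F.F C C 2 (a + 1) :=
    F.comp_mem _ (by omega) (F.mem_self c) hu
  have h2 : D.comp u c one_add_one_eq_two ∈ F.F C C 2 (a + 1) :=
    F.comp_mem _ (by omega) hu (F.mem_self c)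
  have h3 : D.comp u u one_add_one_eq_two ∈ F.F C C 2 (a + 1) :=
    F.comp_mem _ (by omega) hu (F.mem_self u)
  convert add_mem (add_mem h1 h2) h3 using 1
  abel

/-- Linearisation of the defect: on the graded piece only `d j + u ∘ ι` is visible. No filtration
bound on `u` is needed, since `u` has degree `1` and so `u ∘ j` already rises by one step. -/
theorem defect_add_sub_mem {c u : D.Hom C C 1} {ι j : ∀ s, D.Hom (X s) C 0} {a : ℤ}
    (hj : ∀ s, j s ∈ F.F (X s) C 0 a) (s : I) :
    T.defect (c + u) (fun s => ι s + j s) s - T.defect c ι s - D.d 0 1 (zero_add 1) (j s)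
      - D.comp u (ι s) (add_zero 1) ∈ F.F (X s) C 1 (a + 1) := by
  rw [defect_add]
  have h1 := T.T_mem (zero_add 1) j hj s
  have h2 : D.comp c (j s) (add_zero 1) ∈ F.F (X s) C 1 (a + 1) :=
    F.comp_mem _ (by omega) (F.mem_self c) (hj s)
  have h3 : D.comp u (j s) (add_zero 1) ∈ F.F (X s) C 1 (a + 1) :=
    F.comp_mem _ (by omega) (F.mem_self u) (hj s)
  convert add_mem (add_mem h1 h2) h3 using 1
  rw [δ]
  abel


/-- Obstruction theory: at each stage the pair (curvature, defect) is a cocycle on a graded piece,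
and acyclicity of the graded cone provides the correction that pushes it one step higher.
Completeness gives a limit, and separatedness shows that its curvature and defect vanish. -/
theorem exists_curv_eq_zero {ι₀ : ∀ s, D.Hom (X s) C 0} (hι₀ : ∀ s, D.d 0 1 (zero_add 1) (ι₀ s) = 0)
    (H : F.IsGrCoprod X C ι₀) : ∃ (c : D.Hom C C 1) (ι : ∀ s, D.Hom (X s) C 0),
      curv c = 0 ∧ (∀ s, T.defect c ι s = 0) ∧ ∀ s, ι s - ι₀ s ∈ F.F (X s) C 0 1 := by
  obtain ⟨a, hP, hQ⟩ := exists_approx_seq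
    (α := D.Hom C C 1 × ∀ s, D.Hom (X s) C 0)
    (fun i x => (∀ s, x.2 s - ι₀ s ∈ F.F (X s) C 0 1) ∧ curv x.1 ∈ F.F C C 2 (1 + i) ∧
      ∀ s, T.defect x.1 x.2 s ∈ F.F (X s) C 1 (1 + i))
    (fun i x y => y.1 - x.1 ∈ F.F C C 1 (1 + i) ∧ ∀ s, y.2 s - x.2 s ∈ F.F (X s) C 0 (1 + i))
    -- The starting point `c = 0` is flat, and its defect is `T ι₀`, which lies in step `1` because
    -- `T` raises the filtration.
    ⟨(0, ι₀), fun s => by rw [sub_self]; exact zero_mem _, by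
      rw [curv, map_zero, GradedCat.zero_comp, add_zero]; exact zero_mem _, fun s => by
      rw [defect, δ, GradedCat.zero_comp, add_zero, hι₀, zero_add]
      exact F.anti (by simp) (T.T_mem (zero_add 1) ι₀ (fun s => F.mem_self _) s)⟩ (by
    rintro i ⟨c, ι⟩ ⟨h1, h2, h3⟩
    dsimp only at h1 h2 h3
    -- The correction must cancel the obstruction to leading order, whence the negated curvature and
    -- defect as data for the graded lifting problem.
    obtain ⟨u, j, hu, hj, hu', hj'⟩ := H (1 + i) (zero_add 1) one_add_one_eq_two
      (show (2 : ℤ) + 1 = 3 by norm_num) (-curv c) (fun s => -T.defect c ι s) (neg_mem h2)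
      (fun s => neg_mem (h3 s)) (by
        rw [map_neg, d_curv]
        exact neg_mem (sub_mem (F.comp_mem _ le_rfl h2 (F.mem_self c))
          (F.comp_mem _ (by omega) (F.mem_self c) h2))) (fun s => by
        have e1 := T.δ_defect c ι s
        rw [δ] at e1
        -- The graded hypothesis is about `ι₀`; replacing `ι` by `ι₀` costs one filtration step, as
        -- `ι - ι₀` lies in step `1`.
        have e2 : D.comp (curv c) (ι s - ι₀ s) (add_zero 2) ∈ F.F (X s) C 2 (1 + i + 1) :=
          F.comp_mem _ le_rfl h2 (h1 s)
        have e3 : D.comp c (T.defect c ι s) one_add_one_eq_two ∈ F.F (X s) C 2 (1 + i + 1) :=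
          F.comp_mem _ (by omega) (F.mem_self c) (h3 s)
        have e4 := T.T_mem one_add_one_eq_two (T.defect c ι) h3 s
        convert sub_mem (add_mem e4 e3) e2 using 1
        rw [GradedCat.comp_sub, map_neg, GradedCat.neg_comp, eq_sub_of_add_eq e1]
        abel)
    -- The lift satisfies `u ∘ ι₀ + defect - d j ≡ 0`, so `j` has to be subtracted from `ι`.
    refine ⟨(c + u, fun s => ι s + - j s), ⟨fun s => ?_, ?_, fun s => ?_⟩, ?_, fun s => ?_⟩
    · rw [show ι s + -j s - ι₀ s = ι s - ι₀ s - j s by abel]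
      exact sub_mem (h1 s) (F.anti (by omega) (hj s))
    · have := add_mem (curv_add_sub_mem (c := c) hu) hu'
      push_cast
      rw [← add_assoc]
      convert this using 1
      abel
    · have e1 := T.defect_add_sub_mem (c := c) (u := u) (ι := ι) (j := fun s => - j s)
        (fun s => neg_mem (hj s)) s
      have e2 : D.comp u (ι s - ι₀ s) (add_zero 1) ∈ F.F (X s) C 1 (1 + i + 1) :=
          F.comp_mem _ le_rfl hu (h1 s)
      have := add_mem (add_mem e1 e2) (hj' s)
      push_cast
      rw [← add_assoc]
      convert this using 1
      rw [GradedCat.comp_sub, map_neg]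
      abel
    · rw [add_sub_cancel_left]
      exact hu
    · rw [add_sub_cancel_left]
      exact neg_mem (hj s))
  obtain ⟨c, hc⟩ := F.complete (fun i => (a i).1) fun i => (hQ i).1
  choose ι hι using fun s => F.complete (fun i => (a i).2 s) fun i => (hQ i).2 s
  refine ⟨c, ι, F.separated (a := 1) fun i => ?_, fun s => F.separated (a := 1) fun i => ?_,
    fun s => ?_⟩
  -- The limit differs from the `i`-th stage by an element of step `1 + i`, so its curvature lies in
  -- every step.
  · have e := curv_add_sub_mem (c := (a i).1) (hc i)
    rw [add_sub_cancel] at e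
    have := add_mem (add_mem (F.anti (by omega) e) (F.d_mem one_add_one_eq_two (hc i))) (hP i).2.1
    convert this using 1
    abel
  · have e := T.defect_add_sub_mem (c := (a i).1) (u := c - (a i).1) (ι := (a i).2)
      (j := fun s => ι s - (a i).2 s) (fun s => hι s i) s
    simp only [add_sub_cancel] at e
    have e1 : D.comp (c - (a i).1) ((a i).2 s) (add_zero 1) ∈ F.F (X s) C 1 (1 + i) :=
      F.comp_mem _ (by omega) (hc i) (F.mem_self _)
    have := add_mem (add_mem (add_mem (F.anti (by omega) e) (F.d_mem (zero_add 1) (hι s i))) e1)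
      ((hP i).2.2 s)
    convert this using 1
    abel
  · have := add_mem (hι s 0) ((hP 0).1 s)
    simpa using this

/-- The differential of `∏ s, D(X s, Y)`, twisted by a Maurer-Cartan element of `Y`. -/
def δMC (Y : D.MCObj) (n m : ℤ) (h : n + 1 = m) (σ : ∀ s, D.Hom (X s) Y.X n) (s : I) :
    D.Hom (X s) Y.X m := T.δ n m h σ s + D.comp Y.x (σ s) (by omega)

theorem δMC_add {Y : D.MCObj} {n m : ℤ} (h : n + 1 = m) (σ τ : ∀ s, D.Hom (X s) Y.X n) (s : I) :
    T.δMC Y n m h (fun s => σ s + τ s) s = T.δMC Y n m h σ s + T.δMC Y n m h τ s := by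
  simp only [δMC, δ_add, D.comp_add]
  abel

theorem δMC_sub {Y : D.MCObj} {n m : ℤ} (h : n + 1 = m) (σ τ : ∀ s, D.Hom (X s) Y.X n) (s : I) :
    T.δMC Y n m h (fun s => σ s - τ s) s = T.δMC Y n m h σ s - T.δMC Y n m h τ s := by
  simp only [δMC, δ_sub, GradedCat.comp_sub]
  abel

theorem δMC_mem {Y : D.MCObj} {n m a : ℤ} (h : n + 1 = m) {σ : ∀ s, D.Hom (X s) Y.X n}
    (hσ : ∀ s, σ s ∈ F.F (X s) Y.X n a) (s : I) : T.δMC Y n m h σ s ∈ F.F (X s) Y.X m a :=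
  add_mem (T.δ_mem h hσ s) (F.comp_mem _ (by omega) (F.mem_self Y.x) (hσ s))

theorem δMC_δMC {Y : D.MCObj} {n m l : ℤ} (hn : n + 1 = m) (hm : m + 1 = l)
    (σ : ∀ s, D.Hom (X s) Y.X n) (s : I) : T.δMC Y m l hm (T.δMC Y n m hn σ) s = 0 := by
  have h := T.δ_add hm (T.δ n m hn σ) (fun s => D.comp Y.x (σ s) (by omega)) s
  refine (congrArg₂ (· + ·) h rfl).trans ?_
  rw [T.δ_δ, T.δ_comp Y.x σ (show 1 + n = m by omega) hm one_add_one_eq_two hn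
    (show 2 + n = l by omega) (show 1 + m = l by omega), δMC,
    D.comp_add, eq_neg_of_add_eq_zero_left Y.mc, GradedCat.neg_comp, dgSign_one,
    D.assoc Y.x Y.x (σ s) one_add_one_eq_two (show 1 + n = m by omega) (show 2 + n = l by omega)
      (show 1 + m = l by omega)]
  module

/-- Precomposition with `ι` is a chain map for the twisted differentials: vanishing of the defect
turns the term with `δ ι` into the one with the Maurer-Cartan element of `C`. -/
theorem δMC_comp {C Y : D.MCObj} {ι : ∀ s, D.Hom (X s) C.X 0} (hι : ∀ s, T.defect C.x ι s = 0)
    {n m : ℤ} (hn : n + 1 = m) (g : D.Hom C.X Y.X n) (s : I) :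
    T.δMC Y n m hn (fun s => D.comp g (ι s) (add_zero n)) s =
      D.comp (D.mcD C Y n m hn g) (ι s) (add_zero m) := by
  rw [δMC, T.δ_comp g ι (add_zero n) hn hn (zero_add 1) (add_zero m) hn,
    eq_neg_of_add_eq_zero_left (hι s), mcD_apply, GradedCat.sub_comp, D.add_comp, D.smul_comp,
    GradedCat.comp_neg, D.assoc g C.x (ι s) hn (add_zero 1) (add_zero m) hn,
    D.assoc Y.x g (ι s) (by omega) (add_zero n) (add_zero m) (by omega)]
  module

/-- Acyclicity passes from the graded pieces to the complete filtered cone: the residual error of an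
approximate solution is again a cocycle, and the graded statement improves it by one step. This is
the `lift` half of being a homotopy coproduct, for the twisted differentials. -/
theorem exists_lift {ι₀ : ∀ s, D.Hom (X s) C 0}
    (H : F.IsGrCoprod X C ι₀) {c : D.Hom C C 1} {ι : ∀ s, D.Hom (X s) C 0} (hc : curv c = 0)
    (hι : ∀ s, T.defect c ι s = 0) (hι₀ : ∀ s, ι s - ι₀ s ∈ F.F (X s) C 0 1) {Y : D.MCObj}
    {e n m l : ℤ} (he : e + 1 = n) (hn : n + 1 = m) (hm : m + 1 = l) (r : D.Hom C Y.X m)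
    (σ : ∀ s, D.Hom (X s) Y.X n) (hr : D.mcD ⟨C, c, hc⟩ Y m l hm r = 0)
    (hσ : ∀ s, T.δMC Y n m hn σ s = D.comp r (ι s) (add_zero m)) :
    ∃ (g : D.Hom C Y.X n) (h : ∀ s, D.Hom (X s) Y.X e), D.mcD ⟨C, c, hc⟩ Y n m hn g = r ∧
      ∀ s, D.comp g (ι s) (add_zero n) - σ s = T.δMC Y e n he h s := by
  -- On graded pieces the twisted differential agrees with `d`.
  have hmem : ∀ {n m a : ℤ} (hn : n + 1 = m) {g : D.Hom C Y.X n}, g ∈ F.F C Y.X n a →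
      D.mcD ⟨C, c, hc⟩ Y n m hn g - D.d n m hn g ∈ F.F C Y.X m (a + 1) := by
    intro n m a hn g hg
    rw [mcD_apply]
    have e1 : D.comp Y.x g (by omega) ∈ F.F C Y.X m (a + 1) :=
      F.comp_mem _ (by omega) (F.mem_self Y.x) hg
    have e2 : D.comp g c hn ∈ F.F C Y.X m (a + 1) :=
      F.comp_mem _ (by omega) hg (F.mem_self c)
    convert sub_mem e1 (Submodule.smul_mem _ (dgSign k n) e2) using 1
    abel
  obtain ⟨x, hP, hQ⟩ := exists_approx_seq
    (α := D.Hom C Y.X n × ∀ s, D.Hom (X s) Y.X e)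
    (fun i x => r - D.mcD ⟨C, c, hc⟩ Y n m hn x.1 ∈ F.F C Y.X m (n + i) ∧
      ∀ s, σ s - D.comp x.1 (ι s) (add_zero n) + T.δMC Y e n he x.2 s ∈ F.F (X s) Y.X n (n + i))
    (fun i x y => y.1 - x.1 ∈ F.F C Y.X n (n + i) ∧ ∀ s, y.2 s - x.2 s ∈ F.F (X s) Y.X e (n + i))
    -- The zero solution works at step `n` since morphisms of degree `n` and `n + 1` all lie there.
    -- This is why the approximation starts at `n`.
    ⟨(0, fun _ => 0), F.mem_of_le (by simp; omega) _, fun s => F.mem_of_le (by simp) _⟩ (by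
    rintro i ⟨g, h⟩ ⟨h1, h2⟩
    dsimp only at h1 h2
    set r' := r - D.mcD ⟨C, c, hc⟩ Y n m hn g with hr'
    set σ' : ∀ s, D.Hom (X s) Y.X n :=
      fun s => σ s - D.comp g (ι s) (add_zero n) + T.δMC Y e n he h s with hσ'
    -- The error `(r', σ')` satisfies the exact cocycle equations of the twisted cone, because the
    -- current approximation contributes a boundary.
    have hr'0 : D.mcD ⟨C, c, hc⟩ Y m l hm r' = 0 := by
      rw [hr', map_sub, hr, zero_sub, neg_eq_zero]
      exact D.mcDG.d_d (X := ⟨C, c, hc⟩) (Y := Y) hn hm g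
    have hσ'0 : ∀ s, T.δMC Y n m hn σ' s = D.comp r' (ι s) (add_zero m) := fun s => by
      rw [hσ', T.δMC_add, T.δMC_sub, hσ, T.δMC_δMC,
        T.δMC_comp (C := ⟨C, c, hc⟩) hι hn g s, add_zero, ← GradedCat.sub_comp]
    obtain ⟨u, j, hu, hj, hu', hj'⟩ := H (n + i) he hn hm r' σ' h1 h2 (by
        have := hmem hm h1
        rw [hr'0, zero_sub] at this
        simpa using this) (fun s => by
        have e1 := hσ'0 s
        rw [δMC, δ] at e1
        have e2 : D.comp r' (ι s - ι₀ s) (add_zero m) ∈ F.F (X s) Y.X m (n + i + 1) :=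
          F.comp_mem _ le_rfl h1 (hι₀ s)
        have e3 : D.comp Y.x (σ' s) (by omega) ∈ F.F (X s) Y.X m (n + i + 1) :=
          F.comp_mem _ (by omega) (F.mem_self Y.x) (h2 s)
        have e4 := T.T_mem hn σ' h2 s
        convert sub_mem (sub_mem e2 e3) e4 using 1
        rw [GradedCat.comp_sub, ← e1]
        abel)
    refine ⟨(g + u, fun s => h s + j s), ⟨?_, fun s => ?_⟩, ?_, fun s => ?_⟩
    · have := neg_mem (add_mem hu' (hmem hn hu))
      push_cast
      rw [← add_assoc]
      convert this using 1
      rw [map_add, hr']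
      abel
    · have e2 : D.comp u (ι s - ι₀ s) (add_zero n) ∈ F.F (X s) Y.X n (n + i + 1) :=
        F.comp_mem _ le_rfl hu (hι₀ s)
      have e3 : D.comp Y.x (j s) (by omega) ∈ F.F (X s) Y.X n (n + i + 1) :=
        F.comp_mem _ (by omega) (F.mem_self Y.x) (hj s)
      have e4 := T.T_mem he j hj s
      have := sub_mem (add_mem e4 e3) (add_mem (hj' s) e2)
      push_cast
      rw [← add_assoc]
      convert this using 1
      have e5 : T.δMC Y e n he j s = D.d e n he (j s) + T.T e n he j s
        + D.comp Y.x (j s) (by omega) := rfl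
      rw [T.δMC_add, e5, GradedCat.comp_sub, D.add_comp]
      change _ = T.T e n he j s + D.comp Y.x (j s) _ -
        (D.comp u (ι₀ s) _ - (σ s - D.comp g (ι s) _ + T.δMC Y e n he h s) - D.d e n he (j s) +
          (D.comp u (ι s) _ - D.comp u (ι₀ s) _))
      abel
    · rw [add_sub_cancel_left]
      exact hu
    · rw [add_sub_cancel_left]
      exact hj s)
  obtain ⟨g, hg⟩ := F.complete (fun i => (x i).1) fun i => (hQ i).1
  choose h hh using fun s => F.complete (fun i => (x i).2 s) fun i => (hQ i).2 s
  refine ⟨g, h, ?_, fun s => ?_⟩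
  · refine (sub_eq_zero.1 (F.separated (a := n) fun i => ?_)).symm
    have e1 := (hP i).1
    have e2 := add_mem (F.anti (by omega) (hmem hn (hg i))) (F.d_mem hn (hg i))
    convert sub_mem e1 e2 using 1
    rw [map_sub]
    abel
  · refine (sub_eq_zero.1 (F.separated (a := n) fun i => ?_))
    have e1 := (hP i).2 s
    have e2 : D.comp (g - (x i).1) (ι s) (add_zero n) ∈ F.F (X s) Y.X n (n + i) :=
      F.comp_mem _ (by omega) (hg i) (F.mem_self (ι s))
    have e3 := T.δMC_mem he (fun s => hh s i) s
    convert sub_mem (sub_mem e2 e3) e1 using 1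
    rw [GradedCat.sub_comp, T.δMC_sub]
    abel

end Twist
end Filtration
end DGCat

/-! ### Coproducts and products of Maurer-Cartan objects -/

namespace DGCat

variable {k : Type w} [CommRing k] {D : DGCat.{w, u, v} k}

namespace Filtration

variable (F : D.Filtration)

/-- The perturbation of the differential of `∏ s, D(X s, Z)` given by Maurer-Cartan elements of the
`X s`. -/
def mcTwist {I : Type t} (X : I → D.MCObj) : F.Twist fun s => (X s).X where
  T {Z} n m h :=
    { toFun := fun σ s => -(dgSign k n • D.comp (σ s) (X s).x h)
      map_zero' := by
        funext s
        simp only [Pi.zero_apply, GradedCat.zero_comp, smul_zero, neg_zero]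
      map_add' := fun σ τ => by
        funext s
        simp only [Pi.add_apply, D.add_comp, smul_add, neg_add] }
  T_comp {Y Z p q q' n n'} g σ h hq hn h' s := by
    subst h
    change -(dgSign k (p + q) • D.comp (D.comp g (σ s) rfl) (X s).x hn) =
      dgSign k p • D.comp g (-(dgSign k q • D.comp (σ s) (X s).x hq)) h'
    rw [GradedCat.comp_neg, D.comp_smul, dgSign_add, D.assoc g (σ s) (X s).x rfl hq hn h']
    module
  T_T {Z n m l} hn hm σ s := by
    subst hn
    change D.d _ l hm (-(dgSign k n • D.comp (σ s) (X s).x rfl)) +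
      -(dgSign k (n + 1) • D.comp (D.d n _ rfl (σ s)) (X s).x hm) +
      -(dgSign k (n + 1) • D.comp (-(dgSign k n • D.comp (σ s) (X s).x rfl)) (X s).x hm) = 0
    rw [map_neg, map_smul, D.d_comp (σ s) (X s).x rfl hm rfl one_add_one_eq_two hm (by omega),
      GradedCat.neg_comp, D.smul_comp, D.assoc (σ s) (X s).x (X s).x rfl one_add_one_eq_two hm
        (by omega), eq_neg_of_add_eq_zero_left (X s).mc, dgSign_succ, GradedCat.comp_neg]
    module
  T_mem {Z n m a} hn σ hσ s :=
    neg_mem (Submodule.smul_mem _ _ (F.comp_mem hn le_rfl (hσ s) (F.mem_self _)))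

/-- Identifies the abstract perturbed complex with the product of complexes of morphisms of
Maurer-Cartan objects, so that the perturbation theorems speak about `mcDG`. -/
theorem mcTwist_δMC {I : Type t} (X : I → D.MCObj) (Y : D.MCObj) {n m : ℤ} (h : n + 1 = m)
    (σ : ∀ s, D.Hom (X s).X Y.X n) (s : I) :
    (F.mcTwist X).δMC Y n m h σ s = D.mcD (X s) Y n m h (σ s) := by
  change D.d n m h (σ s) + -(dgSign k n • D.comp (σ s) (X s).x h) + D.comp Y.x (σ s) _ = _
  rw [mcD_apply]
  abel

theorem exists_isHoCoprod_mc {I : Type t} (X : I → D.MCObj) {C : D.Obj}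
    {ι₀ : ∀ s, D.Hom (X s).X C 0} (hι₀ : ∀ s, D.d 0 1 (zero_add 1) (ι₀ s) = 0)
    (H : F.IsGrCoprod (fun s => (X s).X) C ι₀) :
    ∃ (C' : D.mcDG.Obj) (ι : ∀ s, D.mcDG.Hom (X s) C' 0), IsHoCoprod D.mcDG X C' ι := by
  obtain ⟨c, ι, hc, hι, h⟩ := (F.mcTwist X).exists_curv_eq_zero hι₀ H
  refine ⟨⟨C, c, hc⟩, ι, fun s => ?_, fun {Y e n m l} he hn hm r σ hr hσ => ?_⟩
  · exact (F.mcTwist_δMC X ⟨C, c, hc⟩ (zero_add 1) ι s).symm.trans (hι s)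
  · obtain ⟨g, h, hg, hh⟩ := (F.mcTwist X).exists_lift H hc hι h he hn hm r σ hr
      (fun s => (F.mcTwist_δMC X Y hn σ s).trans (hσ s))
    exact ⟨g, h, hg, fun s => (hh s).trans (F.mcTwist_δMC X Y he h s)⟩

end Filtration

/-- The Maurer-Cartan object of `D.op` corresponding to a Maurer-Cartan object of `D`. -/
def MCObj.op (X : D.MCObj) : D.op.MCObj where
  X := X.X
  x := -(show D.Hom X.X X.X 1 from X.x)
  mc := by
    change D.d 1 2 one_add_one_eq_two (-X.x) +
      dgSign k (1 * 1) • D.comp (-X.x) (-X.x) one_add_one_eq_two = 0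
    rw [map_neg, GradedCat.neg_comp, GradedCat.comp_neg, mul_one, dgSign_one,
      eq_neg_of_add_eq_zero_left X.mc]
    module

theorem mc_neg_of_op {X : D.Obj} (x : D.Hom X X 1)
    (h : D.d 1 2 one_add_one_eq_two x +
      dgSign k (1 * 1) • D.comp x x one_add_one_eq_two = 0) :
    D.d 1 2 one_add_one_eq_two (-x) + D.comp (-x) (-x) one_add_one_eq_two = 0 := by
  rw [mul_one, dgSign_one] at h
  rw [map_neg, GradedCat.neg_comp, GradedCat.comp_neg, eq_neg_of_add_eq_zero_left h]
  module

/-- Reversing composition changes the sign of `x ∘ x` in degree `1`, which `x ↦ -x` compensates;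
this sign change is an involution, so every Maurer-Cartan object of the opposite comes from one of
`D`. -/
theorem MCObj.exists_op_eq (X : D.op.MCObj) : ∃ Y : D.MCObj, Y.op = X := by
  obtain ⟨X, x, hx⟩ := X
  change D.Obj at X
  change D.Hom X X 1 at x
  refine ⟨⟨X, -x, mc_neg_of_op x hx⟩, ?_⟩
  have : - -x = x := neg_neg x
  simp only [MCObj.op]
  congr 1

/-- The Koszul signs and the sign in `MCObj.op` cancel: left and right twisting terms exchange their
roles and the differential is unchanged. -/
theorem MCObj.op_mcD (X Y : D.MCObj) {n m : ℤ} (h : n + 1 = m) (f : D.Hom X.X Y.X n) :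
    D.op.mcD Y.op X.op n m h f = D.mcD X Y n m h f := by
  change D.d n m h f + dgSign k (1 * n) • D.comp f (-X.x) _ -
    dgSign k n • dgSign k (n * 1) • D.comp (-Y.x) f _ = _
  rw [mcD_apply, GradedCat.neg_comp, GradedCat.comp_neg, one_mul, mul_one, smul_smul,
    dgSign_mul_self]
  module

theorem IsHoCoprod.of_op_mcDG {I : Type t} {X : I → D.MCObj} {C : D.MCObj}
    {ι : ∀ s, D.Hom C.X (X s).X 0}
    (H : IsHoCoprod D.op.mcDG (fun s => (X s).op) C.op ι) :
    IsHoCoprod D.mcDG.op X C ι where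
  closed s := (MCObj.op_mcD C (X s) (zero_add 1) (ι s)).symm.trans (H.closed s)
  lift {Y e n m l} he hn hm r σ hr hσ := by
    obtain ⟨g, h, hg, hh⟩ := H.lift (Y := MCObj.op Y) he hn hm r σ
      ((MCObj.op_mcD Y C hm r).trans hr)
      (fun s => (MCObj.op_mcD Y (X s) hn (σ s)).trans (hσ s))
    exact ⟨g, h, (MCObj.op_mcD Y C hn g).symm.trans hg, fun s => (hh s).trans
      (MCObj.op_mcD Y (X s) he (h s))⟩

namespace Filtration

variable (F : D.Filtration)

/-- The coproduct construction applied to the opposite filtration, then carried from Maurer-Cartan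
objects of the opposite to the opposite of Maurer-Cartan objects. -/
theorem exists_isHoCoprod_op_mc {I : Type t} (X : I → D.MCObj) {C : D.Obj}
    {π₀ : ∀ s, D.Hom C (X s).X 0} (hπ₀ : ∀ s, D.d 0 1 (zero_add 1) (π₀ s) = 0)
    (H : F.op.IsGrCoprod (fun s => (X s).X) C π₀) :
    ∃ (C' : D.mcDG.op.Obj) (π : ∀ s, D.mcDG.op.Hom (X s) C' 0), IsHoCoprod D.mcDG.op X C' π := by
  obtain ⟨C', π, h⟩ := F.op.exists_isHoCoprod_mc (fun s => (X s).op) hπ₀ H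
  obtain ⟨C', rfl⟩ : ∃ C'' : D.MCObj, C''.op = C' := MCObj.exists_op_eq C'
  exact ⟨C', π, IsHoCoprod.of_op_mcDG h⟩

end Filtration

/-! ### Homotopy cones of Maurer-Cartan objects -/

/-- The family of two objects. -/
abbrev pairObj (X Y : D.Obj) : Bool → D.Obj
  | true => X
  | false => Y

/-- The family of two morphisms. -/
def pairHom {X Y Z : D.Obj} {n : ℤ} (f : D.Hom X Z n) (g : D.Hom Y Z n) :
    ∀ b, D.Hom (pairObj X Y b) Z n
  | true => f
  | false => g

namespace Filtration

variable (F : D.Filtration)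

/-- The perturbation of the differential of `D(X, Z) × D(Y, Z)` given by a closed degree `1`
morphism of Maurer-Cartan objects. -/
def coneTwist (X Y : D.MCObj) (f : D.Hom X.X Y.X 1)
    (hf : D.mcD X Y 1 2 one_add_one_eq_two f = 0) : F.Twist (pairObj X.X Y.X) where
  T {Z} n m h :=
    -- Up to sign this is right composition with the triangular matrix on `X ⊕ Y` having diagonal
    -- `x`, `y` and off-diagonal entry `f`. It acts on pairs of morphisms, so no direct sum is
    -- needed to define it.
    { toFun := fun σ => pairHom
        (-(dgSign k n • (D.comp (σ true) X.x h + D.comp (σ false) f h)))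
        (-(dgSign k n • D.comp (σ false) Y.x h))
      map_zero' := by
        funext s
        cases s
        · change -(dgSign k n • D.comp 0 Y.x h) = 0
          rw [GradedCat.zero_comp, smul_zero, neg_zero]
        · change -(dgSign k n • (D.comp 0 X.x h + D.comp 0 f h)) = 0
          rw [GradedCat.zero_comp, GradedCat.zero_comp, add_zero, smul_zero, neg_zero]
      map_add' := fun σ τ => by
        funext s
        cases s
        · change -(dgSign k n • D.comp (σ false + τ false) Y.x h) =
            -(dgSign k n • D.comp (σ false) Y.x h) + -(dgSign k n • D.comp (τ false) Y.x h)
          rw [D.add_comp]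
          module
        · change -(dgSign k n • (D.comp (σ true + τ true) X.x h +
            D.comp (σ false + τ false) f h)) =
            -(dgSign k n • (D.comp (σ true) X.x h + D.comp (σ false) f h)) +
            -(dgSign k n • (D.comp (τ true) X.x h + D.comp (τ false) f h))
          rw [D.add_comp, D.add_comp]
          module }
  T_comp {Z Z' p q q' n n'} g σ h hq hn h' s := by
    subst h
    cases s
    · change -(dgSign k (p + q) • D.comp (D.comp g (σ false) rfl) Y.x hn) =
        dgSign k p • D.comp g (-(dgSign k q • D.comp (σ false) Y.x hq)) h'
      rw [GradedCat.comp_neg, D.comp_smul, dgSign_add, D.assoc g (σ false) Y.x rfl hq hn h']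
      module
    · change -(dgSign k (p + q) • (D.comp (D.comp g (σ true) rfl) X.x hn +
        D.comp (D.comp g (σ false) rfl) f hn)) =
        dgSign k p • D.comp g (-(dgSign k q • (D.comp (σ true) X.x hq +
          D.comp (σ false) f hq))) h'
      rw [GradedCat.comp_neg, D.comp_smul, D.comp_add, dgSign_add,
        D.assoc g (σ true) X.x rfl hq hn h', D.assoc g (σ false) f rfl hq hn h']
      module
  T_T {Z n m l} hn hm σ s := by
    subst hn
    cases s
    · change D.d _ l hm (-(dgSign k n • D.comp (σ false) Y.x rfl)) +
        -(dgSign k (n + 1) • D.comp (D.d n _ rfl (σ false)) Y.x hm) +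
        -(dgSign k (n + 1) • D.comp (-(dgSign k n • D.comp (σ false) Y.x rfl)) Y.x hm) = 0
      rw [map_neg, map_smul, D.d_comp (σ false) Y.x rfl hm rfl one_add_one_eq_two hm (by omega),
        GradedCat.neg_comp, D.smul_comp, D.assoc (σ false) Y.x Y.x rfl one_add_one_eq_two hm
          (by omega), eq_neg_of_add_eq_zero_left Y.mc, dgSign_succ, GradedCat.comp_neg]
      module
    -- Closedness of `f` is the off-diagonal entry of the Maurer-Cartan equation of that matrix.
    · have e : D.d 1 2 one_add_one_eq_two f = - D.comp Y.x f one_add_one_eq_two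
          - D.comp f X.x one_add_one_eq_two := by
        rw [mcD_apply, dgSign_one] at hf
        rw [← sub_eq_zero, ← hf]
        module
      change D.d _ l hm (-(dgSign k n • (D.comp (σ true) X.x rfl + D.comp (σ false) f rfl))) +
        -(dgSign k (n + 1) • (D.comp (D.d n _ rfl (σ true)) X.x hm +
          D.comp (D.d n _ rfl (σ false)) f hm)) +
        -(dgSign k (n + 1) • (D.comp (-(dgSign k n • (D.comp (σ true) X.x rfl +
          D.comp (σ false) f rfl))) X.x hm +
          D.comp (-(dgSign k n • D.comp (σ false) Y.x rfl)) f hm)) = 0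
      rw [map_neg, map_smul, map_add,
        D.d_comp (σ true) X.x rfl hm rfl one_add_one_eq_two hm (by omega),
        D.d_comp (σ false) f rfl hm rfl one_add_one_eq_two hm (by omega),
        GradedCat.neg_comp, GradedCat.neg_comp, D.smul_comp, D.smul_comp, D.add_comp,
        D.assoc (σ true) X.x X.x rfl one_add_one_eq_two hm (by omega),
        D.assoc (σ false) f X.x rfl one_add_one_eq_two hm (by omega),
        D.assoc (σ false) Y.x f rfl one_add_one_eq_two hm (by omega),
        eq_neg_of_add_eq_zero_left X.mc, e, dgSign_succ, GradedCat.comp_neg, GradedCat.comp_sub,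
        GradedCat.comp_neg]
      module
  T_mem {Z n m a} hn σ hσ s := by
    cases s
    · exact neg_mem (Submodule.smul_mem _ _ (F.comp_mem hn le_rfl (hσ false) (F.mem_self _)))
    · exact neg_mem (Submodule.smul_mem _ _ (add_mem
        (F.comp_mem hn le_rfl (hσ true) (F.mem_self _))
        (F.comp_mem hn le_rfl (hσ false) (F.mem_self _))))

variable {F} in
theorem coneTwist_δMC_true {X Y : D.MCObj} {f : D.Hom X.X Y.X 1}
    (hf : D.mcD X Y 1 2 one_add_one_eq_two f = 0) (Z : D.MCObj) {n m : ℤ} (h : n + 1 = m)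
    (σ : ∀ b, D.Hom (pairObj X.X Y.X b) Z.X n) :
    (F.coneTwist X Y f hf).δMC Z n m h σ true =
      D.mcD X Z n m h (σ true) - dgSign k n • D.comp (σ false) f h := by
  change D.d n m h (σ true) + -(dgSign k n • (D.comp (σ true) X.x h + D.comp (σ false) f h)) +
    D.comp Z.x (σ true) _ = _
  rw [mcD_apply]
  module

variable {F} in
theorem coneTwist_δMC_false {X Y : D.MCObj} {f : D.Hom X.X Y.X 1}
    (hf : D.mcD X Y 1 2 one_add_one_eq_two f = 0) (Z : D.MCObj) {n m : ℤ} (h : n + 1 = m)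
    (σ : ∀ b, D.Hom (pairObj X.X Y.X b) Z.X n) :
    (F.coneTwist X Y f hf).δMC Z n m h σ false = D.mcD Y Z n m h (σ false) := by
  change D.d n m h (σ false) + -(dgSign k n • D.comp (σ false) Y.x h) +
    D.comp Z.x (σ false) _ = _
  rw [mcD_apply]
  abel

end Filtration

/-- `C` is a homotopy cone of the closed degree `1` morphism `f : X ⟶ Y`. -/
structure IsHoCone (A : DGCat.{w, u, v} k) {X Y C : A.Obj} (f : A.Hom X Y 1) (j : A.Hom X C 0)
    (i : A.Hom Y C 0) : Prop where
  d_inr : A.d 0 1 (zero_add 1) i = 0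
  d_inl : A.d 0 1 (zero_add 1) j = A.comp i f (zero_add 1)
  lift : ∀ {Z : A.Obj} {e n m l : ℤ} (he : e + 1 = n) (hn : n + 1 = m) (hm : m + 1 = l)
    (r : A.Hom C Z m) (σ : A.Hom X Z n) (τ : A.Hom Y Z n), A.d m l hm r = 0 →
    A.d n m hn σ - dgSign k n • A.comp τ f hn = A.comp r j (add_zero m) →
    A.d n m hn τ = A.comp r i (add_zero m) →
    ∃ (g : A.Hom C Z n) (h : A.Hom X Z e) (h' : A.Hom Y Z e), A.d n m hn g = r ∧
      A.comp g j (add_zero n) - σ = A.d e n he h - dgSign k e • A.comp h' f he ∧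
      A.comp g i (add_zero n) - τ = A.d e n he h'

/-- The perturbation `coneTwist` is invisible on graded pieces, so a graded coproduct of `X` and `Y`
can be perturbed into a cone of `f`. Because `f` has degree `1`, no shift enters: the component on
`X` is the map whose differential is `i ∘ f`, and the component on `Y` is closed. -/
theorem Filtration.exists_isHoCone_mc (F : D.Filtration) (X Y : D.MCObj) {C : D.Obj}
    (f : D.Hom X.X Y.X 1) (hf : D.mcD X Y 1 2 one_add_one_eq_two f = 0)
    {ι₀ : ∀ b, D.Hom (pairObj X.X Y.X b) C 0} (hι₀ : ∀ b, D.d 0 1 (zero_add 1) (ι₀ b) = 0)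
    (H : F.IsGrCoprod (pairObj X.X Y.X) C ι₀) :
    ∃ (C' : D.mcDG.Obj) (j : D.mcDG.Hom X C' 0) (i : D.mcDG.Hom Y C' 0),
      IsHoCone D.mcDG (X := X) (Y := Y) f j i := by
  obtain ⟨c, ι, hc, hι, h⟩ := (F.coneTwist X Y f hf).exists_curv_eq_zero hι₀ H
  refine ⟨⟨C, c, hc⟩, ι true, ι false, ?_, ?_, fun {Z e n m l} he hn hm r σ τ hr hσ hτ => ?_⟩
  · exact (coneTwist_δMC_false (F := F) hf ⟨C, c, hc⟩ (zero_add 1) ι).symm.trans (hι false)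
  · have h1 := (coneTwist_δMC_true (F := F) hf ⟨C, c, hc⟩ (zero_add 1) ι).symm.trans (hι true)
    rw [dgSign_zero, one_smul] at h1
    exact (sub_eq_zero (G := D.Hom X.X C 1)).1 h1
  · obtain ⟨g, h, hg, hh⟩ := (F.coneTwist X Y f hf).exists_lift H hc hι h he hn hm r
      (pairHom σ τ) hr (fun s => by
        cases s
        · exact (coneTwist_δMC_false (F := F) hf Z hn (pairHom σ τ)).trans hτ
        · exact (coneTwist_δMC_true (F := F) hf Z hn (pairHom σ τ)).trans hσ)
    exact ⟨g, h true, h false, hg, (hh true).trans (coneTwist_δMC_true hf Z he h),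
      (hh false).trans (coneTwist_δMC_false hf Z he h)⟩

end DGCat

/-! ### Sequences of objects and the filtration by `j - i` -/

namespace DGCat

variable {k : Type w} [CommRing k] {A : DGCat.{w, u, v} k} (hA : A.IsNonpositive)

theorem seqDG_comp_apply {X Y Z : (seqDG hA).Obj} {p q n : ℤ} (g : (seqDG hA).Hom Y Z p)
    (f : (seqDG hA).Hom X Y q) (h : p + q = n) (i j : ℤ) : (seqDG hA).comp g f h i j =
      ∑ l ∈ Finset.Icc (i + q) (j - p), A.comp (g l j) (f i l) (by omega) := rfl

theorem seqDG_d_apply {X Y : (seqDG hA).Obj} {n m : ℤ} (h : n + 1 = m) (f : (seqDG hA).Hom X Y n)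
    (i j : ℤ) : (seqDG hA).d n m h f i j =
      dgSign k j • A.d (i - j + n) (i - j + m) (by omega) (f i j) := rfl

/-- The filtration of the complexes of morphisms of sequences by `j - i`. -/
def seqFiltration : (seqDG hA).Filtration where
  F X Y n a :=
    { carrier := {f | ∀ i j : ℤ, j - i < a → f i j = 0}
      add_mem' := fun {f g} hf hg i j h => by
        change f i j + g i j = 0
        rw [hf i j h, hg i j h, add_zero]
      zero_mem' := fun i j h => rfl
      smul_mem' := fun c f hf i j h => by
        change c • f i j = 0
        rw [hf i j h, smul_zero] }
  anti h f hf i j hij := hf i j (by omega)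
  -- For `j - i < n` the entry has positive degree `i - j + n`, hence vanishes.
  mem_self f i j hij := hA _ _ _ (by omega) _
  comp_mem {X Y Z p q n a b c g f} h hc hg hf i j hij := by
    rw [seqDG_comp_apply]
    refine Finset.sum_eq_zero fun l _ => ?_
    by_cases hl : l - i < b
    · rw [hf i l hl, GradedCat.comp_zero]
    · rw [hg l j (by omega), GradedCat.zero_comp]
  d_mem {X Y n m a f} h hf i j hij := by
    rw [seqDG_d_apply, hf i j hij, map_zero, smul_zero]
  complete {X Y n a} f hf := by
    -- The `(i, j)` entry of the sequence is constant from the first index `c ≥ 0` with `a + c > j -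
    -- i`; the limit takes this stable value.
    refine ⟨fun i j => f (j - i - a + 1).toNat i j, fun b i j hij => ?_⟩
    have h : ∀ c : ℕ, (j - i - a + 1).toNat ≤ c → f c i j = f (j - i - a + 1).toNat i j := by
      intro c hc
      induction c, hc using Nat.le_induction with
      | base => rfl
      | succ c hc ih =>
        rw [← ih]
        exact sub_eq_zero.1 (hf c i j (by omega))
    exact sub_eq_zero.2 (h b (by omega)).symm
  separated {X Y n a f} hf := by
    funext i j
    exact hf (j - i - a + 1).toNat i j (by omega)

/-- The morphism of sequences with given components `X^i ⟶ Y^i`. -/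
def seqDiag {X Y : (seqDG hA).Obj} (f : ∀ i, A.Hom (X i) (Y i) 0) : (seqDG hA).Hom X Y 0 :=
  fun i j => if h : i = j then
    A.comp (A.eqId (Y := Y j) (n := i - j + 0) (congrArg Y h) (by omega)) (f i) (by omega) else 0

variable {hA}

theorem comp_seqDiag_self {X Y : (seqDG hA).Obj} {Z : A.Obj} (f : ∀ i, A.Hom (X i) (Y i) 0)
    (i : ℤ) {n m : ℤ} (g : A.Hom (Y i) Z n) (h : n + (i - i + 0) = m) :
    A.comp g (seqDiag hA f i i) h = A.comp g (f i) (by omega) := by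
  rw [seqDiag, dif_pos rfl, ← A.assoc g _ (f i) (show n + (i - i + 0) = n by omega) (by omega)
    (by omega), A.comp_eqId]

theorem seqDiag_self_comp {X Y : (seqDG hA).Obj} {Z : A.Obj} (f : ∀ i, A.Hom (X i) (Y i) 0)
    (i : ℤ) {n m : ℤ} (g : A.Hom Z (X i) n) (h : (i - i + 0) + n = m) :
    A.comp (seqDiag hA f i i) g h = A.comp (f i) g (by omega) := by
  rw [seqDiag, dif_pos rfl, A.assoc _ (f i) g _ (show 0 + n = m by omega) _ (by omega),
    A.eqId_comp]

theorem comp_seqDiag {X Y Z : (seqDG hA).Obj} (f : ∀ i, A.Hom (X i) (Y i) 0) {n : ℤ}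
    (g : (seqDG hA).Hom Y Z n) (i j : ℤ) : (seqDG hA).comp g (seqDiag hA f) (add_zero n) i j =
      A.comp (g i j) (f i) (by omega) := by
  rw [seqDG_comp_apply]
  by_cases hij : i ≤ j - n
  · rw [Finset.sum_eq_single i]
    · exact comp_seqDiag_self f i _ _
    · intro l _ hl
      rw [seqDiag, dif_neg (Ne.symm hl), GradedCat.comp_zero]
    · intro hi
      exact absurd (Finset.mem_Icc.2 ⟨by omega, hij⟩) hi
  -- Outside the range of summation the right-hand side has positive degree, so it is zero as well.
  · rw [Finset.Icc_eq_empty (by omega), Finset.sum_empty]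
    exact (hA _ _ _ (by omega) _).symm

theorem seqDiag_comp {X Y Z : (seqDG hA).Obj} (f : ∀ i, A.Hom (X i) (Y i) 0) {n : ℤ}
    (g : (seqDG hA).Hom Z X n) (i j : ℤ) : (seqDG hA).comp (seqDiag hA f) g (zero_add n) i j =
      A.comp (f j) (g i j) (by omega) := by
  rw [seqDG_comp_apply]
  by_cases hij : i + n ≤ j
  · rw [Finset.sum_eq_single j]
    · exact seqDiag_self_comp f j _ _
    · intro l _ hl
      rw [seqDiag, dif_neg hl, GradedCat.zero_comp]
    · intro hi
      exact absurd (Finset.mem_Icc.2 ⟨hij, by omega⟩) hi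
  · rw [Finset.Icc_eq_empty (by omega), Finset.sum_empty]
    exact (hA _ _ _ (by omega) _).symm

theorem d_seqDiag {X Y : (seqDG hA).Obj} {f : ∀ i, A.Hom (X i) (Y i) 0}
    (hf : ∀ i, A.d 0 1 (zero_add 1) (f i) = 0) :
    (seqDG hA).d 0 1 (zero_add 1) (seqDiag hA f) = 0 := by
  funext i j
  rw [seqDG_d_apply]
  by_cases hij : i = j
  · rw [seqDiag, dif_pos hij, A.d_comp _ (f i) _ (show i - j + 0 + 1 = i - j + 1 by omega)
      (show i - j + 0 + 1 = i - j + 1 by omega) (zero_add 1) (by omega) (by omega), hf, A.d_eqId,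
      GradedCat.comp_zero, GradedCat.zero_comp, smul_zero, add_zero, smul_zero]
    rfl
  · rw [seqDiag, dif_neg hij, map_zero, smul_zero]
    rfl

theorem dgSign_smul_smul {M : Type*} [AddCommGroup M] [Module k M] (n : ℤ) (x : M) :
    dgSign k n • dgSign k n • x = x := by
  rw [smul_smul, dgSign_mul_self, one_smul]

theorem eq_zero_of_dgSign_smul {M : Type*} [AddCommGroup M] [Module k M] {n : ℤ} {x : M}
    (h : dgSign k n • x = 0) : x = 0 := by
  rw [← dgSign_smul_smul (k := k) n x, h, smul_zero]

/-- The `a`-th graded piece of the morphisms of sequences is the product of the complexes `A(X^i,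
Y^j)` over the diagonal `j - i = a`, and precomposition with a diagonal morphism acts on each factor
separately. The termwise lifts therefore assemble, with zero off the diagonal. -/
theorem isGrCoprod_seqDiag {I : Type t} {X : I → (seqDG hA).Obj} {C : (seqDG hA).Obj}
    {ι : ∀ s i, A.Hom (X s i) (C i) 0}
    (H : ∀ i, IsHoCoprod A (fun s => X s i) (C i) fun s => ι s i) :
    (seqFiltration hA).IsGrCoprod X C fun s => seqDiag hA (ι s) := by
  intro Y e n m l a he hn hm r σ hr hσ hdr hdσ
  have key : ∀ i j : ℤ, ∃ (g : A.Hom (C i) (Y j) (i - j + n))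
      (h : ∀ s, A.Hom (X s i) (Y j) (i - j + e)), (j - i ≠ a → g = 0 ∧ ∀ s, h s = 0) ∧
        (j - i = a → A.d _ (i - j + m) (by omega) g = dgSign k j • r i j ∧
          ∀ s, A.comp g (ι s i) (add_zero _) - σ s i j =
            dgSign k j • A.d _ (i - j + n) (by omega) (h s)) := by
    intro i j
    by_cases hij : j - i = a
    · have h1 := hdr i j (by omega)
      rw [seqDG_d_apply] at h1
      -- The entrywise differential carries the sign `(-1) ^ j`; multiplying `r` by it here, and `h`
      -- afterwards, turns the equations into those of `A`.
      obtain ⟨g, h, hg, hh⟩ := (H i).lift (Y := Y j) (show i - j + e + 1 = i - j + n by omega)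
        (show i - j + n + 1 = i - j + m by omega) (show i - j + m + 1 = i - j + l by omega)
        (dgSign k j • r i j) (fun s => σ s i j) (by
          rw [map_smul, eq_zero_of_dgSign_smul h1, smul_zero]) (fun s => by
          have h2 := sub_eq_zero.1 (hdσ s i j (by omega))
          rw [seqDG_d_apply, comp_seqDiag] at h2
          rw [A.smul_comp, ← h2, dgSign_smul_smul])
      refine ⟨g, fun s => dgSign k j • h s, fun h => absurd hij h, fun _ => ⟨hg, fun s => ?_⟩⟩
      rw [hh, map_smul, dgSign_smul_smul]
    · exact ⟨0, 0, fun _ => ⟨rfl, fun _ => rfl⟩, fun h => absurd h hij⟩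
  choose g h h1 h2 using key
  refine ⟨g, fun s i j => h i j s, fun i j hij => (h1 i j (by omega)).1,
    fun s i j hij => (h1 i j (by omega)).2 s, fun i j hij => ?_, fun s i j hij => ?_⟩
  · change dgSign k j • A.d (i - j + n) (i - j + m) _ (g i j) - r i j = 0
    by_cases hij' : j - i = a
    · rw [(h2 i j hij').1, dgSign_smul_smul, sub_self]
    · rw [(h1 i j hij').1, hr i j (by omega), map_zero, smul_zero, sub_zero]
  · have e1 := comp_seqDiag (hA := hA) (ι s) g i j
    change (seqDG hA).comp g (seqDiag hA (ι s)) (add_zero n) i j - σ s i j -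
      dgSign k j • A.d (i - j + e) (i - j + n) _ (h i j s) = 0
    rw [e1]
    by_cases hij' : j - i = a
    · rw [(h2 i j hij').2, sub_self]
    · rw [(h1 i j hij').1, (h1 i j hij').2, hσ s i j (by omega), map_zero, smul_zero, sub_zero,
        sub_zero, GradedCat.zero_comp]

/-- The dual diagonal argument: the entry `(i, j)` of a morphism into `C` is lifted with the product
property of the target term `C^j`. All structure maps have degree `0`, so the opposite introduces no
signs in their compositions. -/
theorem isGrCoprod_op_seqDiag {I : Type t} {X : I → (seqDG hA).Obj} {C : (seqDG hA).Obj}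
    {π : ∀ s i, A.Hom (C i) (X s i) 0}
    (H : ∀ i, IsHoCoprod A.op (fun s => X s i) (C i) fun s => π s i) :
    (seqFiltration hA).op.IsGrCoprod X C fun s => seqDiag hA (π s) := by
  intro Y e n m l a he hn hm r σ hr hσ hdr hdσ
  have hop : ∀ {X Y Z : A.Obj} {n : ℤ} (g : A.Hom Y Z 0) (f : A.Hom X Y n),
      A.op.comp (X := Z) (Y := Y) (Z := X) f g (add_zero n) = A.comp g f (zero_add n) := by
    intro X Y Z n g f
    rw [op_comp, mul_zero, dgSign_zero, one_smul]
  have hop' : ∀ {X Y Z : (seqDG hA).Obj} {n : ℤ} (g : (seqDG hA).Hom Y Z 0)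
      (f : (seqDG hA).Hom X Y n), (seqDG hA).op.comp (X := Z) (Y := Y) (Z := X) f g (add_zero n) =
        (seqDG hA).comp g f (zero_add n) := by
    intro X Y Z n g f
    rw [op_comp, mul_zero, dgSign_zero, one_smul]
  have key : ∀ i j : ℤ, ∃ (g : A.Hom (Y i) (C j) (i - j + n))
      (h : ∀ s, A.Hom (Y i) (X s j) (i - j + e)), (j - i ≠ a → g = 0 ∧ ∀ s, h s = 0) ∧
        (j - i = a → A.d _ (i - j + m) (by omega) g = dgSign k j • r i j ∧
          ∀ s, A.comp (π s j) g (zero_add _) - σ s i j =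
            dgSign k j • A.d _ (i - j + n) (by omega) (h s)) := by
    intro i j
    by_cases hij : j - i = a
    · have h1 := hdr i j (by omega)
      change dgSign k j • A.d (i - j + m) (i - j + l) _ (r i j) = 0 at h1
      obtain ⟨g, h, hg, hh⟩ := (H j).lift (Y := Y i) (show i - j + e + 1 = i - j + n by omega)
        (show i - j + n + 1 = i - j + m by omega) (show i - j + m + 1 = i - j + l by omega)
        (dgSign k j • r i j) (fun s => σ s i j) (by
          change A.d (i - j + m) (i - j + l) _ (dgSign k j • r i j) = 0
          rw [map_smul, eq_zero_of_dgSign_smul h1, smul_zero]) (fun s => by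
          have h2 := sub_eq_zero.1 (hdσ s i j (by omega))
          have e1 := seqDiag_comp (hA := hA) (π s) r i j
          have e2 := congrFun (congrFun (hop' (seqDiag hA (π s)) r) i) j
          replace h2 := (h2.trans e2).trans e1
          change dgSign k j • A.d (i - j + n) (i - j + m) _ (σ s i j) = _ at h2
          rw [hop]
          change A.d (i - j + n) (i - j + m) _ (σ s i j) = A.comp (π s j) (dgSign k j • r i j) _
          rw [A.comp_smul, ← h2, dgSign_smul_smul])
      refine ⟨g, fun s => dgSign k j • (show A.Hom (Y i) (X s j) (i - j + e) from h s),
        fun h => absurd hij h, fun _ => ⟨hg, fun s => ?_⟩⟩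
      rw [map_smul, dgSign_smul_smul]
      exact (congrArg (· - σ s i j) (hop (π s j) g).symm).trans (hh s)
    · exact ⟨0, 0, fun _ => ⟨rfl, fun _ => rfl⟩, fun h => absurd h hij⟩
  choose g h h1 h2 using key
  refine ⟨g, fun s i j => h i j s, fun i j hij => (h1 i j (by omega)).1,
    fun s i j hij => (h1 i j (by omega)).2 s, fun i j hij => ?_, fun s i j hij => ?_⟩
  · change dgSign k j • A.d (i - j + n) (i - j + m) _ (g i j) - r i j = 0
    by_cases hij' : j - i = a
    · rw [(h2 i j hij').1, dgSign_smul_smul, sub_self]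
    · rw [(h1 i j hij').1, hr i j (by omega), map_zero, smul_zero, sub_zero]
  · have e1 := seqDiag_comp (hA := hA) (π s) g i j
    have e2 := congrFun (congrFun (hop' (seqDiag hA (π s)) g) i) j
    change (seqDG hA).op.comp (X := X s) (Y := C) (Z := Y) g (seqDiag hA (π s)) (add_zero n) i j -
      σ s i j - dgSign k j • A.d (i - j + e) (i - j + n) _ (h i j s) = 0
    rw [e2, e1]
    by_cases hij' : j - i = a
    · rw [(h2 i j hij').2, sub_self]
    · rw [(h1 i j hij').1, (h1 i j hij').2, hσ s i j (by omega), map_zero, smul_zero, sub_zero,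
        sub_zero, GradedCat.comp_zero]

end DGCat

/-! ### Truncation and the formal zero object -/

namespace DGCat

variable {k : Type w} [CommRing k] {A : DGCat.{w, u, v} k}

/-- The lifting problem has zero data in positive degrees, and in nonpositive degrees a lift in `A`
already lies in the truncation. Degree `0` is the only delicate case. -/
theorem IsHoCoprod.trunc {I : Type t} {X : I → A.Obj} {C : A.Obj} {ι : ∀ s, A.Hom (X s) C 0}
    (H : IsHoCoprod A X C ι) : ∃ ι' : ∀ s, A.trunc.Hom (X s) C 0, IsHoCoprod A.trunc X C ι' := by
  refine ⟨fun s => ⟨ι s, fun _ => H.closed s, fun h => absurd h (lt_irrefl _)⟩,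
    fun s => Subtype.ext (H.closed s), fun {Y e n m l} he hn hm r σ hr hσ => ?_⟩
  change A.Obj at Y
  by_cases h0 : 0 < n
  · refine ⟨(0 : A.truncHom C Y n), fun s => (0 : A.truncHom (X s) Y e), ?_, fun s => ?_⟩
    · exact Subtype.ext ((map_zero (A.d n m hn)).trans (r.2.2 (by omega)).symm)
    · refine Subtype.ext ?_
      change A.comp (0 : A.Hom C Y n) (ι s) (add_zero n) - (σ s).1 = A.d e n he 0
      rw [(σ s).2.2 h0, GradedCat.zero_comp, map_zero, sub_zero]
  · obtain ⟨g, h, hg, hh⟩ := H.lift he hn hm r.1 (fun s => (σ s).1) (congrArg Subtype.val hr)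
      (fun s => congrArg Subtype.val (hσ s))
    refine ⟨⟨g, fun hn0 => mem_cocycles hn ?_, fun h => absurd h h0⟩,
      fun s => ⟨h s, fun h => by omega, fun h => by omega⟩, Subtype.ext hg,
      fun s => Subtype.ext (hh s)⟩
    -- For `n = 0` the element `r` has degree `1`, so it is zero in the truncation and `g` is
    -- closed, as membership in degree `0` requires.
    rw [hg]
    exact r.2.2 (by omega)

section AddZero

/-- The underlying morphism of a morphism in `A.addZero` whose source is not the zero object. -/
def getSource {Y : A.Obj} {n : ℤ} : ∀ (W : Option A.Obj) (h : W.isSome),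
    A.addZeroHom W (some Y) n → A.Hom (W.get h) Y n
  | some _, _, f => f

/-- The morphism in `A.addZero` with a given underlying morphism if its source is not zero. -/
def putSource {Y : A.Obj} {n : ℤ} : ∀ (W : Option A.Obj),
    (∀ h : W.isSome, A.Hom (W.get h) Y n) → A.addZeroHom W (some Y) n
  | some _, f => f rfl
  | none, _ => 0

theorem getSource_putSource {Y : A.Obj} {n : ℤ} (W : Option A.Obj)
    (f : ∀ h : W.isSome, A.Hom (W.get h) Y n) (h : W.isSome) :
    getSource W h (putSource W f) = f h := by
  cases W
  · cases h
  · rfl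

theorem getSource_ext {Y : A.Obj} {n : ℤ} {W : Option A.Obj} {f g : A.addZeroHom W (some Y) n}
    (H : ∀ h, getSource W h f = getSource W h g) : f = g := by
  cases W
  · exact A.addZeroHom_none_left _ _
  · exact H rfl

theorem getSource_sub {Y : A.Obj} {n : ℤ} (W : Option A.Obj) (f g : A.addZeroHom W (some Y) n)
    (h : W.isSome) : getSource W h (f - g) = getSource W h f - getSource W h g := by
  cases W
  · cases h
  · rfl

theorem getSource_zero {Y : A.Obj} {n : ℤ} (W : Option A.Obj) (h : W.isSome) :
    getSource W h (0 : A.addZeroHom W (some Y) n) = 0 := by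
  cases W
  · cases h
  · rfl

theorem getSource_d {Y : A.Obj} {n m : ℤ} (W : Option A.Obj) (f : A.addZeroHom W (some Y) n)
    (h : W.isSome) (hn : n + 1 = m) : getSource W h (A.addZero.d (X := W) (Y := some Y) n m hn f) =
      A.d n m hn (getSource W h f) := by
  cases W
  · cases h
  · rfl

theorem getSource_comp {Y Z : A.Obj} {p q n : ℤ} (W : Option A.Obj) (g : A.Hom Y Z p)
    (f : A.addZeroHom W (some Y) q) (h : W.isSome) (hn : p + q = n) :
    getSource W h (A.addZero.comp (X := W) (Y := some Y) (Z := some Z) g f hn) =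
      A.comp g (getSource W h f) hn := by
  cases W
  · cases h
  · rfl

/-- The underlying morphism of a morphism in `A.addZero` whose target is not the zero object. -/
def getTarget {Y : A.Obj} {n : ℤ} : ∀ (W : Option A.Obj) (h : W.isSome),
    A.addZeroHom (some Y) W n → A.Hom Y (W.get h) n
  | some _, _, f => f

/-- The morphism in `A.addZero` with a given underlying morphism if its target is not zero. -/
def putTarget {Y : A.Obj} {n : ℤ} : ∀ (W : Option A.Obj),
    (∀ h : W.isSome, A.Hom Y (W.get h) n) → A.addZeroHom (some Y) W n
  | some _, f => f rfl
  | none, _ => 0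

theorem getTarget_putTarget {Y : A.Obj} {n : ℤ} (W : Option A.Obj)
    (f : ∀ h : W.isSome, A.Hom Y (W.get h) n) (h : W.isSome) :
    getTarget W h (putTarget W f) = f h := by
  cases W
  · cases h
  · rfl

theorem getTarget_ext {Y : A.Obj} {n : ℤ} {W : Option A.Obj} {f g : A.addZeroHom (some Y) W n}
    (H : ∀ h, getTarget W h f = getTarget W h g) : f = g := by
  cases W
  · exact A.addZeroHom_none_right _ _
  · exact H rfl

theorem getTarget_sub {Y : A.Obj} {n : ℤ} (W : Option A.Obj) (f g : A.addZeroHom (some Y) W n)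
    (h : W.isSome) : getTarget W h (f - g) = getTarget W h f - getTarget W h g := by
  cases W
  · cases h
  · rfl

theorem getTarget_zero {Y : A.Obj} {n : ℤ} (W : Option A.Obj) (h : W.isSome) :
    getTarget W h (0 : A.addZeroHom (some Y) W n) = 0 := by
  cases W
  · cases h
  · rfl

theorem getTarget_d {Y : A.Obj} {n m : ℤ} (W : Option A.Obj) (f : A.addZeroHom (some Y) W n)
    (h : W.isSome) (hn : n + 1 = m) : getTarget W h (A.addZero.d (X := some Y) (Y := W) n m hn f) =
      A.d n m hn (getTarget W h f) := by
  cases W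
  · cases h
  · rfl

theorem getTarget_comp {Y Z : A.Obj} {p q n : ℤ} (W : Option A.Obj)
    (g : A.addZeroHom (some Y) W p) (f : A.Hom Z Y q) (h : W.isSome) (hn : p + q = n) :
    getTarget W h (A.addZero.comp (X := some Z) (Y := some Y) (Z := W) g f hn) =
      A.comp (getTarget W h g) f hn := by
  cases W
  · cases h
  · rfl

/-- Zero objects contribute only zero complexes to the product, so a homotopy coproduct of the
nonzero members of the family serves for the whole family. Testing against the zero object is
trivial. -/
theorem exists_isHoCoprod_addZero {I : Type t} (X : I → Option A.Obj)
    (H : ∃ C ι, IsHoCoprod A (fun s : {s // (X s).isSome} => (X s.1).get s.2) C ι) :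
    ∃ C ι, IsHoCoprod A.addZero X C ι := by
  obtain ⟨C, ι, H⟩ := H
  have hι : ∀ s h, getSource (X s) h (putSource (X s) fun h => ι ⟨s, h⟩) = ι ⟨s, h⟩ := fun s h =>
    getSource_putSource (X s) (fun h => ι ⟨s, h⟩) h
  refine ⟨some C, fun s => putSource (X s) fun h => ι ⟨s, h⟩, fun s => ?_,
    fun {Y e n m l} he hn hm r σ hr hσ => ?_⟩
  · refine getSource_ext fun h => ?_
    refine (getSource_d (X s) _ h (zero_add 1)).trans ?_
    rw [hι]
    exact (H.closed ⟨s, h⟩).trans (getSource_zero (X s) h).symm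
  · cases Y with
    | none => exact ⟨(0 : A.addZeroHom (some C) none n),
        fun s => (0 : A.addZeroHom (X s) none e), A.addZeroHom_none_right (X := some C) (n := m) _ _,
        fun s => A.addZeroHom_none_right (X := X s) (n := n) _ _⟩
    | some Y =>
      obtain ⟨g, h, hg, hh⟩ := H.lift he hn hm r (fun s => getSource (X s.1) s.2 (σ s.1)) hr
        (fun s => by
          have := congrArg (getSource (X s.1) s.2) (hσ s.1)
          refine (getSource_d (X s.1) _ s.2 hn).symm.trans (this.trans ?_)
          refine (getSource_comp (X s.1) r _ s.2 (add_zero m)).trans ?_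
          rw [hι])
      refine ⟨g, fun s => putSource (X s) fun hs => h ⟨s, hs⟩, hg, fun s =>
        getSource_ext fun hs => ?_⟩
      refine Eq.trans ?_ (getSource_d (X s) _ hs he).symm
      refine Eq.trans ?_ (congrArg (A.d e n he)
        (getSource_putSource (X s) (fun hs => h ⟨s, hs⟩) hs)).symm
      refine (getSource_sub (X s) _ _ hs).trans (Eq.trans ?_ (hh ⟨s, hs⟩))
      refine congrArg (· - getSource (X s) hs (σ s)) ?_
      refine (getSource_comp (X s) g _ hs (add_zero n)).trans ?_
      rw [hι]

theorem op_comp_zero_right (A : DGCat.{w, u, v} k) {X Y Z : A.Obj} {n : ℤ} (g : A.Hom Y Z 0)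
    (f : A.Hom X Y n) : A.op.comp (X := Z) (Y := Y) (Z := X) f g (add_zero n) =
      A.comp g f (zero_add n) := by
  rw [op_comp, mul_zero, dgSign_zero, one_smul]

theorem exists_isHoCoprod_addZero_op {I : Type t} (X : I → Option A.Obj)
    (H : ∃ C π, IsHoCoprod A.op (fun s : {s // (X s).isSome} => (X s.1).get s.2) C π) :
    ∃ C π, IsHoCoprod A.addZero.op X C π := by
  obtain ⟨C, π, H⟩ := H
  change A.Obj at C
  have hπ : ∀ s h, getTarget (X s) h (putTarget (Y := C) (X s) fun h => π ⟨s, h⟩) = π ⟨s, h⟩ :=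
    fun s h => getTarget_putTarget (Y := C) (X s) (fun h => π ⟨s, h⟩) h
  refine ⟨some C, fun s => putTarget (X s) fun h => π ⟨s, h⟩, fun s => ?_,
    fun {Y e n m l} he hn hm r σ hr hσ => ?_⟩
  · refine getTarget_ext fun h => ?_
    refine (getTarget_d (X s) _ h (zero_add 1)).trans ?_
    rw [hπ]
    exact (H.closed ⟨s, h⟩).trans (getTarget_zero (X s) h).symm
  · cases Y with
    | none => exact ⟨(0 : A.addZeroHom none (some C) n),
        fun s => (0 : A.addZeroHom none (X s) e), A.addZeroHom_none_left (Y := some C) (n := m) _ _,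
        fun s => A.addZeroHom_none_left (Y := X s) (n := n) _ _⟩
    | some Y =>
      obtain ⟨g, h, hg, hh⟩ := H.lift (Y := Y) he hn hm r
        (fun s => getTarget (X s.1) s.2 (σ s.1)) hr (fun s => by
          have := congrArg (getTarget (X s.1) s.2) ((hσ s.1).trans
            (op_comp_zero_right A.addZero (X := some Y) (Y := some C) (Z := X s.1) _ r))
          refine (getTarget_d (X s.1) _ s.2 hn).symm.trans (this.trans ?_)
          refine (getTarget_comp (X s.1) _ r s.2 (zero_add m)).trans ?_
          rw [hπ]
          exact (op_comp_zero_right A _ _).symm)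
      refine ⟨g, fun s => putTarget (X s) fun hs => h ⟨s, hs⟩, hg, fun s =>
        getTarget_ext fun hs => ?_⟩
      refine Eq.trans ?_ (getTarget_d (X s) _ hs he).symm
      refine Eq.trans ?_ (congrArg (A.d e n he)
        (getTarget_putTarget (Y := Y) (X s) (fun hs => h ⟨s, hs⟩) hs)).symm
      refine (getTarget_sub (X s) _ _ hs).trans (Eq.trans ?_ (hh ⟨s, hs⟩))
      refine congrArg (· - getTarget (X s) hs (σ s)) ?_
      refine (congrArg (getTarget (X s) hs) (op_comp_zero_right A.addZero (X := some Y)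
        (Y := some C) (Z := X s) _ g)).trans ?_
      refine (getTarget_comp (X s) _ g hs (zero_add n)).trans ?_
      rw [hπ]
      exact (op_comp_zero_right A _ _).symm

end AddZero

theorem exists_isHoCoprod_trunc_addZero {κ : Cardinal.{t}} (H : A.cohomology.HasCoproductsLE κ)
    {I : Type t} (hI : Cardinal.mk I ≤ κ) (X : I → A.addZero.trunc.Obj) :
    ∃ C ι, IsHoCoprod A.addZero.trunc X C ι := by
  obtain ⟨C, ι, h⟩ := exists_isHoCoprod_addZero X
    -- Discarding the zero objects only makes the index set smaller.
    (exists_isHoCoprod H ((Cardinal.mk_subtype_le _).trans hI) _)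
  exact ⟨C, h.trunc⟩

theorem exists_isHoCoprod_trunc_addZero_op {κ : Cardinal.{t}} (H : A.cohomology.HasProductsLE κ)
    {I : Type t} (hI : Cardinal.mk I ≤ κ) (X : I → A.addZero.trunc.Obj) :
    ∃ C ι, IsHoCoprod A.addZero.trunc.op X C ι := by
  obtain ⟨C, ι, h⟩ := exists_isHoCoprod_addZero_op X
    (exists_isHoCoprod ((hasProductsLE_iff_op A κ).1 H) ((Cardinal.mk_subtype_le _).trans hI) _)
  exact ⟨C, h.trunc⟩

/-- Homotopy coproducts are taken term by term in the truncation of `A_{0}`; their diagonal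
inclusions are closed and give a graded coproduct, which is then perturbed. -/
theorem tw_hasCoproductsLE {κ : Cardinal.{t}} (H : A.cohomology.HasCoproductsLE κ) :
    A.Tw.cohomology.HasCoproductsLE κ := by
  refine hasCoproductsLE_of_isHoCoprod fun I hI X => ?_
  change I → MCObj _ at X
  choose C ι h using fun i : ℤ => exists_isHoCoprod_trunc_addZero H hI fun s => (X s).X i
  exact (seqFiltration A.addZero.trunc_isNonpositive).exists_isHoCoprod_mc X
    (fun s => d_seqDiag fun i => (h i).closed s)
    (isGrCoprod_seqDiag (X := fun s => (X s).X) (C := C) (ι := fun s i => ι i s) h)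

theorem tw_hasProductsLE {κ : Cardinal.{t}} (H : A.cohomology.HasProductsLE κ) :
    A.Tw.cohomology.HasProductsLE κ := by
  refine (hasProductsLE_iff_op _ _).2 (hasCoproductsLE_of_isHoCoprod fun I hI X => ?_)
  change I → MCObj _ at X
  choose C π h using fun i : ℤ => exists_isHoCoprod_trunc_addZero_op H hI fun s => (X s).X i
  exact (seqFiltration A.addZero.trunc_isNonpositive).exists_isHoCoprod_op_mc X
    (fun s => d_seqDiag fun i => (h i).closed s)
    (isGrCoprod_op_seqDiag (X := fun s => (X s).X) (C := C) (π := fun s i => π i s) h)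

end DGCat

/-! ### Isomorphisms in cohomology and homotopy equivalences -/

theorem dgSign_neg (k : Type w) [CommRing k] (n : ℤ) : dgSign k (-n) = dgSign k n := by
  simp [dgSign, Int.negOnePow_neg]

theorem dgSign_neg_one (k : Type w) [CommRing k] : dgSign k (-1) = -1 := by simp [dgSign]

namespace GradedCat

variable {k : Type w} [CommRing k] (G : GradedCat.{w, u, v} k)

/-- `X` and `Y` are related by an isomorphism of degree `s`. -/
def IsoDeg (s : ℤ) (X Y : G.Obj) : Prop :=
  ∃ (f : G.Hom X Y s) (g : G.Hom Y X (-s)), G.comp f g (by omega) = G.id Y ∧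
    G.comp g f (by omega) = G.id X

variable {G}

theorem IsoDeg.symm {s t : ℤ} {X Y : G.Obj} (h : G.IsoDeg s X Y) (e : s + t = 0) :
    G.IsoDeg t Y X := by
  obtain rfl : t = -s := by omega
  obtain ⟨f, g, hfg, hgf⟩ := h
  -- The inverse must live in degree `-(-s)`, equal to `s` only propositionally, so the morphism is
  -- moved along this equality.
  have : ∀ (r : ℤ) (hr : r = s), ∃ f' : G.Hom X Y r, G.comp f' g (by omega) = G.id Y ∧
      G.comp g f' (by omega) = G.id X := by
    rintro r rfl
    exact ⟨f, hfg, hgf⟩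
  obtain ⟨f', h1, h2⟩ := this (-(-s)) (by omega)
  exact ⟨g, f', h2, h1⟩

theorem IsoDeg.trans {s t r : ℤ} {X Y Z : G.Obj} (h : G.IsoDeg s X Y) (h' : G.IsoDeg t Y Z)
    (e : t + s = r) : G.IsoDeg r X Z := by
  obtain ⟨f, g, hfg, hgf⟩ := h
  obtain ⟨f', g', hfg', hgf'⟩ := h'
  refine ⟨G.comp f' f e, G.comp g g' (by omega), ?_, ?_⟩
  · rw [G.assoc f' f (G.comp g g' _) e (show s + -r = -t by omega) (by omega) (by omega),
      ← G.assoc f g g' (show s + -s = 0 by omega) _ (by omega), hfg, G.id_comp, hfg']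
  · rw [G.assoc g g' (G.comp f' f _) _ (show -t + r = s by omega) (by omega) (by omega),
      ← G.assoc g' f' f (show -t + t = 0 by omega) _ (by omega), hgf', G.id_comp, hgf]

theorem IsoDeg.refl (X : G.Obj) : G.IsoDeg 0 X X :=
  ⟨G.id X, G.id X, G.id_comp _, G.id_comp _⟩

end GradedCat

namespace DGCat

variable {k : Type w} [CommRing k] {T : DGCat.{w, u, v} k}

theorem isoDeg_of_closed {X Y : T.Obj} {s t : ℤ} (e : s + t = 0) (f : T.Hom X Y s)
    (g : T.Hom Y X t) (hf : T.d s (s + 1) rfl f = 0) (hg : T.d t (t + 1) rfl g = 0)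
    (hfg : T.comp f g e = T.id Y) (hgf : T.comp g f (by omega) = T.id X) :
    T.cohomology.IsoDeg s X Y := by
  obtain rfl : t = -s := by omega
  exact ⟨T.mkH ⟨f, hf⟩, T.mkH ⟨g, hg⟩, congrArg T.mkH (Subtype.ext hfg),
    congrArg T.mkH (Subtype.ext hgf)⟩

theorem isoDeg_zero_of_homotopy {X Y : T.Obj} (f : T.Hom X Y 0) (g : T.Hom Y X 0)
    (hf : T.d 0 1 (zero_add 1) f = 0) (hg : T.d 0 1 (zero_add 1) g = 0)
    (a : T.Hom Y Y (-1)) (b : T.Hom X X (-1))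
    (ha : T.d (-1) 0 (neg_add_cancel 1) a = T.comp f g (add_zero 0) - T.id Y)
    (hb : T.d (-1) 0 (neg_add_cancel 1) b = T.comp g f (add_zero 0) - T.id X) :
    T.cohomology.IsoDeg 0 X Y :=
  ⟨T.mkH ⟨f, hf⟩, T.mkH ⟨g, hg⟩,
    (mkH_eq_iff (neg_add_cancel 1) ⟨_, comp_mem ⟨f, hf⟩ ⟨g, hg⟩ (add_zero 0)⟩
      ⟨T.id Y, T.d_id Y⟩).2 ⟨a, ha⟩,
    (mkH_eq_iff (neg_add_cancel 1) ⟨_, comp_mem ⟨g, hg⟩ ⟨f, hf⟩ (add_zero 0)⟩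
      ⟨T.id X, T.d_id X⟩).2 ⟨b, hb⟩⟩

theorem exists_homotopy_of_isoDeg_zero {X Y : T.Obj} (h : T.cohomology.IsoDeg 0 X Y) :
    ∃ (f : T.Hom X Y 0) (g : T.Hom Y X 0) (a : T.Hom Y Y (-1)) (b : T.Hom X X (-1)),
      T.d 0 1 (zero_add 1) f = 0 ∧ T.d 0 1 (zero_add 1) g = 0 ∧
      T.d (-1) 0 (neg_add_cancel 1) a = T.comp f g (add_zero 0) - T.id Y ∧
      T.d (-1) 0 (neg_add_cancel 1) b = T.comp g f (add_zero 0) - T.id X := by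
  obtain ⟨f, g, hfg, hgf⟩ := h
  obtain ⟨f, rfl⟩ := mkH_surjective (A := T) (X := X) (Y := Y) f
  obtain ⟨g, rfl⟩ := mkH_surjective (A := T) (X := Y) (Y := X) (n := 0) g
  obtain ⟨a, ha⟩ := (mkH_eq_iff (neg_add_cancel 1) ⟨_, comp_mem f g (add_zero 0)⟩
      ⟨T.id Y, T.d_id Y⟩).1 hfg
  obtain ⟨b, hb⟩ := (mkH_eq_iff (neg_add_cancel 1) ⟨_, comp_mem g f (add_zero 0)⟩
      ⟨T.id X, T.d_id X⟩).1 hgf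
  exact ⟨f.1, g.1, a, b, f.2, g.2, ha, hb⟩

/-- The cone of the map `T(C, Q) ⟶ T(K, Q)` induced by `e : K ⟶ C` is acyclic. -/
def LiftsAt (T : DGCat.{w, u, v} k) {K C : T.Obj} (e : T.Hom K C 0) (Q : T.Obj) : Prop :=
  ∀ {c n m l : ℤ} (hc : c + 1 = n) (hn : n + 1 = m) (hm : m + 1 = l) (r : T.Hom C Q m)
    (s : T.Hom K Q n), T.d m l hm r = 0 → T.d n m hn s = T.comp r e (add_zero m) →
    ∃ (g : T.Hom C Q n) (h : T.Hom K Q c), T.d n m hn g = r ∧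
      T.comp g e (add_zero n) - s = T.d c n hc h

/-- Precomposition with a homotopy equivalence is a homotopy equivalence of complexes, and the cone
of such a map is contractible. The proof writes the contraction out, using both homotopies. -/
theorem liftsAt_of_homotopy {K C : T.Obj} {e : T.Hom K C 0} {e' : T.Hom C K 0}
    (he : T.d 0 1 (zero_add 1) e = 0) (he' : T.d 0 1 (zero_add 1) e' = 0)
    (a : T.Hom C C (-1)) (b : T.Hom K K (-1))
    (ha : T.d (-1) 0 (neg_add_cancel 1) a = T.comp e e' (add_zero 0) - T.id C)
    (hb : T.d (-1) 0 (neg_add_cancel 1) b = T.comp e' e (add_zero 0) - T.id K) (Q : T.Obj) :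
    T.LiftsAt e Q := by
  intro c n m l hc hn hm r s hr hs
  have hs' : dgSign k m = - dgSign k n := by rw [← hn, dgSign_succ]
  have h1 : T.d n m hn (T.comp s e' (add_zero n)) = r + T.comp r (T.d (-1) 0 (neg_add_cancel 1) a)
      (add_zero m) := by
    rw [T.d_comp s e' (add_zero n) hn hn (zero_add 1) (add_zero m) hn, he', GradedCat.comp_zero,
      smul_zero, add_zero, hs, T.assoc r e e' (add_zero m) (add_zero 0) (add_zero m) (add_zero m),
      ha, GradedCat.comp_sub, T.comp_id]
    abel
  have h2 : T.d n m hn (T.comp r a (by omega)) = dgSign k m • T.comp r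
      (T.d (-1) 0 (neg_add_cancel 1) a) (add_zero m) := by
    rw [T.d_comp r a (show m + -1 = n by omega) hn hm (neg_add_cancel 1) (by omega) (add_zero m),
      hr, GradedCat.zero_comp, zero_add]
  -- `s ∘ e'` is a primitive of `r` up to `r ∘ d a`; since `r` is closed, that error is the
  -- differential of a signed `r ∘ a`.
  set g₁ := T.comp s e' (add_zero n) - dgSign k m • T.comp r a (show m + -1 = n by omega) with hg₁
  have h3 : T.d n m hn g₁ = r := by
    rw [hg₁, map_sub, map_smul, h1, h2, dgSign_smul_smul, add_sub_cancel_right]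
  set z := T.comp g₁ e (add_zero n) - s with hz
  have h4 : T.d n m hn z = 0 := by
    rw [hz, map_sub, hs, T.d_comp g₁ e (add_zero n) hn hn (zero_add 1) (add_zero m) hn, h3, he,
      GradedCat.comp_zero, smul_zero, add_zero, sub_self]
  have h5 : T.d c n hc (T.comp z b (by omega)) = dgSign k n •
      (T.comp (T.comp z e' (add_zero n)) e (add_zero n) - z) := by
    rw [T.d_comp z b (show n + -1 = c by omega) hc hn (neg_add_cancel 1) (by omega) (add_zero n),
      h4, GradedCat.zero_comp, zero_add, hb, GradedCat.comp_sub, T.comp_id,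
      T.assoc z e' e (add_zero n) (add_zero 0) (add_zero n) (add_zero n)]
  -- The remaining error `z` is closed, and subtracting `z ∘ e'` replaces it by `z - z ∘ e' ∘ e`,
  -- which `b` makes exact.
  refine ⟨g₁ - T.comp z e' (add_zero n), -(dgSign k n • T.comp z b (by omega)), ?_, ?_⟩
  · rw [map_sub, h3, T.d_comp z e' (add_zero n) hn hn (zero_add 1) (add_zero m) hn, h4, he',
      GradedCat.comp_zero, GradedCat.zero_comp, smul_zero, add_zero, sub_zero]
  · rw [map_neg, map_smul, h5, dgSign_smul_smul, GradedCat.sub_comp]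
    rw [hz]
    abel

/-- Acyclic cones pass to homotopy retracts: only the homotopy from `v ∘ u` to the identity of `Q'`
is needed. -/
theorem LiftsAt.of_homotopy {K C : T.Obj} {e : T.Hom K C 0} {Q Q' : T.Obj} (H : T.LiftsAt e Q)
    {u : T.Hom Q' Q 0} {v : T.Hom Q Q' 0}
    (hu : T.d 0 1 (zero_add 1) u = 0) (hv : T.d 0 1 (zero_add 1) v = 0)
    (b : T.Hom Q' Q' (-1))
    (hb : T.d (-1) 0 (neg_add_cancel 1) b = T.comp v u (add_zero 0) - T.id Q') :
    T.LiftsAt e Q' := by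
  have hd : ∀ {X Y Z : T.Obj} {n m : ℤ} (hn : n + 1 = m) {u : T.Hom Y Z 0} (f : T.Hom X Y n),
      T.d 0 1 (zero_add 1) u = 0 →
      T.d n m hn (T.comp u f (zero_add n)) = T.comp u (T.d n m hn f) (zero_add m) := by
    intro X Y Z n m hn u f hu
    rw [T.d_comp u f (zero_add n) hn (zero_add 1) hn (by omega) (zero_add m), hu, dgSign_zero,
      one_smul, GradedCat.zero_comp, zero_add]
  have hbd : ∀ {X : T.Obj} {c n m : ℤ} (hc : c + 1 = n) (hn : n + 1 = m) (f : T.Hom X Q' n),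
      T.d c n hc (T.comp b f (by omega)) = T.comp v (T.comp u f (zero_add n)) (zero_add n) - f
        - T.comp b (T.d n m hn f) (by omega) := by
    intro X c n m hc hn f
    rw [T.d_comp b f (show -1 + n = c by omega) hc (neg_add_cancel 1) hn (zero_add n) (by omega), hb,
      GradedCat.sub_comp, T.id_comp, T.assoc v u f (add_zero 0) (zero_add n) (zero_add n)
        (zero_add n), dgSign_neg_one]
    module
  intro c n m l hc hn hm r s hr hs
  obtain ⟨g, h, hg, hh⟩ := H hc hn hm (T.comp u r (zero_add m)) (T.comp u s (zero_add n))
    (by rw [hd hm r hu, hr, GradedCat.comp_zero])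
    (by rw [hd hn s hu, hs, T.assoc u r e (zero_add m) (add_zero m) (add_zero m) (zero_add m)])
  refine ⟨T.comp v g (zero_add n) - T.comp b r (by omega),
    T.comp v h (zero_add c) + T.comp b s (by omega), ?_, ?_⟩
  · rw [map_sub, hd hn g hv, hg, hbd hn hm r, hr, GradedCat.comp_zero]
    abel
  · rw [map_add, hd hc h hv, ← hh, hbd hc hn s, hs, GradedCat.sub_comp, GradedCat.comp_sub,
      T.assoc v g e (zero_add n) (add_zero n) (add_zero n) (zero_add n),
      T.assoc b r e _ (add_zero m) (add_zero n) (by omega)]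
    abel

/-- A Yoneda argument that tests only on the two objects involved. Lifting `id K` gives a homotopy
left inverse `g`; then `e ∘ g - id C` becomes exact after precomposition with `e`, hence is exact by
lifting at `C`. -/
theorem isoDeg_zero_of_liftsAt {K C : T.Obj} {e : T.Hom K C 0} (he : T.d 0 1 (zero_add 1) e = 0)
    (hC : T.LiftsAt e C) (hK : T.LiftsAt e K) : T.cohomology.IsoDeg 0 K C := by
  obtain ⟨g, h, hg, hh⟩ := hK (neg_add_cancel 1) (zero_add 1) one_add_one_eq_two (0 : T.Hom C K 1)
    (T.id K) (map_zero _) (by rw [T.d_id, GradedCat.zero_comp])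
  obtain ⟨a, -, ha, -⟩ := hC (show (-2 : ℤ) + 1 = -1 by norm_num) (neg_add_cancel 1) (zero_add 1)
    (T.comp e g (add_zero 0) - T.id C) (T.comp e h (zero_add (-1))) (by
      rw [map_sub, T.d_id, T.d_comp e g (add_zero 0) (zero_add 1) (zero_add 1) (zero_add 1)
        (add_zero 1) (zero_add 1), he, hg, GradedCat.zero_comp, GradedCat.comp_zero, smul_zero,
        add_zero, sub_zero]) (by
      rw [T.d_comp e h (zero_add (-1)) (neg_add_cancel 1) (zero_add 1) (neg_add_cancel 1)
        (add_neg_cancel 1) (zero_add 0), he, GradedCat.zero_comp, zero_add, dgSign_zero, one_smul,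
        ← hh, GradedCat.comp_sub, GradedCat.sub_comp, T.comp_id, T.id_comp,
        T.assoc e g e (add_zero 0) (add_zero 0) (add_zero 0) (add_zero 0)])
  exact isoDeg_zero_of_homotopy e g he hg a h ha hh.symm

/-! ### Strict cones inside a dg-category -/

/-- `K` is the cone of a degree `1` morphism `φ : M ⟶ N`. -/
structure ConeData (T : DGCat.{w, u, v} k) {M N K : T.Obj} (φ : T.Hom M N 1) where
  j : T.Hom M K 0
  i : T.Hom N K 0
  p : T.Hom K M 0
  q : T.Hom K N 0
  p_j : T.comp p j (add_zero 0) = T.id M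
  q_i : T.comp q i (add_zero 0) = T.id N
  p_i : T.comp p i (add_zero 0) = 0
  q_j : T.comp q j (add_zero 0) = 0
  total : T.comp j p (add_zero 0) + T.comp i q (add_zero 0) = T.id K
  d_φ : T.d 1 2 one_add_one_eq_two φ = 0
  d_j : T.d 0 1 (zero_add 1) j = T.comp i φ (zero_add 1)
  d_i : T.d 0 1 (zero_add 1) i = 0
  d_p : T.d 0 1 (zero_add 1) p = 0
  d_q : T.d 0 1 (zero_add 1) q = -T.comp φ p (add_zero 1)

namespace ConeData

variable {M N K : T.Obj} {φ : T.Hom M N 1} (c : T.ConeData (K := K) φ)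

theorem hom_ext_target {X : T.Obj} {n : ℤ} {f g : T.Hom X K n}
    (hp : T.comp c.p f (zero_add n) = T.comp c.p g (zero_add n))
    (hq : T.comp c.q f (zero_add n) = T.comp c.q g (zero_add n)) : f = g := by
  have h : ∀ f : T.Hom X K n, T.comp c.j (T.comp c.p f (zero_add n)) (zero_add n) +
      T.comp c.i (T.comp c.q f (zero_add n)) (zero_add n) = f := fun f => by
    rw [← T.assoc c.j c.p f (add_zero 0) (zero_add n) (zero_add n) (zero_add n),
      ← T.assoc c.i c.q f (add_zero 0) (zero_add n) (zero_add n) (zero_add n), ← T.add_comp,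
      c.total, T.id_comp]
  rw [← h f, ← h g, hp, hq]

theorem hom_ext_source {X : T.Obj} {n : ℤ} {f g : T.Hom K X n}
    (hj : T.comp f c.j (add_zero n) = T.comp g c.j (add_zero n))
    (hi : T.comp f c.i (add_zero n) = T.comp g c.i (add_zero n)) : f = g := by
  have h : ∀ f : T.Hom K X n, T.comp (T.comp f c.j (add_zero n)) c.p (add_zero n) +
      T.comp (T.comp f c.i (add_zero n)) c.q (add_zero n) = f := fun f => by
    rw [T.assoc f c.j c.p (add_zero n) (add_zero 0) (add_zero n) (add_zero n),
      T.assoc f c.i c.q (add_zero n) (add_zero 0) (add_zero n) (add_zero n), ← T.comp_add,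
      c.total, T.comp_id]
  rw [← h f, ← h g, hj, hi]

theorem exists_target {X : T.Obj} {n : ℤ} (a : T.Hom X M n) (b : T.Hom X N n) :
    ∃ f : T.Hom X K n, T.comp c.p f (zero_add n) = a ∧ T.comp c.q f (zero_add n) = b := by
  refine ⟨T.comp c.j a (zero_add n) + T.comp c.i b (zero_add n), ?_, ?_⟩
  · rw [T.comp_add, ← T.assoc c.p c.j a (add_zero 0) (zero_add n) (zero_add n) (zero_add n),
      ← T.assoc c.p c.i b (add_zero 0) (zero_add n) (zero_add n) (zero_add n), c.p_j, c.p_i,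
      T.id_comp, GradedCat.zero_comp, add_zero]
  · rw [T.comp_add, ← T.assoc c.q c.j a (add_zero 0) (zero_add n) (zero_add n) (zero_add n),
      ← T.assoc c.q c.i b (add_zero 0) (zero_add n) (zero_add n) (zero_add n), c.q_j, c.q_i,
      T.id_comp, GradedCat.zero_comp, zero_add]

theorem exists_source {X : T.Obj} {n : ℤ} (a : T.Hom M X n) (b : T.Hom N X n) :
    ∃ f : T.Hom K X n, T.comp f c.j (add_zero n) = a ∧ T.comp f c.i (add_zero n) = b := by
  refine ⟨T.comp a c.p (add_zero n) + T.comp b c.q (add_zero n), ?_, ?_⟩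
  · rw [T.add_comp, T.assoc a c.p c.j (add_zero n) (add_zero 0) (add_zero n) (add_zero n),
      T.assoc b c.q c.j (add_zero n) (add_zero 0) (add_zero n) (add_zero n), c.p_j, c.q_j,
      T.comp_id, GradedCat.comp_zero, add_zero]
  · rw [T.add_comp, T.assoc a c.p c.i (add_zero n) (add_zero 0) (add_zero n) (add_zero n),
      T.assoc b c.q c.i (add_zero n) (add_zero 0) (add_zero n) (add_zero n), c.p_i, c.q_i,
      T.comp_id, GradedCat.comp_zero, zero_add]

theorem p_d {X : T.Obj} {n m : ℤ} (h : n + 1 = m) (f : T.Hom X K n) :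
    T.comp c.p (T.d n m h f) (zero_add m) = T.d n m h (T.comp c.p f (zero_add n)) := by
  rw [T.d_comp c.p f (zero_add n) h (zero_add 1) h (by omega) (zero_add m), c.d_p,
    GradedCat.zero_comp, zero_add, dgSign_zero, one_smul]

theorem q_d {X : T.Obj} {n m : ℤ} (h : n + 1 = m) (f : T.Hom X K n) :
    T.comp c.q (T.d n m h f) (zero_add m) = T.d n m h (T.comp c.q f (zero_add n)) +
      T.comp φ (T.comp c.p f (zero_add n)) (by omega) := by
  rw [T.d_comp c.q f (zero_add n) h (zero_add 1) h (by omega) (zero_add m), c.d_q,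
    GradedCat.neg_comp, dgSign_zero, one_smul,
    T.assoc φ c.p f (add_zero 1) (zero_add n) (by omega) (by omega)]
  abel

theorem d_j' {X : T.Obj} {n m : ℤ} (h : n + 1 = m) (f : T.Hom K X n) :
    T.comp (T.d n m h f) c.j (add_zero m) = T.d n m h (T.comp f c.j (add_zero n)) -
      dgSign k n • T.comp (T.comp f c.i (add_zero n)) φ h := by
  rw [T.d_comp f c.j (add_zero n) h h (zero_add 1) (add_zero m) h, c.d_j,
    T.assoc f c.i φ (add_zero n) (zero_add 1) h h, add_sub_cancel_right]

theorem d_i' {X : T.Obj} {n m : ℤ} (h : n + 1 = m) (f : T.Hom K X n) :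
    T.comp (T.d n m h f) c.i (add_zero m) = T.d n m h (T.comp f c.i (add_zero n)) := by
  rw [T.d_comp f c.i (add_zero n) h h (zero_add 1) (add_zero m) h, c.d_i,
    GradedCat.comp_zero, smul_zero, add_zero]

/-- Morphisms into `K` are an extension of morphisms into `M` by morphisms into `N`, so acyclicity
at both ends gives it in the middle. The `M`-component is solved first. -/
theorem liftsAt (c : T.ConeData (K := K) φ) {L C : T.Obj} {e : T.Hom L C 0} (hM : T.LiftsAt e M) (hN : T.LiftsAt e N) :
    T.LiftsAt e K := by
  intro b n m l hb hn hm r s hr hs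
  have hr₁ := c.p_d hm r
  have hr₂ := c.q_d hm r
  rw [hr, GradedCat.comp_zero] at hr₁ hr₂
  have hs₁ := c.p_d hn s
  have hs₂ := c.q_d hn s
  rw [hs, ← T.assoc c.p r e (zero_add m) (add_zero m) (add_zero m) (zero_add m)] at hs₁
  rw [hs, ← T.assoc c.q r e (zero_add m) (add_zero m) (add_zero m) (zero_add m)] at hs₂
  obtain ⟨g₁, h₁, hg₁, hh₁⟩ := hM hb hn hm (T.comp c.p r (zero_add m)) (T.comp c.p s (zero_add n))
    hr₁.symm hs₁.symm
  have hφ : ∀ {X : T.Obj} {n m l : ℤ} (hn : n + 1 = m) (hm : m + 1 = l) (f : T.Hom X M n),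
      T.d m l hm (T.comp φ f (by omega)) = -T.comp φ (T.d n m hn f) (by omega) := by
    intro X n m l hn hm f
    rw [T.d_comp φ f (show 1 + n = m by omega) hm one_add_one_eq_two hn (by omega)
      (show 1 + m = l by omega), c.d_φ, GradedCat.zero_comp, dgSign_one]
    module
  -- By `q_d`, the `N`-component of a differential contains `φ` applied to the `M`-component; the
  -- data are corrected by the solution `g₁`, `h₁` already found.
  obtain ⟨g₂, h₂, hg₂, hh₂⟩ := hN hb hn hm
    (T.comp c.q r (zero_add m) - T.comp φ g₁ (by omega))
    (T.comp c.q s (zero_add n) + T.comp φ h₁ (by omega))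
    (by rw [map_sub, hφ hn hm, hg₁, sub_neg_eq_add]; exact hr₂.symm)
    (by
      rw [map_add, hφ hb hn, ← hh₁, GradedCat.sub_comp, hs₂, GradedCat.comp_sub,
        T.assoc φ g₁ e (show 1 + n = m by omega) (add_zero n) (add_zero m) (by omega)]
      abel)
  obtain ⟨g, hg1, hg2⟩ := c.exists_target g₁ g₂
  obtain ⟨h, hh1, hh2⟩ := c.exists_target h₁ h₂
  refine ⟨g, h, c.hom_ext_target ?_ ?_, c.hom_ext_target ?_ ?_⟩
  · rw [c.p_d, hg1, hg₁]
  · rw [c.q_d, hg1, hg2, hg₂, sub_add_cancel]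
  · rw [c.p_d, hh1, ← hh₁, GradedCat.comp_sub,
      ← T.assoc c.p g e (zero_add n) (add_zero n) (add_zero n) (zero_add n), hg1]
  · rw [c.q_d, hh1, hh2, ← hh₂, GradedCat.comp_sub,
      ← T.assoc c.q g e (zero_add n) (add_zero n) (add_zero n) (zero_add n), hg2]
    abel

/-- The square formed by `φ`, `f`, `eM`, `eN` commutes up to the homotopy `η`, which induces a map
`e` of cones. A three-step version of the five lemma shows that `e` is seen as an equivalence by `Z`
if `eM` and `eN` are and if `C` has the cone property for `Z`. -/
theorem exists_liftsAt (c : T.ConeData (K := K) φ) {X Y C : T.Obj} {f : T.Hom X Y 1} {j : T.Hom X C 0}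
    {i : T.Hom Y C 0} (hf : T.d 1 2 one_add_one_eq_two f = 0)
    (hi : T.d 0 1 (zero_add 1) i = 0) (hj : T.d 0 1 (zero_add 1) j = T.comp i f (zero_add 1))
    {eM : T.Hom M X 0} {eN : T.Hom N Y 0} (heM : T.d 0 1 (zero_add 1) eM = 0)
    (heN : T.d 0 1 (zero_add 1) eN = 0) (η : T.Hom M Y 0)
    (hη : T.d 0 1 (zero_add 1) η = T.comp eN φ (zero_add 1) - T.comp f eM (add_zero 1)) :
    ∃ e : T.Hom K C 0, T.d 0 1 (zero_add 1) e = 0 ∧ ∀ Z : T.Obj, T.LiftsAt eM Z → T.LiftsAt eN Z →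
      (∀ {b n m l : ℤ} (hb : b + 1 = n) (hn : n + 1 = m) (hm : m + 1 = l)
        (r : T.Hom C Z m) (σ : T.Hom X Z n) (τ : T.Hom Y Z n), T.d m l hm r = 0 →
        T.d n m hn σ - dgSign k n • T.comp τ f hn = T.comp r j (add_zero m) →
        T.d n m hn τ = T.comp r i (add_zero m) →
        ∃ (g : T.Hom C Z n) (h : T.Hom X Z b) (h' : T.Hom Y Z b), T.d n m hn g = r ∧
          T.comp g j (add_zero n) - σ = T.d b n hb h - dgSign k b • T.comp h' f hb ∧
          T.comp g i (add_zero n) - τ = T.d b n hb h') → T.LiftsAt e Z := by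
  -- The term `i ∘ η` compensates for the square commuting only up to homotopy; without it `e` would
  -- not be closed.
  obtain ⟨e, he1, he2⟩ := c.exists_source
    (T.comp j eM (add_zero 0) + T.comp i η (add_zero 0)) (T.comp i eN (add_zero 0))
  refine ⟨e, c.hom_ext_source ?_ ?_, fun Z hM hN H => ?_⟩
  · rw [c.d_j', he1, he2, map_add,
      T.d_comp j eM (add_zero 0) (zero_add 1) (zero_add 1) (zero_add 1) (add_zero 1) (zero_add 1),
      T.d_comp i η (add_zero 0) (zero_add 1) (zero_add 1) (zero_add 1) (add_zero 1) (zero_add 1),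
      hi, hj, heM, hη, GradedCat.comp_zero, GradedCat.zero_comp, GradedCat.zero_comp,
      GradedCat.comp_sub, T.assoc i f eM (zero_add 1) (add_zero 1) (add_zero 1) (zero_add 1),
      T.assoc i eN φ (add_zero 0) (zero_add 1) (zero_add 1) (zero_add 1), dgSign_zero]
    module
  · rw [c.d_i', he2,
      T.d_comp i eN (add_zero 0) (zero_add 1) (zero_add 1) (zero_add 1) (add_zero 1) (zero_add 1),
      hi, heN, GradedCat.comp_zero, GradedCat.zero_comp, GradedCat.zero_comp, smul_zero, add_zero]
  intro b n m l hb hn hm r s hr hs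
  have hs₁ := c.d_j' hn s
  have hs₂ := c.d_i' hn s
  rw [hs, T.assoc r e c.j (add_zero m) (add_zero 0) (add_zero m) (add_zero m), he1, T.comp_add,
    ← T.assoc r j eM (add_zero m) (add_zero 0) (add_zero m) (add_zero m),
    ← T.assoc r i η (add_zero m) (add_zero 0) (add_zero m) (add_zero m)] at hs₁
  rw [hs, T.assoc r e c.i (add_zero m) (add_zero 0) (add_zero m) (add_zero m), he2,
    ← T.assoc r i eN (add_zero m) (add_zero 0) (add_zero m) (add_zero m)] at hs₂
  set s₁ := T.comp s c.j (add_zero n)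
  set s₂ := T.comp s c.i (add_zero n)
  have hsgn : dgSign k n = -dgSign k b := by rw [← hb, dgSign_succ]
  have hsgn' : dgSign k m = -dgSign k n := by rw [← hn, dgSign_succ]
  have hdc : ∀ {U V W : T.Obj} {n m : ℤ} (hn : n + 1 = m) (x : T.Hom V W n) {y : T.Hom U V 0},
      T.d 0 1 (zero_add 1) y = 0 → T.d n m hn (T.comp x y (add_zero n)) =
        T.comp (T.d n m hn x) y (add_zero m) := by
    intro U V W n m hn x y hy
    rw [T.d_comp x y (add_zero n) hn hn (zero_add 1) (add_zero m) hn, hy, GradedCat.comp_zero,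
      smul_zero, add_zero]
  have hdc' : ∀ {U V W : T.Obj} {n m l : ℤ} (hn : n + 1 = m) (hm : m + 1 = l) (x : T.Hom V W n)
      {y : T.Hom U V 1}, T.d 1 2 one_add_one_eq_two y = 0 → T.d m l hm (T.comp x y hn) =
        T.comp (T.d n m hn x) y hm := by
    intro U V W n m l hn hm x y hy
    rw [T.d_comp x y hn hm hn one_add_one_eq_two hm (by omega), hy, GradedCat.comp_zero,
      smul_zero, add_zero]
  have hdη : ∀ {n m : ℤ} (hn : n + 1 = m) (x : T.Hom Y Z n),
      T.d n m hn (T.comp x η (add_zero n)) = T.comp (T.d n m hn x) η (add_zero m) +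
        dgSign k n • (T.comp (T.comp x eN (add_zero n)) φ hn -
          T.comp (T.comp x f hn) eM (add_zero m)) := by
    intro n m hn x
    rw [T.d_comp x η (add_zero n) hn hn (zero_add 1) (add_zero m) hn, hη, GradedCat.comp_sub,
      T.assoc x eN φ (add_zero n) (zero_add 1) hn hn,
      T.assoc x f eM hn (add_zero 1) (add_zero m) hn]
  -- First the `N`-component is replaced by a morphism from `Y`, then the `M`-component, corrected
  -- by the result, by a morphism from `X`. The pair `(ρ, τ)` is then a lifting problem for the cone
  -- property of `C`.
  obtain ⟨τ, t, hτ, ht⟩ := hN hb hn hm (T.comp r i (add_zero m)) s₂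
    (by rw [hdc hm r hi, hr, GradedCat.zero_comp]) hs₂.symm
  obtain ⟨ρ, t', hρ, ht'⟩ := hM hb hn hm (T.comp r j (add_zero m) + dgSign k n • T.comp τ f hn)
    (s₁ - T.comp τ η (add_zero n) + dgSign k n • T.comp t φ hb)
    (by
      rw [map_add, map_smul, hdc' hn hm τ hf, hτ,
        T.d_comp r j (add_zero m) hm hm (zero_add 1) (add_zero l) hm, hr, hj,
        T.assoc r i f (add_zero m) (zero_add 1) hm hm, GradedCat.zero_comp, hsgn']
      module)
    (by
      rw [map_add, map_sub, map_smul, hdη hn τ, hτ, hdc' hb hn t c.d_φ, ← ht,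
        eq_add_of_sub_eq hs₁.symm, T.add_comp, T.smul_comp, GradedCat.sub_comp]
      module)
  obtain ⟨g, h₁, h₂, hg, hh₁, hh₂⟩ := H hb hn hm r ρ τ hr (by rw [hρ]; abel) hτ
  -- The three homotopies are added up, those on `X` and `Y` being pulled back along the components
  -- of `e`.
  obtain ⟨h, hhj, hhi⟩ := c.exists_source
    (t' + T.comp h₁ eM (add_zero b) + T.comp h₂ η (add_zero b)) (t + T.comp h₂ eN (add_zero b))
  refine ⟨g, h, hg, c.hom_ext_source ?_ ?_⟩
  · rw [c.d_j', hhj, hhi, GradedCat.sub_comp,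
      T.assoc g e c.j (add_zero n) (add_zero 0) (add_zero n) (add_zero n), he1, T.comp_add,
      ← T.assoc g j eM (add_zero n) (add_zero 0) (add_zero n) (add_zero n),
      ← T.assoc g i η (add_zero n) (add_zero 0) (add_zero n) (add_zero n),
      sub_eq_iff_eq_add.1 hh₁, sub_eq_iff_eq_add.1 hh₂, map_add, map_add, ← ht', hdc hb h₁ heM,
      hdη hb h₂, T.add_comp, T.add_comp, T.add_comp, GradedCat.sub_comp, T.smul_comp, hsgn]
    module
  · rw [c.d_i', hhi, GradedCat.sub_comp,
      T.assoc g e c.i (add_zero n) (add_zero 0) (add_zero n) (add_zero n), he2,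
      ← T.assoc g i eN (add_zero n) (add_zero 0) (add_zero n) (add_zero n),
      sub_eq_iff_eq_add.1 hh₂, map_add, hdc hb h₂ heN, ← ht, T.add_comp]
    abel

end ConeData

end DGCat

/-! ### Dg-modules: Yoneda lemma, shifts and mapping cones -/

namespace DGModule

variable {k : Type w} [CommRing k] {A : DGCat.{w, u, v} k}

/-- The Yoneda lemma: evaluation at the identity is inverse. It holds for all morphisms of the
complexes, not only closed ones, because module morphisms commute with the action strictly. -/
theorem yonedaMap_bijective (B C : A.Obj) (n : ℤ) :
    Function.Bijective (yonedaMap B C n) := by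
  constructor
  · intro g g' h
    have h1 : (yonedaHom g).app 0 n (zero_add n) (A.id B) =
        (yonedaHom g').app 0 n (zero_add n) (A.id B) :=
      congrArg (fun φ : HomDG (yoneda B) (yoneda C) n => φ.app 0 n (zero_add n) (A.id B)) h
    exact (A.comp_id g).symm.trans ((yonedaHom_app g 0 n _ (add_zero n) _).symm.trans
      (h1.trans ((yonedaHom_app g' 0 n _ (add_zero n) _).trans (A.comp_id g'))))
  · intro φ
    refine ⟨φ.app 0 n (zero_add n) (A.id B), HomDG.ext fun X i j h x => ?_⟩
    refine (yonedaHom_app _ i j h (show n + i = j by omega) x).trans ?_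
    refine (φ.app_act (A.id B) x (zero_add i) (zero_add n) h (by omega)).symm.trans ?_
    exact congrArg _ (A.id_comp x)

/-- A degree `0` morphism of dg-modules from its components. -/
def HomDG.mkZero {M N : DGModule A} (φ : ∀ (X : A.Obj) (i : ℤ), M.carrier X i →ₗ[k] N.carrier X i)
    (hφ : ∀ (X Y : A.Obj) (p q r : ℤ) (x : M.carrier Y p) (f : A.Hom X Y q) (h : p + q = r),
      φ X r (M.act x f h) = N.act (φ Y p x) f h) : HomDG M N 0 :=
  HomDG.mk (fun X i j h => (show i = j by omega) ▸ φ X i) (by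
    intro X Y p q r p' r' x f h hp hr h'
    obtain rfl : p = p' := by omega
    obtain rfl : r = r' := by omega
    exact hφ X Y p q r x f h)

theorem HomDG.mkZero_app {M N : DGModule A}
    (φ : ∀ (X : A.Obj) (i : ℤ), M.carrier X i →ₗ[k] N.carrier X i) (hφ)
    {X : A.Obj} (i : ℤ) (h : i + 0 = i) (x : M.carrier X i) :
    (HomDG.mkZero φ hφ).app i i h x = φ X i x :=
  HomDG.mk_app _ _ i i h x

/-- Two morphisms of degree `0` agree if their components agree. -/
theorem HomDG.ext_zero {M N : DGModule A} {φ ψ : HomDG M N 0}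
    (H : ∀ (X : A.Obj) (i : ℤ) (x : M.carrier X i),
      φ.app i i (add_zero i) x = ψ.app i i (add_zero i) x) : φ = ψ :=
  HomDG.ext fun X i j h x => by
    obtain rfl : i = j := by omega
    exact H X i x

theorem HomDG.comp_zero_app {L M N : DGModule A} (ψ : HomDG M N 0) (φ : HomDG L M 0)
    {X : A.Obj} (i : ℤ) (x : L.carrier X i) :
    (ψ.comp φ (add_zero 0)).app i i (add_zero i) x =
      ψ.app i i (add_zero i) (φ.app i i (add_zero i) x) :=
  HomDG.comp_app ψ φ _ i i i _ _ _ x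

theorem HomDG.diff_zero_app {M N : DGModule A} (φ : HomDG M N 0) {X : A.Obj} (i j : ℤ)
    (h : i + 1 = j) (x : M.carrier X i) :
    (HomDG.diff 0 1 (zero_add 1) φ).app i j h x =
      N.d i j h (φ.app i i (add_zero i) x) - φ.app j j (add_zero j) (M.d i j h x) := by
  rw [HomDG.diff_app (zero_add 1) φ i j j i h (add_zero i) h h (add_zero j), dgSign_zero, one_smul]

/-- The identity, as a morphism of degree `s` from the shift `M[s]` to `M`. -/
def fromShift (M : DGModule A) (s : ℤ) : HomDG (M.shift s) M s :=
  HomDG.mk (M := M.shift s) (fun X i j h => h ▸ (LinearMap.id : M.carrier X (i + s) →ₗ[k] _)) (by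
    intro X Y p q r p' r' x f h hp hr h'
    subst hp hr
    rfl)

theorem fromShift_app (M : DGModule A) (s : ℤ) {X : A.Obj} (i : ℤ) (x : M.carrier X (i + s)) :
    (M.fromShift s).app i (i + s) rfl x = x :=
  HomDG.mk_app (M := M.shift s) _ _ i (i + s) rfl x

/-- The identity, as a morphism of degree `-s` from `M` to the shift `M[s]`. -/
def toShift (M : DGModule A) (s t : ℤ) (hst : s + t = 0) : HomDG M (M.shift s) t :=
  HomDG.mk (N := M.shift s)
    (fun X i j h => (show i = j + s by omega) ▸ (LinearMap.id : M.carrier X i →ₗ[k] _)) (by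
    intro X Y p q r p' r' x f h hp hr h'
    obtain rfl : t = -s := by omega
    obtain rfl : p = p' + s := by omega
    obtain rfl : r = r' + s := by omega
    rfl)

theorem toShift_app (M : DGModule A) (s t : ℤ) (hst : s + t = 0) {X : A.Obj} (j : ℤ)
    (h : j + s + t = j) (x : M.carrier X (j + s)) :
    (M.toShift s t hst).app (j + s) j h x = x :=
  HomDG.mk_app (N := M.shift s) _ _ (j + s) j h x

/-- The sign `(-1) ^ s` in the differential of the shift cancels the one in the differential of a
degree `s` morphism. -/
theorem d_fromShift (M : DGModule A) (s : ℤ) :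
    HomDG.diff s (s + 1) rfl (M.fromShift s) = 0 := by
  refine HomDG.ext fun X i j h x => ?_
  obtain rfl : j = i + 1 + s := by omega
  rw [HomDG.diff_app rfl (M.fromShift s) i (i + 1 + s) (i + 1) (i + s) rfl rfl h (by omega) rfl,
    HomDG.zero_app]
  refine sub_eq_zero.2 ?_
  refine (congrArg (M.d (i + s) (i + 1 + s) _) (M.fromShift_app s i x)).trans ?_
  refine Eq.trans ?_ (congrArg (dgSign k s • ·) (M.fromShift_app s (i + 1) _).symm)
  exact (DGCat.dgSign_smul_smul s _).symm

theorem d_toShift (M : DGModule A) (s t : ℤ) (hst : s + t = 0) :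
    HomDG.diff t (t + 1) rfl (M.toShift s t hst) = 0 := by
  refine HomDG.ext fun X i j h x => ?_
  obtain ⟨j, rfl⟩ : ∃ j', j = j' + 1 := ⟨j - 1, by omega⟩
  obtain rfl : i = j + s := by omega
  rw [HomDG.diff_app rfl (M.toShift s t hst) (j + s) (j + 1) (j + 1 + s) j (by omega) (by omega) h
    rfl (by omega), HomDG.zero_app]
  refine sub_eq_zero.2 ?_
  refine (congrArg ((M.shift s).d j (j + 1) _) (M.toShift_app s t hst j (by omega) x)).trans ?_
  refine Eq.trans ?_ (congrArg (dgSign k t • ·) (M.toShift_app s t hst (j + 1) (by omega) _).symm)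
  obtain rfl : t = -s := by omega
  rw [dgSign_neg]
  rfl

theorem fromShift_comp_toShift (M : DGModule A) (s t : ℤ) (hst : s + t = 0) :
    (M.fromShift s).comp (M.toShift s t hst) hst = HomDG.idHom M := by
  refine HomDG.ext_zero fun X i x => ?_
  obtain ⟨i, rfl⟩ : ∃ i', i = i' + s := ⟨i - s, by omega⟩
  rw [HomDG.comp_app _ _ hst (i + s) i (i + s) (add_zero _) (by omega) rfl, HomDG.idHom_app]
  refine (congrArg _ (M.toShift_app s t hst i (by omega) x)).trans ?_
  exact M.fromShift_app s i x

theorem toShift_comp_fromShift (M : DGModule A) (s t : ℤ) (hst : s + t = 0) :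
    (M.toShift s t hst).comp (M.fromShift s) (by omega) = HomDG.idHom (M.shift s) := by
  refine HomDG.ext_zero fun X i x => ?_
  rw [HomDG.comp_app _ _ _ i (i + s) i (add_zero _) rfl (by omega), HomDG.idHom_app]
  refine (congrArg _ (M.fromShift_app s i x)).trans ?_
  exact M.toShift_app s t hst i (by omega) x

section Cone

variable {M N : DGModule A} (φ : HomDG M N 0) (hφ : HomDG.diff 0 1 (zero_add 1) φ = 0)

/-- The degree `1` morphism `M[1] ⟶ N` given by `φ : M ⟶ N`. -/
def shiftHom : HomDG (M.shift 1) N 1 :=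
  HomDG.mk (M := M.shift 1) (fun X i j h => φ.app (i + 1) j (by omega)) (by
    intro X Y p q r p' r' x f h hp hr h'
    exact φ.app_act x f _ _ _ _)

theorem shiftHom_app {X : A.Obj} (i j : ℤ) (h : i + 1 = j) (x : (M.shift 1).carrier X i) :
    (shiftHom φ).app i j h x = φ.app (i + 1) j (by omega) x :=
  HomDG.mk_app (M := M.shift 1) _ _ i j h x

theorem shift_one_d_apply {X : A.Obj} {n m : ℤ} (h : n + 1 = m) (x : (M.shift 1).carrier X n) :
    (M.shift 1).d n m h x =
      -(show (M.shift 1).carrier X m from M.d (n + 1) (m + 1) (by omega) x) := by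
  change dgSign k 1 • M.d (n + 1) (m + 1) (by omega) x = -M.d (n + 1) (m + 1) (by omega) x
  rw [dgSign_one]
  module

theorem app_d_of_closed (hφ : HomDG.diff 0 1 (zero_add 1) φ = 0) {X : A.Obj} (i j : ℤ)
    (h : i + 1 = j) (x : M.carrier X i) :
    N.d i j h (φ.app i i (add_zero i) x) = φ.app j j (add_zero j) (M.d i j h x) := by
  have h1 := HomDG.diff_zero_app φ i j h x
  rw [hφ, HomDG.zero_app] at h1
  exact sub_eq_zero.1 h1.symm

/-- Viewing `φ` as a degree `1` map out of `M[1]` brings two signs, from the shift and from the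
degree, which cancel; this lets mapping cones be treated as cones of degree `1` morphisms. -/
theorem d_shiftHom (hφ : HomDG.diff 0 1 (zero_add 1) φ = 0) :
    HomDG.diff 1 2 one_add_one_eq_two (shiftHom φ) = 0 :=
  HomDG.ext fun X i j h x => by
    obtain rfl : j = i + 1 + 1 := by omega
    rw [HomDG.diff_app one_add_one_eq_two (shiftHom φ) i (i + 1 + 1) (i + 1) (i + 1) rfl rfl h
      rfl rfl x, shift_one_d_apply, map_neg, shiftHom_app, shiftHom_app, HomDG.zero_app, dgSign_one]
    refine (congrArg (· - (-1 : k) • -φ.app (i + 1 + 1) (i + 1 + 1) (add_zero _)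
      (M.d (i + 1) (i + 1 + 1) rfl x)) (app_d_of_closed φ hφ (i + 1) (i + 1 + 1) rfl x)).trans ?_
    module

/-- The first component of an element of the cone. -/
def coneFstL (X : A.Obj) (i : ℤ) : (cone φ hφ).carrier X i →ₗ[k] (M.shift 1).carrier X i :=
  LinearMap.fst k (M.carrier X (i + 1)) (N.carrier X i)

/-- The second component of an element of the cone. -/
def coneSndL (X : A.Obj) (i : ℤ) : (cone φ hφ).carrier X i →ₗ[k] N.carrier X i :=
  LinearMap.snd k (M.carrier X (i + 1)) (N.carrier X i)

/-- The first inclusion into the cone, on elements. -/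
def coneInlL (X : A.Obj) (i : ℤ) : (M.shift 1).carrier X i →ₗ[k] (cone φ hφ).carrier X i :=
  LinearMap.inl k (M.carrier X (i + 1)) (N.carrier X i)

/-- The second inclusion into the cone, on elements. -/
def coneInrL (X : A.Obj) (i : ℤ) : N.carrier X i →ₗ[k] (cone φ hφ).carrier X i :=
  LinearMap.inr k (M.carrier X (i + 1)) (N.carrier X i)

theorem coneFstL_d {X : A.Obj} {i j : ℤ} (h : i + 1 = j) (x : (cone φ hφ).carrier X i) :
    coneFstL φ hφ X j ((cone φ hφ).d i j h x) = (M.shift 1).d i j h (coneFstL φ hφ X i x) :=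
  (shift_one_d_apply h _).symm

theorem coneSndL_d {X : A.Obj} {i j : ℤ} (h : i + 1 = j) (x : (cone φ hφ).carrier X i) :
    coneSndL φ hφ X j ((cone φ hφ).d i j h x) =
      (shiftHom φ).app i j h (coneFstL φ hφ X i x) + N.d i j h (coneSndL φ hφ X i x) :=
  congrArg (· + N.d i j h (coneSndL φ hφ X i x)) (shiftHom_app φ i j h _).symm

theorem cone_ext {X : A.Obj} {i : ℤ} {x y : (cone φ hφ).carrier X i}
    (h₁ : coneFstL φ hφ X i x = coneFstL φ hφ X i y)
    (h₂ : coneSndL φ hφ X i x = coneSndL φ hφ X i y) : x = y := Prod.ext h₁ h₂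

theorem coneFstL_inl {X : A.Obj} {i : ℤ} (x : (M.shift 1).carrier X i) :
    coneFstL φ hφ X i (coneInlL φ hφ X i x) = x := rfl

theorem coneSndL_inl {X : A.Obj} {i : ℤ} (x : (M.shift 1).carrier X i) :
    coneSndL φ hφ X i (coneInlL φ hφ X i x) = 0 := rfl

theorem coneFstL_inr {X : A.Obj} {i : ℤ} (x : N.carrier X i) :
    coneFstL φ hφ X i (coneInrL φ hφ X i x) = 0 := rfl

theorem coneSndL_inr {X : A.Obj} {i : ℤ} (x : N.carrier X i) :
    coneSndL φ hφ X i (coneInrL φ hφ X i x) = x := rfl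

/-- The inclusion `M[1] ⟶ cone φ`. -/
def coneInl : HomDG (M.shift 1) (cone φ hφ) 0 :=
  HomDG.mkZero (coneInlL φ hφ) (by
    intro X Y p q r x f h
    exact Prod.ext rfl (N.zero_act f h).symm)

/-- The inclusion `N ⟶ cone φ`. -/
def coneInr : HomDG N (cone φ hφ) 0 :=
  HomDG.mkZero (coneInrL φ hφ) (by
    intro X Y p q r x f h
    exact Prod.ext (M.zero_act f _).symm rfl)

/-- The projection `cone φ ⟶ M[1]`. -/
def coneFst : HomDG (cone φ hφ) (M.shift 1) 0 :=
  HomDG.mkZero (coneFstL φ hφ) (by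
    intro X Y p q r x f h
    rfl)

/-- The projection `cone φ ⟶ N`. -/
def coneSnd : HomDG (cone φ hφ) N 0 :=
  HomDG.mkZero (coneSndL φ hφ) (by
    intro X Y p q r x f h
    rfl)

theorem coneInl_app {X : A.Obj} (i : ℤ) (h : i + 0 = i) (x : (M.shift 1).carrier X i) :
    (coneInl φ hφ).app i i h x = coneInlL φ hφ X i x := HomDG.mkZero_app _ _ i _ x

theorem coneInr_app {X : A.Obj} (i : ℤ) (h : i + 0 = i) (x : N.carrier X i) :
    (coneInr φ hφ).app i i h x = coneInrL φ hφ X i x := HomDG.mkZero_app _ _ i _ x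

theorem coneFst_app {X : A.Obj} (i : ℤ) (h : i + 0 = i) (x : (cone φ hφ).carrier X i) :
    (coneFst φ hφ).app i i h x = coneFstL φ hφ X i x := HomDG.mkZero_app _ _ i _ x

theorem coneSnd_app {X : A.Obj} (i : ℤ) (h : i + 0 = i) (x : (cone φ hφ).carrier X i) :
    (coneSnd φ hφ).app i i h x = coneSndL φ hφ X i x := HomDG.mkZero_app _ _ i _ x

theorem coneFst_comp_inl : (coneFst φ hφ).comp (coneInl φ hφ) (add_zero 0) = HomDG.idHom _ :=
  HomDG.ext_zero fun X i x => by
    rw [HomDG.comp_zero_app, coneInl_app, coneFst_app, HomDG.idHom_app, coneFstL_inl]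

theorem coneSnd_comp_inr : (coneSnd φ hφ).comp (coneInr φ hφ) (add_zero 0) = HomDG.idHom _ :=
  HomDG.ext_zero fun X i x => by
    rw [HomDG.comp_zero_app, coneInr_app, coneSnd_app, HomDG.idHom_app, coneSndL_inr]

theorem coneFst_comp_inr : (coneFst φ hφ).comp (coneInr φ hφ) (add_zero 0) = 0 :=
  HomDG.ext_zero fun X i x => by
    rw [HomDG.comp_zero_app, coneInr_app, coneFst_app, HomDG.zero_app, coneFstL_inr]

theorem coneSnd_comp_inl : (coneSnd φ hφ).comp (coneInl φ hφ) (add_zero 0) = 0 :=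
  HomDG.ext_zero fun X i x => by
    rw [HomDG.comp_zero_app, coneInl_app, coneSnd_app, HomDG.zero_app, coneSndL_inl]

theorem cone_total : (coneInl φ hφ).comp (coneFst φ hφ) (add_zero 0) +
    (coneInr φ hφ).comp (coneSnd φ hφ) (add_zero 0) = HomDG.idHom _ :=
  HomDG.ext_zero fun X i x => by
    rw [HomDG.add_app, HomDG.comp_zero_app, HomDG.comp_zero_app, coneFst_app, coneSnd_app,
      coneInl_app, coneInr_app, HomDG.idHom_app]
    refine cone_ext φ hφ ?_ ?_
    · rw [map_add, coneFstL_inl, coneFstL_inr, add_zero]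
    · rw [map_add, coneSndL_inl, coneSndL_inr, zero_add]

theorem d_coneInl : HomDG.diff 0 1 (zero_add 1) (coneInl φ hφ) =
    (coneInr φ hφ).comp (shiftHom φ) (zero_add 1) :=
  HomDG.ext fun X i j h x => by
    rw [HomDG.diff_zero_app, coneInl_app, coneInl_app,
      HomDG.comp_app _ _ (zero_add 1) i j j h h (add_zero j) x, coneInr_app]
    refine cone_ext φ hφ ?_ ?_
    · rw [map_sub, coneFstL_d, coneFstL_inl, coneFstL_inl, coneFstL_inr, sub_self]
    · rw [map_sub, coneSndL_d, coneFstL_inl, coneSndL_inl, coneSndL_inl, coneSndL_inr, map_zero,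
        add_zero, sub_zero]

theorem d_coneInr : HomDG.diff 0 1 (zero_add 1) (coneInr φ hφ) = 0 :=
  HomDG.ext fun X i j h x => by
    rw [HomDG.diff_zero_app, coneInr_app, coneInr_app, HomDG.zero_app]
    refine cone_ext φ hφ ?_ ?_
    · rw [map_sub, coneFstL_d, coneFstL_inr, coneFstL_inr, map_zero, map_zero, sub_zero]
    · rw [map_sub, coneSndL_d, coneFstL_inr, coneSndL_inr, coneSndL_inr, map_zero, map_zero,
        zero_add, sub_self]

theorem d_coneFst : HomDG.diff 0 1 (zero_add 1) (coneFst φ hφ) = 0 :=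
  HomDG.ext fun X i j h x => by
    rw [HomDG.diff_zero_app, coneFst_app, coneFst_app, HomDG.zero_app, coneFstL_d, sub_self]

theorem d_coneSnd : HomDG.diff 0 1 (zero_add 1) (coneSnd φ hφ) =
    -(shiftHom φ).comp (coneFst φ hφ) (add_zero 1) :=
  HomDG.ext fun X i j h x => by
    rw [HomDG.diff_zero_app, coneSnd_app, coneSnd_app, coneSndL_d, ← neg_one_smul k,
      HomDG.smul_app, HomDG.comp_app _ _ (add_zero 1) i i j h (add_zero i) h x, coneFst_app]
    module

end Cone

end DGModule

/-! ### The essential image of a fully faithful dg-functor -/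

namespace DGFunctor

variable {k : Type w} [CommRing k] {A : DGCat.{w, u, v} k} {T : DGCat.{w, u', v'} k}

theorem mapH_bijective (F : DGFunctor A T)
    (hF : ∀ X Y n, Function.Bijective (F.map : A.Hom X Y n → T.Hom (F.obj X) (F.obj Y) n))
    (X Y : A.Obj) (n : ℤ) : Function.Bijective (F.mapH X Y n) := by
  constructor
  · refine (injective_iff_map_eq_zero _).2 fun f hf => ?_
    obtain ⟨f, rfl⟩ := DGCat.mkH_surjective f
    obtain ⟨e, he⟩ := (DGCat.mkH_eq_zero_iff (sub_add_cancel n 1) (F.mapZ X Y n f)).1 hf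
    obtain ⟨e, rfl⟩ := (hF X Y (n - 1)).2 e
    exact (DGCat.mkH_eq_zero_iff (sub_add_cancel n 1) f).2
      ⟨e, (hF X Y n).1 ((F.map_d _ e).trans he)⟩
  · intro g
    obtain ⟨⟨g, hg⟩, rfl⟩ := DGCat.mkH_surjective g
    obtain ⟨f, rfl⟩ := (hF X Y n).2 g
    refine ⟨A.mkH ⟨f, (hF X Y (n + 1)).1 ?_⟩, rfl⟩
    rw [F.map_d, map_zero]
    exact hg

theorem isoDeg_map (F : DGFunctor A T) {X Y : A.Obj} {s : ℤ} (h : A.cohomology.IsoDeg s X Y) :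
    T.cohomology.IsoDeg s (F.obj X) (F.obj Y) := by
  obtain ⟨f, g, hfg, hgf⟩ := h
  obtain ⟨f, rfl⟩ := DGCat.mkH_surjective (A := A) (X := X) (Y := Y) f
  obtain ⟨g, rfl⟩ := DGCat.mkH_surjective (A := A) (X := Y) (Y := X) (n := -s) g
  refine ⟨F.mapH X Y s (A.mkH f), F.mapH Y X (-s) (A.mkH g), ?_, ?_⟩
  · exact (congrArg T.mkH (Subtype.ext (F.map_comp f.1 g.1 _).symm)).trans
      ((congrArg (F.mapH Y Y 0) hfg).trans (congrArg T.mkH (Subtype.ext (F.map_id Y))))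
  · exact (congrArg T.mkH (Subtype.ext (F.map_comp g.1 f.1 _).symm)).trans
      ((congrArg (F.mapH X X 0) hgf).trans (congrArg T.mkH (Subtype.ext (F.map_id X))))

/-- The essential image of a fully faithful dg-functor is closed under those cones that exist in
its source. -/
theorem exists_isoDeg_cone (F : DGFunctor A T)
    (hF : ∀ X Y n, Function.Bijective (F.map : A.Hom X Y n → T.Hom (F.obj X) (F.obj Y) n))
    (hcone : ∀ {X Y : A.Obj} (f : A.Hom X Y 1), A.d 1 2 one_add_one_eq_two f = 0 →
      ∃ (C : A.Obj) (j : A.Hom X C 0) (i : A.Hom Y C 0), A.IsHoCone f j i)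
    {M N K : T.Obj} {φ : T.Hom M N 1} (c : T.ConeData (K := K) φ) {X Y : A.Obj}
    (hM : T.cohomology.IsoDeg 0 M (F.obj X)) (hN : T.cohomology.IsoDeg 0 N (F.obj Y)) :
    ∃ C : A.Obj, T.cohomology.IsoDeg 0 K (F.obj C) := by
  obtain ⟨eM, eM', aM, bM, heM, heM', haM, hbM⟩ := DGCat.exists_homotopy_of_isoDeg_zero hM
  obtain ⟨eN, eN', aN, bN, heN, heN', haN, hbN⟩ := DGCat.exists_homotopy_of_isoDeg_zero hN
  have hφ1 : T.d 1 2 one_add_one_eq_two (T.comp eN φ (zero_add 1)) = 0 := by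
    rw [T.d_comp eN φ (zero_add 1) one_add_one_eq_two (zero_add 1) one_add_one_eq_two
      one_add_one_eq_two (zero_add 2), heN, c.d_φ, GradedCat.zero_comp, GradedCat.comp_zero,
      smul_zero, add_zero]
  -- Full faithfulness on complexes lets `φ`, transported along the two equivalences, be realised by
  -- a morphism of `A`; the homotopy `η` comes from `bM`, which relates `eM' ∘ eM` to the identity.
  obtain ⟨f, hf⟩ := (hF X Y 1).2 (T.comp (T.comp eN φ (zero_add 1)) eM' (add_zero 1))
  have hf1 : T.d 1 2 one_add_one_eq_two (F.map f) = 0 := by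
    rw [hf, T.d_comp _ eM' (add_zero 1) one_add_one_eq_two one_add_one_eq_two (zero_add 1)
      (add_zero 2) one_add_one_eq_two, hφ1, heM', GradedCat.zero_comp, GradedCat.comp_zero,
      smul_zero, add_zero]
  have hf0 : A.d 1 2 one_add_one_eq_two f = 0 := by
    refine (hF X Y 2).1 ?_
    rw [F.map_d, hf1, map_zero]
  obtain ⟨C, j, i, H⟩ := hcone f hf0
  have hη : T.d 0 1 (zero_add 1) (T.comp (T.comp eN φ (zero_add 1)) bM (add_neg_cancel 1)) =
      T.comp eN φ (zero_add 1) - T.comp (F.map f) eM (add_zero 1) := by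
    rw [T.d_comp _ bM (add_neg_cancel 1) (zero_add 1) one_add_one_eq_two (neg_add_cancel 1)
      (by omega) (add_zero 1), hφ1, hbM, GradedCat.zero_comp, GradedCat.comp_sub, T.comp_id, hf,
      T.assoc (T.comp eN φ (zero_add 1)) eM' eM (add_zero 1) (add_zero 0) (add_zero 1) (add_zero 1),
      dgSign_one]
    module
  obtain ⟨e, he, hL⟩ := c.exists_liftsAt (X := F.obj X) (Y := F.obj Y) (C := F.obj C)
    (f := F.map f) (j := F.map j) (i := F.map i) hf1
    (by rw [← F.map_d, H.d_inr, map_zero]) (by rw [← F.map_d, H.d_inl, F.map_comp])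
    heM heN _ hη
  -- `IsHoCone` tests only against objects of `A`, so lifting is obtained at objects in the image of
  -- `F`.
  have key : ∀ Z : A.Obj, T.LiftsAt e (F.obj Z) := by
    intro Z
    refine hL _ (DGCat.liftsAt_of_homotopy heM heM' aM bM haM hbM _)
      (DGCat.liftsAt_of_homotopy heN heN' aN bN haN hbN _) ?_
    intro b n m l hb hn hm r σ τ hr hσ hτ
    obtain ⟨r, rfl⟩ := (hF C Z m).2 r
    obtain ⟨σ, rfl⟩ := (hF X Z n).2 σ
    obtain ⟨τ, rfl⟩ := (hF Y Z n).2 τ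
    obtain ⟨g, h, h', hg, hh, hh'⟩ := H.lift hb hn hm r σ τ
      ((hF C Z l).1 (by rw [F.map_d, hr, map_zero]))
      ((hF X Z m).1 (by
        rw [map_sub, map_smul, F.map_d, F.map_comp τ f hn, F.map_comp r j (add_zero m), hσ]))
      ((hF Y Z m).1 (by rw [F.map_d, F.map_comp r i (add_zero m), hτ]))
    refine ⟨F.map g, F.map h, F.map h', ?_, ?_, ?_⟩
    · rw [← F.map_d, hg]
    · rw [← F.map_comp g j (add_zero n), ← F.map_comp h' f hb, ← F.map_d, ← map_sub, hh, map_sub,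
        map_smul]
    · rw [← F.map_comp g i (add_zero n), ← F.map_d, ← map_sub, hh']
  -- Lifting at `K` itself, which need not be in the image, follows because `K` is a cone of objects
  -- equivalent to images.
  exact ⟨C, DGCat.isoDeg_zero_of_liftsAt he (key C)
    (c.liftsAt (DGCat.LiftsAt.of_homotopy (key X) heM heM' bM hbM)
      (DGCat.LiftsAt.of_homotopy (key Y) heN heN' bN hbN))⟩

end DGFunctor

/-! ### Modules in the pretriangulated hull -/

namespace DGModule

variable {k : Type w} [CommRing k] {A : DGCat.{w, u, v} k}

theorem isoDeg_shift {M : DGModule A} (hM : M.IsPretr) (s : ℤ) :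
    A.pretr.cohomology.IsoDeg s ⟨M.shift s, hM.shift M s⟩ ⟨M, hM⟩ :=
  DGCat.isoDeg_of_closed (T := A.pretr) (X := ⟨M.shift s, hM.shift M s⟩) (Y := ⟨M, hM⟩)
    (add_neg_cancel s) (M.fromShift s) (M.toShift s (-s) (add_neg_cancel s)) (M.d_fromShift s)
    (M.d_toShift s (-s) _) (M.fromShift_comp_toShift s (-s) _) (M.toShift_comp_fromShift s (-s) _)

/-- The mapping cone as a cone in the pretriangulated hull. -/
def coneDataPretr {M N : DGModule A} (φ : HomDG M N 0) (hφ : HomDG.diff 0 1 (zero_add 1) φ = 0)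
    (hM : M.IsPretr) (hN : N.IsPretr) :
    A.pretr.ConeData (M := ⟨M.shift 1, hM.shift M 1⟩) (N := ⟨N, hN⟩)
      (K := ⟨cone φ hφ, hM.cone φ hφ hN⟩) (shiftHom φ) where
  j := coneInl φ hφ
  i := coneInr φ hφ
  p := coneFst φ hφ
  q := coneSnd φ hφ
  p_j := coneFst_comp_inl φ hφ
  q_i := coneSnd_comp_inr φ hφ
  p_i := coneFst_comp_inr φ hφ
  q_j := coneSnd_comp_inl φ hφ
  total := cone_total φ hφ
  d_φ := d_shiftHom φ hφ
  d_j := d_coneInl φ hφ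
  d_i := d_coneInr φ hφ
  d_p := d_coneFst φ hφ
  d_q := d_coneSnd φ hφ

/-- Induction over the construction of the hull. For a cone, the source is first shifted by `1`, as
`hcone` concerns morphisms of degree `1`. -/
theorem IsPretr.exists_isoDeg
    (hshift : ∀ (X : A.Obj) (s : ℤ), ∃ X' : A.Obj, A.cohomology.IsoDeg s X' X)
    (hcone : ∀ {X Y : A.Obj} (f : A.Hom X Y 1), A.d 1 2 one_add_one_eq_two f = 0 →
      ∃ (C : A.Obj) (j : A.Hom X C 0) (i : A.Hom Y C 0), A.IsHoCone f j i)
    {M : DGModule A} (hM : M.IsPretr) :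
    ∃ X : A.Obj, A.pretr.cohomology.IsoDeg 0 ⟨M, hM⟩ (A.yonedaPretr.obj X) := by
  have shift : ∀ {M : DGModule A} (hM : M.IsPretr) (s : ℤ) {X : A.Obj},
      A.pretr.cohomology.IsoDeg 0 ⟨M, hM⟩ (A.yonedaPretr.obj X) → ∃ X' : A.Obj,
        A.pretr.cohomology.IsoDeg 0 ⟨M.shift s, hM.shift M s⟩ (A.yonedaPretr.obj X') := by
    intro M hM s X hX
    obtain ⟨X', hX'⟩ := hshift X s
    -- The degrees `s`, `0` and `-s` of the three isomorphisms add up to `0`.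
    exact ⟨X', ((isoDeg_shift hM s).trans hX (zero_add s)).trans
      ((A.yonedaPretr.isoDeg_map hX').symm (add_neg_cancel s)) (neg_add_cancel s)⟩
  induction hM with
  | yoneda B => exact ⟨B, GradedCat.IsoDeg.refl _⟩
  | shift M s hM ih =>
    obtain ⟨X, hX⟩ := ih
    exact shift hM s hX
  | cone φ hφ hM hN ihM ihN =>
    obtain ⟨X, hX⟩ := ihM
    obtain ⟨X', hX'⟩ := shift hM 1 hX
    obtain ⟨Y, hY⟩ := ihN
    exact A.yonedaPretr.exists_isoDeg_cone yonedaMap_bijective hcone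
      (coneDataPretr φ hφ hM hN) hX' hY

end DGModule

namespace DGCat

variable {k : Type w} [CommRing k] {A : DGCat.{w, u, v} k}

theorem isPretriangulated_of_shifts_of_cones
    (hshift : ∀ (X : A.Obj) (s : ℤ), ∃ X' : A.Obj, A.cohomology.IsoDeg s X' X)
    (hcone : ∀ {X Y : A.Obj} (f : A.Hom X Y 1), A.d 1 2 one_add_one_eq_two f = 0 →
      ∃ (C : A.Obj) (j : A.Hom X C 0) (i : A.Hom Y C 0), A.IsHoCone f j i) :
    A.IsPretriangulated := by
  refine ⟨A.yonedaPretr.mapH_bijective DGModule.yonedaMap_bijective, ⟨fun P => ?_⟩⟩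
  obtain ⟨P, hP⟩ := P
  obtain ⟨X, f, g, hfg, hgf⟩ := hP.exists_isoDeg hshift hcone
  exact ⟨X, ⟨⟨g, f, hfg, hgf⟩⟩⟩

end DGCat

/-! ### Finite biproducts as graded coproducts -/

namespace GradedCat

variable {k : Type w} [CommRing k] (G : GradedCat.{w, u, v} k)

/-- The equations between inclusions and projections of a biproduct live in degree `0` and can be
composed with morphisms of any degree, so the universal property extends to all degrees. -/
theorem hasCoproductsLE_of_hasFiniteBiproducts
    (h : CategoryTheory.Limits.HasFiniteBiproducts G.DegZero) {κ : Cardinal.{0}}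
    (hκ : κ < Cardinal.aleph0) : G.HasCoproductsLE κ := by
  classical
  intro I hI X
  have : Finite I := Cardinal.lt_aleph0_iff_finite.1 (hI.trans_lt hκ)
  have := Fintype.ofFinite I
  have := CategoryTheory.Limits.hasBiproductsOfShape_finite (C := G.DegZero) (J := I)
  let X' : I → G.DegZero := X
  let C' : G.DegZero := CategoryTheory.Limits.biproduct X'
  let C : G.Obj := C'
  let ι : ∀ s, G.Hom (X s) C 0 := fun s => (CategoryTheory.Limits.biproduct.ι X' s : X' s ⟶ C')
  let π : ∀ s, G.Hom C (X s) 0 := fun s => (CategoryTheory.Limits.biproduct.π X' s : C' ⟶ X' s)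
  have total : ∑ s, G.comp (ι s) (π s) (add_zero 0) = G.id C :=
    CategoryTheory.Limits.biproduct.total (f := X')
  have hself : ∀ s, G.comp (π s) (ι s) (add_zero 0) = G.id (X s) := fun s =>
    CategoryTheory.Limits.biproduct.ι_π_self X' s
  have hne : ∀ {s s'}, s ≠ s' → G.comp (π s') (ι s) (add_zero 0) = 0 := fun h =>
    CategoryTheory.Limits.biproduct.ι_π_ne X' h
  refine ⟨C, ι, fun Y n => ⟨fun f g hfg => ?_, fun σ => ?_⟩⟩
  · have hexp : ∀ f : G.Hom C Y n, f =
        ∑ s, G.comp (G.comp f (ι s) (add_zero n)) (π s) (add_zero n) := fun f => by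
      rw [Finset.sum_congr rfl fun s _ => G.assoc f (ι s) (π s) (add_zero n) (add_zero 0)
        (add_zero n) (add_zero n), ← comp_sum, total, G.comp_id]
    rw [hexp f, hexp g]
    exact Finset.sum_congr rfl fun s _ =>
      congrArg (fun a => G.comp a (π s) (add_zero n)) (congrFun hfg s)
  · refine ⟨∑ s, G.comp (σ s) (π s) (add_zero n), funext fun s => ?_⟩
    change G.comp (∑ s, G.comp (σ s) (π s) (add_zero n)) (ι s) (add_zero n) = σ s
    rw [sum_comp, Finset.sum_eq_single s]
    · rw [G.assoc (σ s) (π s) (ι s) (add_zero n) (add_zero 0) (add_zero n) (add_zero n), hself,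
        G.comp_id]
    · intro s' _ hs
      rw [G.assoc (σ s') (π s') (ι s) (add_zero n) (add_zero 0) (add_zero n) (add_zero n),
        hne (Ne.symm hs), comp_zero]
    · exact fun h => absurd (Finset.mem_univ s) h

end GradedCat

/-! ### Shifts and cones of twisted complexes -/

namespace DGCat

variable {k : Type w} [CommRing k]

/-- A Maurer-Cartan element is transported along a strict closed isomorphism of degree `s` by
conjugation. The sign `(-1) ^ s` makes `σ` and `τ` closed for the twisted differentials. -/
theorem mcObj_exists_isoDeg {D : DGCat.{w, u, v} k} (X : D.MCObj) {X' : D.Obj} {s t : ℤ}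
    (hst : s + t = 0) (σ : D.Hom X' X.X s) (τ : D.Hom X.X X' t)
    (hσ : D.d s (s + 1) rfl σ = 0) (hτ : D.d t (t + 1) rfl τ = 0)
    (hστ : D.comp σ τ hst = D.id X.X) (hτσ : D.comp τ σ (by omega) = D.id X') :
    ∃ X' : D.MCObj, D.mcDG.cohomology.IsoDeg s X' X := by
  obtain rfl : t = -s := by omega
  have h1 : ∀ {a b : ℤ} {Y : D.Obj} (f : D.Hom Y X.X a) (e : -s + a = b) (e' : s + b = a),
      D.comp σ (D.comp τ f e) e' = f := by
    intro a b Y f e e'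
    rw [← D.assoc σ τ f hst e (by omega) e', hστ, D.id_comp]
  set y : D.Hom X' X' 1 := dgSign k s • D.comp τ (D.comp X.x σ (show 1 + s = s + 1 by omega))
    (show -s + (s + 1) = 1 by omega) with hy
  have h2 : D.comp σ y (show s + 1 = s + 1 from rfl) =
      dgSign k s • D.comp X.x σ (show 1 + s = s + 1 by omega) := by
    rw [hy, D.comp_smul, h1]
  have h3 : D.comp y τ (show 1 + -s = -s + 1 by omega) = dgSign k s • D.comp τ X.x rfl := by
    rw [hy, D.smul_comp, D.assoc τ _ τ _ (show s + 1 + -s = 1 by omega) _ rfl,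
      D.assoc X.x σ τ _ hst _ (add_zero 1), hστ, D.comp_id]
  have h4 : D.comp y y one_add_one_eq_two = D.comp τ (D.comp (D.comp X.x X.x one_add_one_eq_two) σ
      (show 2 + s = s + 2 by omega)) (show -s + (s + 2) = 2 by omega) := by
    conv_lhs => rw [hy]
    rw [D.smul_comp, D.assoc τ _ y _ (show s + 1 + 1 = s + 2 by omega) _ (by omega),
      D.assoc X.x σ y _ rfl _ (by omega), h2, D.comp_smul, D.comp_smul, dgSign_smul_smul,
      D.assoc X.x X.x σ one_add_one_eq_two (show 1 + s = s + 1 by omega) _ (by omega)]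
  have h5 : D.d 1 2 one_add_one_eq_two y = D.comp τ (D.comp (D.d 1 2 one_add_one_eq_two X.x) σ
      (show 2 + s = s + 2 by omega)) (show -s + (s + 2) = 2 by omega) := by
    rw [hy, map_smul, D.d_comp τ _ (show -s + (s + 1) = 1 by omega) one_add_one_eq_two rfl
      (show s + 1 + 1 = s + 2 by omega) (by omega) (by omega), hτ,
      D.d_comp X.x σ (show 1 + s = s + 1 by omega) (by omega) one_add_one_eq_two rfl (by omega)
        (by omega), hσ, GradedCat.zero_comp, GradedCat.comp_zero, smul_zero, zero_add, add_zero,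
      dgSign_neg, dgSign_smul_smul]
  let Z : D.MCObj := ⟨X', y, by
    rw [h4, h5, ← D.comp_add, ← D.add_comp, X.mc, GradedCat.zero_comp, GradedCat.comp_zero]⟩
  refine ⟨Z, isoDeg_of_closed (T := D.mcDG) (X := Z) (Y := X) hst σ τ ?_ ?_ hστ hτσ⟩
  · refine (D.mcD_apply Z X s (s + 1) rfl σ).trans ?_
    change _ + _ - dgSign k s • D.comp σ y _ = 0
    rw [h2, dgSign_smul_smul, hσ, zero_add, sub_self]
  · refine (D.mcD_apply X Z (-s) (-s + 1) rfl τ).trans ?_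
    change _ + D.comp y τ _ - _ = 0
    rw [h3, hτ, zero_add, dgSign_neg, sub_self]

variable {A : DGCat.{w, u, v} k}

/-- The identities `X^{i + s} = Y^i`, as a morphism of degree `n` when the degrees match. -/
def seqShift (hA : A.IsNonpositive) {X Y : (seqDG hA).Obj} (s n : ℤ) (hn : n = s)
    (h : ∀ i, X i = Y (i + s)) : (seqDG hA).Hom X Y n :=
  fun i j => if e : i + s = j then
    A.eqId (n := i - j + n) ((h i).trans (congrArg Y e)) (by omega) else 0

theorem d_seqShift (hA : A.IsNonpositive) {X Y : (seqDG hA).Obj} (s n : ℤ) (hn : n = s)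
    (h : ∀ i, X i = Y (i + s)) :
    (seqDG hA).d n (n + 1) rfl (seqShift hA s n hn h) = 0 := by
  funext i j
  rw [seqDG_d_apply, seqShift]
  split_ifs with e
  · rw [A.d_eqId, smul_zero]
    rfl
  · rw [map_zero, smul_zero]
    rfl

theorem eqId_comp_eqId {X Y Z : A.Obj} {m n r : ℤ} (hY : Y = Z) (hX : X = Y) (hm : 0 = m)
    (hn : 0 = n) (e : m + n = r) :
    A.comp (A.eqId hY hm) (A.eqId hX hn) e = A.eqId (hX.trans hY) (by omega) := by
  subst hX hY hm hn
  obtain rfl : r = 0 := by omega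
  exact A.id_comp _

theorem seqShift_comp_seqShift (hA : A.IsNonpositive) {X Y : (seqDG hA).Obj} (s t : ℤ)
    (hst : s + t = 0) (h : ∀ i, X i = Y (i + t)) (h' : ∀ i, Y i = X (i + s)) :
    (seqDG hA).comp (seqShift hA s s rfl h') (seqShift hA t t rfl h) hst = (seqDG hA).id X := by
  funext i j
  rw [seqDG_comp_apply]
  change _ = if e : i = j then A.eqId (n := i - j + 0) (congrArg X e) (by omega) else 0
  by_cases e : i = j
  · rw [dif_pos e, Finset.sum_eq_single (i + t)]
    · rw [seqShift, seqShift, dif_pos rfl, dif_pos (by omega), eqId_comp_eqId]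
    · intro l _ hl
      rw [seqShift, seqShift, dif_neg (Ne.symm hl), GradedCat.comp_zero]
    · intro hi
      exact absurd (Finset.mem_Icc.2 ⟨le_rfl, by omega⟩) hi
  · rw [dif_neg e]
    refine Finset.sum_eq_zero fun l _ => ?_
    by_cases hl : i + t = l
    · rw [seqShift, dif_neg (by omega), GradedCat.zero_comp]
    · rw [seqShift, seqShift, dif_neg hl, GradedCat.comp_zero]

theorem twNonpositive_exists_isoDeg (hA : A.IsNonpositive) (X : (twNonpositive hA).Obj) (s : ℤ) :
    ∃ X' : (twNonpositive hA).Obj, (twNonpositive hA).cohomology.IsoDeg s X' X := by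
  change MCObj _ at X
  -- The identity of `X^{i + s}`, placed in position `(i, i + s)`, has entry degree `0` exactly when
  -- the total degree is `s`.
  let X' : (seqDG hA).Obj := fun i => X.X (i + s)
  have h : ∀ i, X' i = X.X (i + s) := fun i => rfl
  have h' : ∀ i, X.X i = X' (i + -s) := fun i => congrArg X.X (by omega)
  exact mcObj_exists_isoDeg X (add_neg_cancel s) (seqShift hA s s rfl h)
    (seqShift hA (-s) (-s) rfl h') (d_seqShift hA _ _ _ _) (d_seqShift hA _ _ _ _)
    (seqShift_comp_seqShift hA s (-s) _ h' h) (seqShift_comp_seqShift hA (-s) s _ h h')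

/-- Only binary coproducts of the terms `X^i` and `Y^i` are needed, which explains the cardinal `2`
and the index type `Bool`. -/
theorem tw_exists_isHoCone (h : CategoryTheory.Limits.HasFiniteBiproducts A.H0) {X Y : A.Tw.Obj}
    (f : A.Tw.Hom X Y 1) (hf : A.Tw.d 1 2 one_add_one_eq_two f = 0) :
    ∃ (C : A.Tw.Obj) (j : A.Tw.Hom X C 0) (i : A.Tw.Hom Y C 0), A.Tw.IsHoCone f j i := by
  have H := A.cohomology.hasCoproductsLE_of_hasFiniteBiproducts h
    (κ := (2 : Cardinal.{0})) (by exact_mod_cast Cardinal.natCast_lt_aleph0 (n := 2))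
  change MCObj _ at X Y
  choose C ι hC using fun i : ℤ =>
    exists_isHoCoprod_trunc_addZero H (I := Bool) (by simp) fun s => pairObj X.X Y.X s i
  exact (seqFiltration A.addZero.trunc_isNonpositive).exists_isHoCone_mc X Y f hf
    (fun s => d_seqDiag fun i => (hC i).closed s)
    (isGrCoprod_seqDiag (X := fun s => pairObj X.X Y.X s) (C := C) (ι := fun s i => ι i s) hC)

theorem tw_isPretriangulated (h : CategoryTheory.Limits.HasFiniteBiproducts A.H0) :
    A.Tw.IsPretriangulated :=
  isPretriangulated_of_shifts_of_cones (twNonpositive_exists_isoDeg _) (tw_exists_isHoCone h)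

end DGCat

theorem mainTheorem5 {k : Type w} [CommRing k] (A : DGCat.{w, u, v} k)
    (κ : Cardinal.{t}) (hκ : κ.IsRegular)
    (hA : A.IsCohNonpositive)
    (hadd : CategoryTheory.Limits.HasFiniteBiproducts A.H0) :
    A.Tw.IsPretriangulated ∧
      (A.cohomology.HasCoproductsLE κ → A.Tw.cohomology.HasCoproductsLE κ) ∧
      (A.cohomology.HasProductsLE κ → A.Tw.cohomology.HasProductsLE κ) :=
  ⟨DGCat.tw_isPretriangulated hadd, DGCat.tw_hasCoproductsLE, DGCat.tw_hasProductsLE⟩
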